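/- All manifolds are smooth, connected, Hausdorff and second countable, without boundary; a Riemannian manifold carries a smooth metric, and $\nabla$ is its Levi-Civita connection. A doubly warped product is a Riemannian manifold of the form $$\bigl(I\times\hat M,\; dt^2\oplus\rho(t)^2\,\hat g_{\hat\eta}\oplus\sigma(t)^2\,\hat g_{\hat\eta^\perp}\bigr),$$ where $(\hat M,\hat g)$ is a connected Riemannian manifold with a unit Killing vector field $\hat\eta$, $\hat g_{\hat\eta}$ and $\hat g_{\hat\eta^\perp}$ are the components of $\hat g$ along $\mathbb R\hat\eta$ and $\hat\eta^\perp$, $I\subset\mathbb R$ is a non-empty open interval, and $\rho,\sigma\colon I\to\mathbb R$ are smooth positive functions. A local DWP-structure $(\nu,\eta)$ on a Riemannian manifold $(M,g)$ consists of a unit geodesic vector field $\nu$ (that is, $g(\nu,\nu)=1$ and $\nabla_\nu\nu=0$) whose orthogonal distribution $\nu^\perp$ is integrable, and a Killing vector field $\eta$ on $(M,g)$ that is not identically zero, is pointwise orthogonal to $\nu$ and has constant length along each integral leaf of $\nu^\perp$, such that there are functions $\lambda,\mu\colon M\to\mathbb R$, constant along each integral leaf of $\nu^\perp$, for which the Weingarten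 map $W=-\nabla\nu$ of the leaves satisfies $Wv=\lambda v$ for $v\in\mathbb R\eta$ and $Wv=\mu v$ for $v\in\eta^\perp\cap\nu^\perp$ (the case $\lambda=\mu$ is allowed). Proposition. Let $(M,g)$ be a connected Riemannian manifold of dimension $n+1\ge 1$. If $(M,g)$ is isometric to a doubly warped product, then $(M,g)$ admits a local DWP-structure. Conversely, if $(M,g)$ admits a local DWP-structure, then it is locally isometric to a doubly warped product, that is, every point of $M$ has an open neighbourhood that is isometric to a doubly warped product. -/

import Mathlib

open Bundle Set Function
open scoped Manifold ContDiff Topology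

universe u

namespace DWP

noncomputable section

section LeviCivita

variable {E : Type*} [NormedAddCommGroup E] [NormedSpace ℝ E]
  {H : Type*} [TopologicalSpace H] (I : ModelWithCorners ℝ E H)
  {M : Type*} [TopologicalSpace M] [ChartedSpace H M] [IsManifold I ∞ M]
  [RiemannianBundle (fun x : M => TangentSpace I x)]

/-- The Koszul expression, i.e. the value at `x` of
`g(∇_X Y, Z) = 1/2 (X g(Y,Z) + Y g(Z,X) - Z g(X,Y) + g([X,Y],Z) - g([Y,Z],X) + g([Z,X],Y))`. -/
def koszul (Y X Z : Π x : M, TangentSpace I x) (x : M) : ℝ :=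
  (1 / 2) * (mvfderiv I (fun y => inner ℝ (Y y) (Z y)) x (X x)
    + mvfderiv I (fun y => inner ℝ (Z y) (X y)) x (Y x)
    - mvfderiv I (fun y => inner ℝ (X y) (Y y)) x (Z x)
    + inner ℝ (VectorField.mlieBracket I X Y x) (Z x)
    - inner ℝ (VectorField.mlieBracket I Y Z x) (X x)
    + inner ℝ (VectorField.mlieBracket I Z X x) (Y x))

variable [FiniteDimensional ℝ E]
  [IsContMDiffRiemannianBundle I 1 E (fun x : M => TangentSpace I x)]

variable {I} in
theorem mdifferentiableAt_inner {x : M} {X Y : Π x : M, TangentSpace I x}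
    (hX : MDiffAt (T% X) x) (hY : MDiffAt (T% Y) x) :
    MDiffAt (fun y => (inner ℝ (X y) (Y y) : ℝ)) x :=
  MDifferentiableAt.inner_bundle (IB := I) (F := E) (E := fun x : M => TangentSpace I x)
    (b := fun y => y) hX hY

variable {I} in
theorem koszul_tensorial_left {x : M} {Y : Π x : M, TangentSpace I x}
    (hY : MDiffAt (T% Y) x) (Z : Π x : M, TangentSpace I x) (hZ : MDiffAt (T% Z) x) :
    TensorialAt I E (koszul I Y · Z x) x where
  smul {f X} hf hX := by
    have h1 := mvfderiv_fun_mul hf (mdifferentiableAt_inner hZ hX)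
    have h2 := mvfderiv_fun_mul hf (mdifferentiableAt_inner hX hY)
    simp only [koszul, VectorField.mlieBracket_smul_left hf hX,
      VectorField.mlieBracket_smul_right hf hX, Pi.smul_apply', inner_smul_left, inner_smul_right,
      inner_add_left, conj_trivial, h1, h2, neg_smul, inner_neg_left]
    simp [real_inner_comm]
    ring
  add {X X'} hX hX' := by
    have h1 := mvfderiv_fun_add (mdifferentiableAt_inner hZ hX) (mdifferentiableAt_inner hZ hX')
    have h2 := mvfderiv_fun_add (mdifferentiableAt_inner hX hY) (mdifferentiableAt_inner hX' hY)
    simp only [koszul, VectorField.mlieBracket_add_left hX hX',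
      VectorField.mlieBracket_add_right hX hX', Pi.add_apply, inner_add_left, inner_add_right,
      h1, h2]
    simp
    ring

variable {I} in
theorem koszul_tensorial_right {x : M} {Y : Π x : M, TangentSpace I x}
    (hY : MDiffAt (T% Y) x) (X : Π x : M, TangentSpace I x) (hX : MDiffAt (T% X) x) :
    TensorialAt I E (koszul I Y X · x) x where
  smul {f Z} hf hZ := by
    have h1 := mvfderiv_fun_mul hf (mdifferentiableAt_inner hY hZ)
    have h2 := mvfderiv_fun_mul hf (mdifferentiableAt_inner hZ hX)
    simp only [koszul, VectorField.mlieBracket_smul_left hf hZ,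
      VectorField.mlieBracket_smul_right hf hZ, Pi.smul_apply', inner_smul_left, inner_smul_right,
      inner_add_left, conj_trivial, h1, h2, neg_smul, inner_neg_left]
    simp [real_inner_comm]
    ring
  add {Z Z'} hZ hZ' := by
    have h1 := mvfderiv_fun_add (mdifferentiableAt_inner hY hZ) (mdifferentiableAt_inner hY hZ')
    have h2 := mvfderiv_fun_add (mdifferentiableAt_inner hZ hX) (mdifferentiableAt_inner hZ' hX)
    simp only [koszul, VectorField.mlieBracket_add_left hZ hZ',
      VectorField.mlieBracket_add_right hZ hZ', Pi.add_apply, inner_add_left, inner_add_right,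
      h1, h2]
    simp
    ring

instance (x : M) : FiniteDimensional ℝ (TangentSpace I x) :=
  inferInstanceAs (FiniteDimensional ℝ E)

open Classical in
/-- The covariant derivative `∇Y`, as a section of `End(TM)`: `leviCivitaAux I Y x v` is
`(∇_v Y)(x)`. Junk value `0` where `Y` is not differentiable. -/
def leviCivitaAux (Y : Π x : M, TangentSpace I x) (x : M) :
    TangentSpace I x →L[ℝ] TangentSpace I x :=
  if hY : MDiffAt (T% Y) x then
    (InnerProductSpace.toDual ℝ (TangentSpace I x)).symm.toContinuousLinearEquiv.toContinuousLinearMap ∘L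
      TensorialAt.mkHom₂ (fun X Z => koszul I Y X Z x) x (koszul_tensorial_left hY)
        (koszul_tensorial_right hY)
  else 0

variable {I} in
theorem inner_leviCivitaAux {x : M} {X Y Z : Π x : M, TangentSpace I x}
    (hX : MDiffAt (T% X) x) (hY : MDiffAt (T% Y) x) (hZ : MDiffAt (T% Z) x) :
    inner ℝ (leviCivitaAux I Y x (X x)) (Z x) = koszul I Y X Z x := by
  rw [leviCivitaAux, dif_pos hY]
  rw [← TensorialAt.mkHom₂_apply (koszul_tensorial_left hY) (koszul_tensorial_right hY) hX hZ]
  simp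

variable {I} in
theorem endomorphism_ext {x : M} {A B : TangentSpace I x →L[ℝ] TangentSpace I x}
    (h : ∀ X Z : Π x : M, TangentSpace I x, MDiffAt (T% X) x → MDiffAt (T% Z) x →
      (inner ℝ (A (X x)) (Z x) : ℝ) = inner ℝ (B (X x)) (Z x)) : A = B := by
  ext1 v
  refine ext_inner_right ℝ fun w => ?_
  simpa using h (FiberBundle.extend E v) (FiberBundle.extend E w)
    (FiberBundle.mdifferentiableAt_extend ..) (FiberBundle.mdifferentiableAt_extend ..)

/-- The Levi-Civita connection of a Riemannian manifold: `leviCivita I Y x v` is `(∇_v Y)(x)`. -/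
def leviCivita : CovariantDerivative I E (fun x : M => TangentSpace I x) where
  toFun := leviCivitaAux I
  isCovariantDerivativeOnUniv :=
    { add := by
        intro Y Y' x hY hY' _
        refine endomorphism_ext fun X Z hX hZ => ?_
        have hS : MDiffAt (T% (Y + Y')) x := mdifferentiableAt_add_section hY hY'
        have h1 := mvfderiv_fun_add (mdifferentiableAt_inner hY hZ) (mdifferentiableAt_inner hY' hZ)
        have h2 := mvfderiv_fun_add (mdifferentiableAt_inner hX hY) (mdifferentiableAt_inner hX hY')
        rw [inner_leviCivitaAux hX hS hZ, add_apply, inner_add_left,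
          inner_leviCivitaAux hX hY hZ, inner_leviCivitaAux hX hY' hZ]
        simp only [koszul, VectorField.mlieBracket_add_left hY hY',
          VectorField.mlieBracket_add_right hY hY', Pi.add_apply, inner_add_left, inner_add_right,
          h1, h2]
        simp
        ring
      leibniz := by
        intro Y f x hY hf _
        refine endomorphism_ext fun X Z hX hZ => ?_
        have hS : MDiffAt (T% (f • Y)) x := hf.smul_section hY
        have h1 := mvfderiv_fun_mul hf (mdifferentiableAt_inner hY hZ)
        have h2 := mvfderiv_fun_mul hf (mdifferentiableAt_inner hX hY)
        rw [inner_leviCivitaAux hX hS hZ, add_apply, inner_add_left,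
          smul_apply, inner_smul_left, inner_leviCivitaAux hX hY hZ]
        simp only [koszul, VectorField.mlieBracket_smul_left hf hY,
          VectorField.mlieBracket_smul_right hf hY, Pi.smul_apply', inner_smul_left,
          inner_smul_right, inner_add_left, conj_trivial, h1, h2, neg_smul, inner_neg_left]
        simp [real_inner_comm, real_inner_smul_right]
        ring }

variable {I} in
theorem inner_leviCivita {x : M} {X Y Z : Π x : M, TangentSpace I x}
    (hX : MDiffAt (T% X) x) (hY : MDiffAt (T% Y) x) (hZ : MDiffAt (T% Z) x) :
    inner ℝ (leviCivita I Y x (X x)) (Z x) = koszul I Y X Z x :=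
  inner_leviCivitaAux hX hY hZ

theorem leviCivita_torsion : (leviCivita I : CovariantDerivative I E
    (fun x : M => TangentSpace I x)).torsion = 0 := by
  rw [CovariantDerivative.torsion_eq_zero_iff]
  intro X Y x hX hY
  refine ext_inner_right ℝ fun w => ?_
  obtain ⟨Z, hZ, rfl⟩ : ∃ Z : Π x : M, TangentSpace I x, MDiffAt (T% Z) x ∧ Z x = w :=
    ⟨FiberBundle.extend E w, FiberBundle.mdifferentiableAt_extend .., by simp⟩
  rw [inner_sub_left, inner_leviCivita hX hY hZ, inner_leviCivita hY hX hZ, koszul, koszul,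
    VectorField.mlieBracket_swap_apply (V := Y) (W := X),
    VectorField.mlieBracket_swap_apply (V := Z) (W := Y),
    VectorField.mlieBracket_swap_apply (V := Z) (W := X)]
  simp only [inner_neg_left, real_inner_comm]
  ring

variable {I} in
theorem leviCivita_metric {x : M} {X Y Z : Π x : M, TangentSpace I x}
    (hX : MDiffAt (T% X) x) (hY : MDiffAt (T% Y) x) (hZ : MDiffAt (T% Z) x) :
    mvfderiv I (fun y => (inner ℝ (Y y) (Z y) : ℝ)) x (X x) =
      inner ℝ (leviCivita I Y x (X x)) (Z x) + inner ℝ (Y x) (leviCivita I Z x (X x)) := by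
  have h1 := inner_leviCivita hX hY hZ
  have h2 := inner_leviCivita hX hZ hY
  rw [real_inner_comm (leviCivita I Z x (X x)), h1, h2, koszul, koszul,
    VectorField.mlieBracket_swap_apply (V := Z) (W := Y),
    VectorField.mlieBracket_swap_apply (V := Z) (W := X),
    VectorField.mlieBracket_swap_apply (V := Y) (W := X)]
  simp only [inner_neg_left, real_inner_comm]
  ring

end LeviCivita

section Notions

variable {E : Type*} [NormedAddCommGroup E] [NormedSpace ℝ E] [FiniteDimensional ℝ E]
  {H : Type*} [TopologicalSpace H] (I : ModelWithCorners ℝ E H)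
  {M : Type*} [TopologicalSpace M] [ChartedSpace H M] [IsManifold I ∞ M]
  [RiemannianBundle (fun x : M => TangentSpace I x)]
  [IsContMDiffRiemannianBundle I ∞ E (fun x : M => TangentSpace I x)]

/-- A smooth vector field `ξ` is a Killing vector field if `∇ξ` is skew-symmetric. -/
structure IsKillingField (ξ : Π x : M, TangentSpace I x) : Prop where
  smooth : ContMDiff I I.tangent ∞ (T% ξ)
  skew : ∀ (x : M) (v w : TangentSpace I x),
    (inner ℝ (leviCivita I ξ x v) w + inner ℝ v (leviCivita I ξ x w) : ℝ) = 0

/-- A smooth vector field `ν` of length one with `∇_ν ν = 0`. -/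
structure IsUnitGeodesicField (ν : Π x : M, TangentSpace I x) : Prop where
  smooth : ContMDiff I I.tangent ∞ (T% ν)
  unit : ∀ x : M, (inner ℝ (ν x) (ν x) : ℝ) = 1
  geodesic : ∀ x : M, leviCivita I ν x (ν x) = 0

/-- The distribution `ν^⊥`. -/
def orthogonalDistribution (ν : Π x : M, TangentSpace I x) (x : M) :
    Submodule ℝ (TangentSpace I x) :=
  (Submodule.span ℝ {ν x})ᗮ

/-- The endomorphism `W = -∇ν`. Its restriction to `ν^⊥` is the Weingarten map of the integral
leaves of `ν^⊥`. -/
def weingarten (ν : Π x : M, TangentSpace I x) (x : M) :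
    TangentSpace I x →L[ℝ] TangentSpace I x :=
  -leviCivita I ν x

end Notions

section Distributions

variable {E : Type*} [NormedAddCommGroup E] [NormedSpace ℝ E]
  {H : Type*} [TopologicalSpace H] (I : ModelWithCorners ℝ E H)

/-- `i : N → M` is an integral manifold of the distribution `D` on `M`: an injectively immersed
`k`-dimensional manifold whose tangent spaces are the fibres of `D`. -/
structure IsIntegralManifold {M : Type*} [TopologicalSpace M] [ChartedSpace H M]
    (D : Π x : M, Submodule ℝ (TangentSpace I x)) {k : ℕ}
    {N : Type*} [TopologicalSpace N] [ChartedSpace (EuclideanSpace ℝ (Fin k)) N]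
    (i : N → M) : Prop where
  smooth : ContMDiff (𝓡 k) I ∞ i
  injective : Injective i
  immersion : ∀ y : N, Injective (mfderiv (𝓡 k) I i y)
  tangent : ∀ y : N, Set.range (mfderiv (𝓡 k) I i y) = D (i y)

/-- The distribution `D` of rank `k` is integrable: through each point of `M` there passes a
connected integral manifold of `D`. -/
def IsIntegrable {M : Type u} [TopologicalSpace M] [ChartedSpace H M]
    (D : Π x : M, Submodule ℝ (TangentSpace I x)) (k : ℕ) : Prop :=
  ∀ p : M, ∃ (N : Type u) (_ : TopologicalSpace N) (_ : ChartedSpace (EuclideanSpace ℝ (Fin k)) N)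
    (_ : IsManifold (𝓡 k) ∞ N) (_ : T2Space N) (_ : SecondCountableTopology N)
    (_ : ConnectedSpace N) (i : N → M), IsIntegralManifold I D (k := k) i ∧ p ∈ Set.range i

/-- `f` is constant along each integral leaf of the distribution `D` of rank `k`. As every
connected integral manifold lies in a leaf (a maximal one), this is constancy along all connected
integral manifolds. -/
def IsConstantAlongLeaves {M : Type u} [TopologicalSpace M] [ChartedSpace H M]
    (D : Π x : M, Submodule ℝ (TangentSpace I x)) (k : ℕ) (f : M → ℝ) : Prop :=
  ∀ (N : Type u) [TopologicalSpace N] [ChartedSpace (EuclideanSpace ℝ (Fin k)) N]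
    [IsManifold (𝓡 k) ∞ N] [T2Space N] [SecondCountableTopology N] [ConnectedSpace N]
    (i : N → M), IsIntegralManifold I D (k := k) i → ∀ y z : N, f (i y) = f (i z)

end Distributions

/-- `(ν, η)` is a local DWP-structure on the Riemannian manifold `M` of dimension `n + 1`.
The eigenvalues `lam` and `mu` are allowed to coincide. -/
structure IsLocalDWPStructure {n : ℕ} {M : Type u} [TopologicalSpace M]
    [ChartedSpace (EuclideanSpace ℝ (Fin (n + 1))) M] [IsManifold (𝓡 (n + 1)) ∞ M]
    [RiemannianBundle (fun x : M => TangentSpace (𝓡 (n + 1)) x)]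
    [IsContMDiffRiemannianBundle (𝓡 (n + 1)) ∞ (EuclideanSpace ℝ (Fin (n + 1)))
      (fun x : M => TangentSpace (𝓡 (n + 1)) x)]
    (ν η : Π x : M, TangentSpace (𝓡 (n + 1)) x) : Prop where
  unitGeodesic : IsUnitGeodesicField (𝓡 (n + 1)) ν
  integrable : IsIntegrable (𝓡 (n + 1)) (orthogonalDistribution (𝓡 (n + 1)) ν) n
  killing : IsKillingField (𝓡 (n + 1)) η
  nontrivial : ∃ x : M, η x ≠ 0
  orthogonal : ∀ x : M, (inner ℝ (η x) (ν x) : ℝ) = 0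
  length_const : IsConstantAlongLeaves (𝓡 (n + 1)) (orthogonalDistribution (𝓡 (n + 1)) ν) n
    (fun x => Real.sqrt (inner ℝ (η x) (η x)))
  weingarten_eigen : ∃ lam mu : M → ℝ,
    (∀ (x : M) (v : TangentSpace (𝓡 (n + 1)) x), v ∈ Submodule.span ℝ {η x} →
      weingarten (𝓡 (n + 1)) ν x v = lam x • v) ∧
    (∀ (x : M) (v : TangentSpace (𝓡 (n + 1)) x),
      v ∈ (Submodule.span ℝ {η x})ᗮ ⊓ orthogonalDistribution (𝓡 (n + 1)) ν x →
      weingarten (𝓡 (n + 1)) ν x v = mu x • v) ∧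
    IsConstantAlongLeaves (𝓡 (n + 1)) (orthogonalDistribution (𝓡 (n + 1)) ν) n lam ∧
    IsConstantAlongLeaves (𝓡 (n + 1)) (orthogonalDistribution (𝓡 (n + 1)) ν) n mu

/-- The data of a doubly warped product of dimension `n + 1`: a connected Riemannian manifold
`Mhat` of dimension `n` with a unit Killing vector field `etahat`, a nonempty open interval
`interval ⊆ ℝ`, and positive functions `rho` and `sigma` that are smooth on it. -/
structure DoublyWarpedProduct (n : ℕ) where
  Mhat : Type u
  [topologicalSpace : TopologicalSpace Mhat]
  [chartedSpace : ChartedSpace (EuclideanSpace ℝ (Fin n)) Mhat]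
  [isManifold : IsManifold (𝓡 n) ∞ Mhat]
  [t2Space : T2Space Mhat]
  [secondCountable : SecondCountableTopology Mhat]
  [connectedSpace : ConnectedSpace Mhat]
  [riemannianBundle : RiemannianBundle (fun x : Mhat => TangentSpace (𝓡 n) x)]
  [smoothMetric : IsContMDiffRiemannianBundle (𝓡 n) ∞ (EuclideanSpace ℝ (Fin n))
    (fun x : Mhat => TangentSpace (𝓡 n) x)]
  etahat : Π x : Mhat, TangentSpace (𝓡 n) x
  killing : IsKillingField (𝓡 n) etahat
  unit : ∀ x : Mhat, (inner ℝ (etahat x) (etahat x) : ℝ) = 1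
  interval : TopologicalSpace.Opens ℝ
  interval_nonempty : (interval : Set ℝ).Nonempty
  interval_ordConnected : (interval : Set ℝ).OrdConnected
  rho : ℝ → ℝ
  sigma : ℝ → ℝ
  rho_smooth : ContDiffOn ℝ ∞ rho interval
  sigma_smooth : ContDiffOn ℝ ∞ sigma interval
  rho_pos : ∀ t ∈ interval, 0 < rho t
  sigma_pos : ∀ t ∈ interval, 0 < sigma t

namespace DoublyWarpedProduct

attribute [instance] topologicalSpace chartedSpace isManifold t2Space secondCountable
  connectedSpace riemannianBundle smoothMetric

variable {n : ℕ} (D : DoublyWarpedProduct.{u} n)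

/-- The manifold `interval × Mhat` underlying the doubly warped product. -/
abbrev Carrier : Type u := D.interval × D.Mhat

/-- The component of the metric of `Mhat` along `ℝ etahat`. -/
def ghatEta (x : D.Mhat) (v w : TangentSpace (𝓡 n) x) : ℝ :=
  inner ℝ v (D.etahat x) * inner ℝ w (D.etahat x)

/-- The component of the metric of `Mhat` along the orthogonal complement of `etahat`. -/
def ghatPerp (x : D.Mhat) (v w : TangentSpace (𝓡 n) x) : ℝ :=
  inner ℝ v w - D.ghatEta x v w

/-- The differential `dt` of the coordinate `t` of the interval. -/
def dt (q : D.Carrier) : TangentSpace (𝓘(ℝ, ℝ).prod (𝓡 n)) q →L[ℝ] ℝ :=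
  mvfderiv (𝓘(ℝ, ℝ).prod (𝓡 n)) (fun q' : D.Carrier => ((q'.1 : D.interval) : ℝ)) q

/-- The differential of the projection to `Mhat`. -/
def dproj (q : D.Carrier) :
    TangentSpace (𝓘(ℝ, ℝ).prod (𝓡 n)) q →L[ℝ] TangentSpace (𝓡 n) q.2 :=
  mfderiv (𝓘(ℝ, ℝ).prod (𝓡 n)) (𝓡 n) (Prod.snd : D.Carrier → D.Mhat) q

/-- The metric `dt² + ρ(t)² ĝ_η̂ + σ(t)² ĝ_η̂^⊥` of the doubly warped product. -/
def metric (q : D.Carrier) (v w : TangentSpace (𝓘(ℝ, ℝ).prod (𝓡 n)) q) : ℝ :=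
  D.dt q v * D.dt q w
    + D.rho q.1 ^ 2 * D.ghatEta q.2 (D.dproj q v) (D.dproj q w)
    + D.sigma q.1 ^ 2 * D.ghatPerp q.2 (D.dproj q v) (D.dproj q w)

/-- The doubly warped product `D` is isometric to the open subset `U` of the Riemannian manifold
`M`: there is a diffeomorphism of `D` onto `U` (an injective local diffeomorphism with range `U`)
that pulls the metric of `M` back to the metric of `D`. -/
def IsIsometricTo {M : Type*} [TopologicalSpace M]
    [ChartedSpace (EuclideanSpace ℝ (Fin (n + 1))) M] [IsManifold (𝓡 (n + 1)) ∞ M]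
    [RiemannianBundle (fun x : M => TangentSpace (𝓡 (n + 1)) x)] (U : Set M) : Prop :=
  ∃ Φ : D.Carrier → M,
    IsLocalDiffeomorph (𝓘(ℝ, ℝ).prod (𝓡 n)) (𝓡 (n + 1)) ∞ Φ ∧ Injective Φ ∧ Set.range Φ = U ∧
    ∀ (q : D.Carrier) (v w : TangentSpace (𝓘(ℝ, ℝ).prod (𝓡 n)) q),
      (inner ℝ (mfderiv (𝓘(ℝ, ℝ).prod (𝓡 n)) (𝓡 (n + 1)) Φ q v)
        (mfderiv (𝓘(ℝ, ℝ).prod (𝓡 n)) (𝓡 (n + 1)) Φ q w) : ℝ) = D.metric q v w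

end DoublyWarpedProduct

end

end DWP

/-!
A manifold isometric to a doubly warped product carries the structure with `ν = ∂_t` and with `η`
the lift of the Killing field of the second factor; everything to be checked is a computation in
product coordinates (`DoublyWarpedProduct.exists_isLocalDWPStructure`).

Conversely, let `(ν, η)` be a local DWP-structure. The flow of `ν`, started on the integral leaf
through a given point, gives coordinates `(t, x)` with `ν = ∂_t` (`exists_flowBox`). As `ν` is a
unit geodesic field that is orthogonal to the leaf `t = 0`, the metric is `dt² + h_t`
(`IsFlowBox.coordMetric_fst`), so the slices `t = const` are integral leaves of `ν^⊥`, and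
`∂_t h_t = -2 h_t(W ·, ·)`. The Killing equation shows that the coefficients of `η` do not depend
on `t` (`IsFlowBox.coordField_eq`). Hence `η`, whose length is constant on the slices, vanishes
near each of its zeros, and by connectedness it has none (`killing_ne_zero`).

The equations `W = λ` on `ℝ η` and `W = μ` on the complement of `η` in `ν^⊥`, with `λ` and `μ`
functions of `t` alone, are linear ordinary differential equations for `h_t`. They show that `h_t`
arises from `h_0` by scaling the component along `η` and the component along its complement, each
by a function of `t` (`exists_warping`). So the flow box is isometric to a doubly warped product
over a ball in the leaf, with the restriction of `η`, divided by its length on the slice `t = 0`,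
as the unit Killing field (`DoublyWarpedProduct.isIsometricTo_ofCoordinates`).

Mathlib has integral curves, but not the smooth dependence of the flow on the initial value. It is
obtained here (`exists_smooth_flow`) from the inverse function theorem in the Banach space of
continuous curves. The Levi-Civita connection is computed in parametrizations by open subsets of a
vector space (`inner_leviCivita_coord`).
-/

namespace DWP

noncomputable section

/-! ### Smoothness of composition operators and the inverse function theorem -/

section CompositionOperator

variable {K : Type*} [TopologicalSpace K] [CompactSpace K]

/-- The pointwise extension `(γ, δ) ↦ (t ↦ B (γ t) (δ t))` of a continuous bilinear map `B` to
spaces of continuous functions on a compact space. -/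
def pointwiseBilin {L E F : Type*} [NormedAddCommGroup L] [NormedSpace ℝ L] [NormedAddCommGroup E]
    [NormedSpace ℝ E] [NormedAddCommGroup F] [NormedSpace ℝ F] (B : L →L[ℝ] E →L[ℝ] F) :
    C(K, L) →L[ℝ] C(K, E) →L[ℝ] C(K, F) :=
  LinearMap.mkContinuous₂ (E := C(K, L)) (F := C(K, E)) (G := C(K, F))
    (LinearMap.mk₂ ℝ (fun (A : C(K, L)) (γ : C(K, E)) =>
        (⟨fun t => B (A t) (γ t),
          (B.continuous.comp A.continuous).clm_apply γ.continuous⟩ : C(K, F)))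
      (fun A B γ => by ext; simp) (fun c A γ => by ext; simp)
      (fun A γ δ => by ext; simp) (fun c A γ => by ext; simp)) ‖B‖
    (fun A γ => by
      rw [ContinuousMap.norm_le _ (by positivity)]
      intro t
      simp only [LinearMap.mk₂_apply, ContinuousMap.coe_mk]
      exact B.le_of_opNorm₂_le_of_le le_rfl (A.norm_coe_le_norm t) (γ.norm_coe_le_norm t))

@[simp]
theorem pointwiseBilin_apply {L E F : Type*} [NormedAddCommGroup L] [NormedSpace ℝ L]
    [NormedAddCommGroup E] [NormedSpace ℝ E] [NormedAddCommGroup F] [NormedSpace ℝ F]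
    (B : L →L[ℝ] E →L[ℝ] F) (A : C(K, L)) (γ : C(K, E)) (t : K) :
    pointwiseBilin B A γ t = B (A t) (γ t) := rfl

theorem hasFDerivAt_comp_continuousMap {L E F : Type*} [NormedAddCommGroup L] [NormedSpace ℝ L]
    [NormedAddCommGroup E] [NormedSpace ℝ E] [NormedAddCommGroup F] [NormedSpace ℝ F]
    (B : L →L[ℝ] E →L[ℝ] F) {v : E → F} {v' : E → L}
    (hv : ∀ x, HasFDerivAt v (B (v' x)) x) (hc : Continuous v) (hc' : Continuous v') (γ : C(K, E)) :
    HasFDerivAt (fun γ : C(K, E) => (ContinuousMap.mk v hc).comp γ)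
      (pointwiseBilin B ((ContinuousMap.mk v' hc').comp γ)) γ := by
  rw [hasFDerivAt_iff_isLittleO_nhds_zero, Asymptotics.isLittleO_iff]
  intro ε hε
  have hB : 0 < ‖B‖ + 1 := by positivity
  have hcont : Continuous fun γ : C(K, E) => (ContinuousMap.mk v' hc').comp γ :=
    ContinuousMap.continuous_postcomp _
  obtain ⟨δ, hδ, h⟩ := Metric.continuous_iff.1 hcont γ (ε / (‖B‖ + 1)) (by positivity)
  filter_upwards [Metric.ball_mem_nhds (0 : C(K, E)) hδ] with k hk
  rw [ContinuousMap.norm_le _ (by positivity)]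
  intro t
  have hseg : ∀ x ∈ segment ℝ (γ t) (γ t + k t), ‖B (v' x) - B (v' (γ t))‖ ≤ ε := by
    intro x hx
    rw [segment_eq_image'] at hx
    obtain ⟨s, hs, rfl⟩ := hx
    have h1 : dist (γ + s • k) γ < δ := by
      rw [dist_eq_norm, add_sub_cancel_left, norm_smul, Real.norm_of_nonneg hs.1]
      have : ‖k‖ < δ := by simpa using hk
      nlinarith [norm_nonneg k, hs.2]
    have h2 := (ContinuousMap.dist_apply_le_dist t).trans_lt (h _ h1)
    simp only [ContinuousMap.comp_apply, ContinuousMap.coe_mk, dist_eq_norm] at h2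
    rw [← map_sub, add_sub_cancel_left]
    refine (B.le_opNorm_of_le h2.le).trans ?_
    rw [mul_div_assoc', div_le_iff₀ hB]
    nlinarith
  have := (convex_segment (γ t) (γ t + k t)).norm_image_sub_le_of_norm_hasFDerivWithin_le'
    (fun x hx => (hv x).hasFDerivWithinAt) hseg (left_mem_segment _ _ _) (right_mem_segment _ _ _)
  simp only [add_sub_cancel_left] at this
  refine (le_trans (le_of_eq ?_) this).trans ?_
  · simp
  · exact mul_le_mul_of_nonneg_left (k.norm_coe_le_norm t) hε.le

/-- Left composition with a smooth map is a smooth operator between spaces of continuous functions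
on a compact space. -/
theorem contDiff_comp_continuousMap_nat (n : ℕ) {E F : Type u} [NormedAddCommGroup E]
    [NormedSpace ℝ E] [NormedAddCommGroup F] [NormedSpace ℝ F] {v : E → F} (hv : ContDiff ℝ n v) :
    ContDiff ℝ n (fun γ : C(K, E) => (ContinuousMap.mk v hv.continuous).comp γ) := by
  induction n generalizing F with
  | zero =>
    exact contDiff_zero.2 (ContinuousMap.continuous_postcomp _)
  | succ n ih =>
    have hv' : ContDiff ℝ n (fderiv ℝ v) := hv.fderiv_right (by simp)
    refine contDiff_succ_iff_hasFDerivAt.2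
      ⟨_, ?_, hasFDerivAt_comp_continuousMap (ContinuousLinearMap.id ℝ (E →L[ℝ] F))
        (v' := fderiv ℝ v) (fun x => ((hv.differentiable (by simp)) x).hasFDerivAt) hv.continuous
        hv'.continuous⟩
    exact (pointwiseBilin (ContinuousLinearMap.id ℝ (E →L[ℝ] F))).contDiff.comp (ih hv')

theorem contDiff_comp_continuousMap {E F : Type u} [NormedAddCommGroup E]
    [NormedSpace ℝ E] [NormedAddCommGroup F] [NormedSpace ℝ F] {v : E → F} (hv : ContDiff ℝ ∞ v) :
    ContDiff ℝ ∞ (fun γ : C(K, E) => (ContinuousMap.mk v hv.continuous).comp γ) :=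
  contDiff_infty.2 fun n => contDiff_comp_continuousMap_nat n (hv.of_le (by exact_mod_cast le_top))

end CompositionOperator

section InverseFunction

/-- The inverse function theorem for a `C^∞` map on an open set: the local inverse is `C^∞` on all
of its domain. -/
theorem exists_openPartialHomeomorph_of_isInvertible {X Y : Type*} [NormedAddCommGroup X]
    [NormedSpace ℝ X] [CompleteSpace X] [NormedAddCommGroup Y] [NormedSpace ℝ Y]
    {f : X → Y} {s : Set X} (hs : IsOpen s) (hf : ContDiffOn ℝ ∞ f s) {a : X} (ha : a ∈ s)
    (hinv : (fderiv ℝ f a).IsInvertible) :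
    ∃ e : OpenPartialHomeomorph X Y, a ∈ e.source ∧ e.source ⊆ s ∧ ⇑e = f ∧
      ContDiffOn ℝ ∞ e.symm e.target := by
  obtain ⟨A, hA⟩ := hinv
  have hcd : ContDiffAt ℝ ∞ f a := hf.contDiffAt (hs.mem_nhds ha)
  have hfa : HasFDerivAt f (A : X →L[ℝ] Y) a := by
    rw [hA]; exact (hcd.differentiableAt (by simp)).hasFDerivAt
  let e₀ := hcd.toOpenPartialHomeomorph f hfa (by simp)
  have hcont : ContinuousOn (fderiv ℝ f) s := hf.continuousOn_fderiv_of_isOpen hs (by simp)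
  have hopen : IsOpen (s ∩ fderiv ℝ f ⁻¹' range ((↑) : (X ≃L[ℝ] Y) → X →L[ℝ] Y)) :=
    hcont.isOpen_inter_preimage hs ContinuousLinearEquiv.isOpen
  let e := e₀.restrOpen _ hopen
  have hes : e.source ⊆ s ∩ fderiv ℝ f ⁻¹' range ((↑) : (X ≃L[ℝ] Y) → X →L[ℝ] Y) := by
    intro x hx
    rw [OpenPartialHomeomorph.restrOpen_source] at hx
    exact hx.2
  have hef : ⇑e = f := rfl
  refine ⟨e, ?_, fun x hx => (hes hx).1, hef, ?_⟩
  · rw [OpenPartialHomeomorph.restrOpen_source]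
    exact ⟨hcd.mem_toOpenPartialHomeomorph_source hfa (by simp), ha, A, hA⟩
  · intro y hy
    have hx := hes (e.map_target hy)
    obtain ⟨B, hB⟩ := hx.2
    have hcx : ContDiffAt ℝ ∞ f (e.symm y) := hf.contDiffAt (hs.mem_nhds hx.1)
    refine (e.contDiffAt_symm hy (f₀' := B) ?_ hcx).contDiffWithinAt
    rw [hB]
    exact (hcx.differentiableAt (by simp)).hasFDerivAt

end InverseFunction

/-! ### Smooth dependence of integral curves on the initial value -/

section Flow

variable {E : Type u} [NormedAddCommGroup E] [NormedSpace ℝ E]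

theorem continuous_primitive_unitInterval (γ : C(unitInterval, E)) :
    Continuous fun t : ℝ => ∫ s in (0 : ℝ)..t, IccExtend zero_le_one γ s :=
  intervalIntegral.continuous_primitive
    (fun _ _ => (γ.continuous.Icc_extend').intervalIntegrable _ _) 0

/-- The primitive `γ ↦ (t ↦ ∫ s in 0..t, γ s)` as an operator on continuous curves `[0, 1] → E`. -/
def primitiveL : C(unitInterval, E) →L[ℝ] C(unitInterval, E) :=
  LinearMap.mkContinuous (E := C(unitInterval, E)) (F := C(unitInterval, E))
    { toFun := fun γ => ⟨fun t => ∫ s in (0 : ℝ)..t, IccExtend zero_le_one γ s,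
        (continuous_primitive_unitInterval γ).comp continuous_subtype_val⟩
      map_add' := fun γ δ => by
        ext t
        simp only [ContinuousMap.coe_mk, ContinuousMap.add_apply]
        rw [← intervalIntegral.integral_add
          ((γ.continuous.Icc_extend').intervalIntegrable _ _)
          ((δ.continuous.Icc_extend').intervalIntegrable _ _)]
        rfl
      map_smul' := fun c γ => by
        ext t
        simp only [ContinuousMap.coe_mk, ContinuousMap.smul_apply, RingHom.id_apply]
        rw [← intervalIntegral.integral_smul]
        rfl } 1
    (fun γ => by
      rw [ContinuousMap.norm_le _ (by positivity)]
      intro t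
      refine (intervalIntegral.norm_integral_le_of_norm_le_const (C := ‖γ‖)
        fun s _ => γ.norm_coe_le_norm _).trans ?_
      rw [sub_zero, abs_of_nonneg t.2.1, one_mul]
      exact mul_le_of_le_one_right (norm_nonneg _) t.2.2)

theorem primitiveL_apply (γ : C(unitInterval, E)) (t : unitInterval) :
    primitiveL γ t = ∫ s in (0 : ℝ)..t, IccExtend zero_le_one γ s := rfl

/-- Constant curves, as a continuous linear map. -/
def constCurveL : E →L[ℝ] C(unitInterval, E) :=
  ContinuousLinearMap.const ℝ unitInterval

@[simp]
theorem constCurveL_apply (x : E) (t : unitInterval) : constCurveL x t = x := rfl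

/-- The zeros of the last component are the triples `(ε, x, γ)` for which `γ` solves
`γ' = ε v(γ)`, `γ 0 = x`. -/
def picardMap (v : C(E, E)) (q : ℝ × E × C(unitInterval, E)) : ℝ × E × C(unitInterval, E) :=
  (q.1, q.2.1, q.2.2 - constCurveL q.2.1 - q.1 • primitiveL (v.comp q.2.2))

theorem contDiff_picardMap {v : E → E} (hv : ContDiff ℝ ∞ v) :
    ContDiff ℝ ∞ (picardMap ⟨v, hv.continuous⟩) := by
  have h1 : ContDiff ℝ ∞ fun q : ℝ × E × C(unitInterval, E) => q.2.2 := contDiff_snd.snd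
  have h2 := (contDiff_comp_continuousMap (K := unitInterval) hv).comp h1
  have h3 : ContDiff ℝ ∞ fun q : ℝ × E × C(unitInterval, E) => constCurveL q.2.1 :=
    (ContinuousLinearMap.contDiff (F := C(unitInterval, E)) constCurveL).comp contDiff_snd.fst
  have h4 : ContDiff ℝ ∞ fun q : ℝ × E × C(unitInterval, E) =>
      q.1 • primitiveL ((ContinuousMap.mk v hv.continuous).comp q.2.2) :=
    contDiff_fst.smul ((ContinuousLinearMap.contDiff (E := C(unitInterval, E))
      (F := C(unitInterval, E)) primitiveL).comp h2)
  exact contDiff_fst.prodMk (contDiff_snd.fst.prodMk ((h1.sub h3).sub h4))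

theorem isInvertible_fderiv_picardMap {v : E → E} (hv : ContDiff ℝ ∞ v) (x₀ : E) :
    (fderiv ℝ (picardMap ⟨v, hv.continuous⟩) (0, x₀, constCurveL x₀)).IsInvertible := by
  set v' : C(E, E) := ⟨v, hv.continuous⟩ with hv'
  set c : C(unitInterval, E) := primitiveL (v'.comp (constCurveL x₀))
  let X := C(unitInterval, E)
  let p1 : ℝ × E × X →L[ℝ] ℝ := ContinuousLinearMap.fst ℝ ℝ (E × X)
  let p2 : ℝ × E × X →L[ℝ] E :=
    (ContinuousLinearMap.fst ℝ E X).comp (ContinuousLinearMap.snd ℝ ℝ (E × X))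
  let p3 : ℝ × E × X →L[ℝ] X :=
    (ContinuousLinearMap.snd ℝ E X).comp (ContinuousLinearMap.snd ℝ ℝ (E × X))
  let A : ℝ × E × X →L[ℝ] ℝ × E × X :=
    p1.prod (p2.prod (p3 - constCurveL.comp p2 - p1.smulRight c))
  let B : ℝ × E × X →L[ℝ] ℝ × E × X :=
    p1.prod (p2.prod (p3 + constCurveL.comp p2 + p1.smulRight c))
  have hA : HasFDerivAt (picardMap v') A (0, x₀, constCurveL x₀) := by
    have h1 : HasFDerivAt (fun q : ℝ × E × X => q.1) p1 (0, x₀, constCurveL x₀) := p1.hasFDerivAt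
    have h2 : HasFDerivAt (fun q : ℝ × E × X => q.2.1) p2 (0, x₀, constCurveL x₀) := p2.hasFDerivAt
    have h3 : HasFDerivAt (fun q : ℝ × E × X => q.2.2) p3 (0, x₀, constCurveL x₀) := p3.hasFDerivAt
    have hd : DifferentiableAt ℝ (fun q : ℝ × E × X => primitiveL (v'.comp q.2.2))
        (0, x₀, constCurveL x₀) :=
      (primitiveL.contDiff.comp ((contDiff_comp_continuousMap (K := unitInterval) hv).comp
        (contDiff_snd.snd (n := ∞)))).differentiable (by simp) _
    have h4 := h1.smul hd.hasFDerivAt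
    refine (h1.prodMk (h2.prodMk
      ((h3.sub (constCurveL.hasFDerivAt.comp _ h2)).sub h4))).congr_fderiv ?_
    ext q <;> simp [A, p1, p2, p3, c]
  rw [hA.fderiv]
  refine ⟨ContinuousLinearEquiv.equivOfInverse A B ?_ ?_, rfl⟩
  · intro q
    refine Prod.ext rfl (Prod.ext rfl ?_)
    simp [A, B, p1, p2, p3]
    abel
  · intro q
    refine Prod.ext rfl (Prod.ext rfl ?_)
    simp [A, B, p1, p2, p3]
    abel

/-- Rescaling the time of a curve. -/
def rescale (t : unitInterval) (γ : C(unitInterval, E)) : C(unitInterval, E) :=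
  γ.comp ⟨fun s => t * s, by fun_prop⟩

omit [NormedSpace ℝ E] in
theorem rescale_apply (t s : unitInterval) (γ : C(unitInterval, E)) :
    rescale t γ s = γ (t * s) := rfl

theorem primitiveL_rescale (t s : unitInterval) (γ : C(unitInterval, E)) :
    (t : ℝ) • primitiveL (rescale t γ) s = primitiveL γ (t * s) := by
  simp only [primitiveL_apply]
  have h : ∀ r ∈ uIcc (0 : ℝ) s, IccExtend zero_le_one (rescale t γ) r =
      IccExtend zero_le_one γ (r * t) := by
    intro r hr
    rw [uIcc_of_le s.2.1] at hr
    have hr1 : r ∈ Icc (0 : ℝ) 1 := ⟨hr.1, hr.2.trans s.2.2⟩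
    have hr2 : r * t ∈ Icc (0 : ℝ) 1 :=
      ⟨mul_nonneg hr.1 t.2.1, mul_le_one₀ hr1.2 t.2.1 t.2.2⟩
    rw [IccExtend_of_mem _ _ hr1, IccExtend_of_mem _ _ hr2, rescale_apply]
    congr 1
    exact Subtype.ext (mul_comm _ _)
  rw [intervalIntegral.integral_congr h, intervalIntegral.smul_integral_comp_mul_right]
  simp [mul_comm]

theorem picardMap_rescale (v : C(E, E)) (t : unitInterval) {ε : ℝ} {x : E}
    {γ : C(unitInterval, E)} (h : picardMap v (ε, x, γ) = (ε, x, 0)) :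
    picardMap v (t * ε, x, rescale t γ) = (t * ε, x, 0) := by
  simp only [picardMap, Prod.mk.injEq, true_and] at h ⊢
  ext s
  have h' := DFunLike.congr_fun h (t * s)
  have h2 : v.comp (rescale t γ) = rescale t (v.comp γ) := rfl
  have h3 := primitiveL_rescale t s (v.comp γ)
  simp only [ContinuousMap.sub_apply, ContinuousMap.smul_apply, constCurveL_apply,
    ContinuousMap.zero_apply] at h' ⊢
  rw [← h3] at h'
  rw [h2, rescale_apply, mul_comm (t : ℝ) ε, mul_smul, h']

/-- A smooth vector field on a Banach space has a local flow that is smooth in time and the initial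
value. The integral curves, with their time scaled to `[0, 1]`, are obtained from the inverse
function theorem in the space of continuous curves. -/
theorem exists_smooth_flow [CompleteSpace E] {v : E → E} (hv : ContDiff ℝ ∞ v) (x₀ : E) :
    ∃ (W : Set (ℝ × E)) (θ : ℝ × E → E), IsOpen W ∧ (0, x₀) ∈ W ∧ ContDiffOn ℝ ∞ θ W ∧
      (∀ x, (0, x) ∈ W → θ (0, x) = x) ∧
      ∀ q ∈ W, HasDerivAt (fun s => θ (s, q.2)) (v (θ q)) q.1 := by
  set v' : C(E, E) := ⟨v, hv.continuous⟩ with hv'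
  obtain ⟨e₀, ha, -, he₀, hsymm₀⟩ := exists_openPartialHomeomorph_of_isInvertible isOpen_univ
    (contDiff_picardMap hv).contDiffOn (mem_univ _) (isInvertible_fderiv_picardMap hv x₀)
  obtain ⟨δ, hδ, hball⟩ := Metric.isOpen_iff.1 e₀.open_source _ ha
  -- On a ball of the sup metric, the domain is stable under rescaling of time.
  let e := e₀.restrOpen (Metric.ball (0, x₀, constCurveL x₀) δ) Metric.isOpen_ball
  have hes : e.source = Metric.ball (0, x₀, constCurveL x₀) δ := by
    rw [OpenPartialHomeomorph.restrOpen_source]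
    exact inter_eq_right.2 hball
  have he : ⇑e = picardMap v' := he₀
  have het : e.target ⊆ e₀.target := by
    intro y hy
    have := e.map_target hy
    rw [OpenPartialHomeomorph.restrOpen_source] at this
    rw [← e.right_inv hy]
    exact e₀.map_source this.1
  have hsymm : ContDiffOn ℝ ∞ e.symm e.target := hsymm₀.mono het
  let W : Set (ℝ × E) := (fun q : ℝ × E => (q.1, q.2, (0 : C(unitInterval, E)))) ⁻¹' e.target
  have hj : ContDiff ℝ ∞ fun q : ℝ × E => (q.1, q.2, (0 : C(unitInterval, E))) :=
    contDiff_fst.prodMk (contDiff_snd.prodMk contDiff_const)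
  let γ : ℝ × E → C(unitInterval, E) := fun q => (e.symm (q.1, q.2, 0)).2.2
  let ev : C(unitInterval, E) →L[ℝ] E := ContinuousMap.evalCLM ℝ (1 : unitInterval)
  have hγ : ∀ q ∈ W, e.symm (q.1, q.2, 0) = (q.1, q.2, γ q) ∧
      picardMap v' (q.1, q.2, γ q) = (q.1, q.2, 0) := by
    intro q hq
    have h1 := e.right_inv hq
    rw [he] at h1
    have h2 : e.symm (q.1, q.2, 0) = (q.1, q.2, γ q) := by
      simp only [picardMap, Prod.mk.injEq] at h1
      exact Prod.ext h1.1 (Prod.ext h1.2.1 rfl)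
    exact ⟨h2, h2 ▸ h1⟩
  have hscale : ∀ q ∈ W, ∀ t : unitInterval, ((t : ℝ) * q.1, q.2) ∈ W ∧
      γ ((t : ℝ) * q.1, q.2) = rescale t (γ q) := by
    intro q hq t
    have h1 := picardMap_rescale v' t (hγ q hq).2
    have hm : (q.1, q.2, γ q) ∈ e.source := (hγ q hq).1 ▸ e.map_target hq
    have hm' : ((t : ℝ) * q.1, q.2, rescale t (γ q)) ∈ e.source := by
      rw [hes] at hm ⊢
      simp only [Metric.mem_ball, Prod.dist_eq, max_lt_iff, dist_zero_right] at hm ⊢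
      refine ⟨?_, hm.2.1, lt_of_le_of_lt ?_ hm.2.2⟩
      · refine lt_of_le_of_lt ?_ hm.1
        rw [norm_mul, Real.norm_of_nonneg t.2.1]
        exact mul_le_of_le_one_left (norm_nonneg _) t.2.2
      · rw [ContinuousMap.dist_le dist_nonneg]
        intro s
        exact ContinuousMap.dist_apply_le_dist (f := γ q) (g := constCurveL x₀) (t * s)
    have h2 : e ((t : ℝ) * q.1, q.2, rescale t (γ q)) = ((t : ℝ) * q.1, q.2, 0) := by rw [he, h1]
    refine ⟨?_, ?_⟩
    · change ((t : ℝ) * q.1, q.2, (0 : C(unitInterval, E))) ∈ e.target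
      rw [← h2]
      exact e.map_source hm'
    · simp only [γ]
      rw [← h2, e.left_inv hm']
  have hWo : IsOpen W := e.open_target.preimage hj.continuous
  have hθs : ContDiffOn ℝ ∞ (fun q => ev (γ q)) W :=
    ev.contDiff.comp_contDiffOn ((contDiff_snd.snd.comp_contDiffOn hsymm).comp hj.contDiffOn
      fun q hq => hq)
  have hint : ∀ q ∈ W, ev (γ q) = q.2 + ∫ s in (0 : ℝ)..q.1, v (ev (γ (s, q.2))) := by
    intro q hq
    have h1 := (hγ q hq).2
    simp only [picardMap, Prod.mk.injEq, true_and] at h1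
    have h2 := DFunLike.congr_fun h1 1
    simp only [ContinuousMap.sub_apply, ContinuousMap.smul_apply, constCurveL_apply,
      ContinuousMap.zero_apply, primitiveL_apply] at h2
    have h3 : ∀ r ∈ uIcc (0 : ℝ) 1, IccExtend zero_le_one (v'.comp (γ q)) r =
        v (ev (γ (r * q.1, q.2))) := by
      intro r hr
      rw [uIcc_of_le zero_le_one] at hr
      rw [IccExtend_of_mem _ _ hr, (hscale q hq ⟨r, hr⟩).2]
      simp [ev, rescale_apply, v']
    have h4 : ((1 : unitInterval) : ℝ) = 1 := rfl
    rw [h4, intervalIntegral.integral_congr h3,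
      intervalIntegral.smul_integral_comp_mul_right (fun s => v (ev (γ (s, q.2))))] at h2
    simp only [zero_mul, one_mul] at h2
    rw [sub_sub, sub_eq_zero] at h2
    exact h2
  refine ⟨W, fun q => ev (γ q), hWo, ?_, hθs, ?_, ?_⟩
  · have h1 : e (0, x₀, constCurveL x₀) = (0, x₀, 0) := by
      rw [he]; simp [picardMap]
    change (0, x₀, (0 : C(unitInterval, E))) ∈ e.target
    rw [← h1]
    exact e.map_source (by rw [hes]; exact Metric.mem_ball_self hδ)
  · intro x hx
    simpa using hint _ hx
  · rintro ⟨τ, x⟩ hq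
    have hcW : ContinuousOn (fun s : ℝ => v (ev (γ (s, x)))) {s | (s, x) ∈ W} :=
      hv.continuous.comp_continuousOn (hθs.continuousOn.comp
        (Continuous.prodMk_left x).continuousOn fun s hs => hs)
    have hWx : IsOpen {s : ℝ | (s, x) ∈ W} := hWo.preimage (Continuous.prodMk_left x)
    have hsub : uIcc 0 τ ⊆ {s | (s, x) ∈ W} := by
      intro s hs
      have : s ∈ segment ℝ (0 : ℝ) τ := by rwa [segment_eq_uIcc]
      rw [segment_eq_image'] at this
      obtain ⟨t, ht, rfl⟩ := this
      simpa using (hscale _ hq ⟨t, ht⟩).1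
    have hd := intervalIntegral.integral_hasDerivAt_right
      (hcW.mono hsub).intervalIntegrable
      (hcW.stronglyMeasurableAtFilter hWx τ hq) (hcW.continuousAt (hWx.mem_nhds hq))
    refine (hd.const_add x).congr_of_eventuallyEq ?_
    filter_upwards [hWx.mem_nhds hq] with s hs
    exact hint _ hs

end Flow

/-! ### Vector fields, the metric and the Levi-Civita connection in a parametrization -/

section Calculus

variable {F : Type*} [NormedAddCommGroup F] [NormedSpace ℝ F]

theorem hasFDerivAt_bilin_apply {G : F → F →L[ℝ] F →L[ℝ] ℝ} {y : F → F} {u : F}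
    (hG : DifferentiableAt ℝ G u) (hy : DifferentiableAt ℝ y u) (c : F) :
    HasFDerivAt (fun w => G w (y w) c)
      (((fderiv ℝ G u).flip (y u) + (G u).comp (fderiv ℝ y u)).flip c) u := by
  have h := (hG.hasFDerivAt.clm_apply hy.hasFDerivAt).clm_apply (hasFDerivAt_const c u)
  refine h.congr_fderiv ?_
  ext v
  simp [add_comm]

theorem fderiv_bilin_apply {G : F → F →L[ℝ] F →L[ℝ] ℝ} {y : F → F} {u : F}
    (hG : DifferentiableAt ℝ G u) (hy : DifferentiableAt ℝ y u) (c v : F) :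
    fderiv ℝ (fun w => G w (y w) c) u v = fderiv ℝ G u v (y u) c + G u (fderiv ℝ y u v) c := by
  rw [(hasFDerivAt_bilin_apply hG hy c).fderiv]
  simp

theorem fderiv_bilin_const_apply {G : F → F →L[ℝ] F →L[ℝ] ℝ} {u : F}
    (hG : DifferentiableAt ℝ G u) (a c v : F) :
    fderiv ℝ (fun w => G w a c) u v = fderiv ℝ G u v a c := by
  have h := fderiv_bilin_apply hG (differentiableAt_const a) c v
  simpa using h

theorem fderiv_bilin_symm {G : F → F →L[ℝ] F →L[ℝ] ℝ} {u : F} (hG : DifferentiableAt ℝ G u)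
    (hs : ∀ᶠ w in 𝓝 u, ∀ a b, G w a b = G w b a) (v a b : F) :
    fderiv ℝ G u v a b = fderiv ℝ G u v b a := by
  rw [← fderiv_bilin_const_apply hG, ← fderiv_bilin_const_apply hG]
  have h : (fun w => G w a b) =ᶠ[𝓝 u] fun w => G w b a := hs.mono fun w hw => hw a b
  rw [h.fderiv_eq]

end Calculus

theorem mdifferentiableAt_vectorSpace {F : Type*} [NormedAddCommGroup F] [NormedSpace ℝ F]
    {y : F → F} {u : F} (hy : DifferentiableAt ℝ y u) :
    MDifferentiableAt 𝓘(ℝ, F) 𝓘(ℝ, F).tangent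
      (fun x => TotalSpace.mk' F (E := fun x : F => TangentSpace 𝓘(ℝ, F) x) x (y x)) u := by
  refine (mdifferentiableAt_totalSpace _ _).2 ⟨mdifferentiableAt_id, ?_⟩
  convert! hy.mdifferentiableAt with y
  simp

theorem mlieBracket_eq_lieBracket {F : Type*} [NormedAddCommGroup F] [NormedSpace ℝ F]
    {V W : Π x : F, TangentSpace 𝓘(ℝ, F) x} :
    VectorField.mlieBracket 𝓘(ℝ, F) V W = VectorField.lieBracket ℝ (E := F) V W := by
  rw [← VectorField.mlieBracketWithin_univ, VectorField.mlieBracketWithin_eq_lieBracketWithin]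
  exact VectorField.lieBracketWithin_univ

section Parametrization

variable {E : Type*} [NormedAddCommGroup E] [NormedSpace ℝ E]
  {H : Type*} [TopologicalSpace H] {I : ModelWithCorners ℝ E H}
  {M : Type*} [TopologicalSpace M] [ChartedSpace H M]
  {F : Type*} [NormedAddCommGroup F] [NormedSpace ℝ F]
  (φ : PartialDiffeomorph 𝓘(ℝ, F) I F M ∞)

theorem mfderiv_symm_apply_mfderiv {u : F} (hu : u ∈ φ.source) (a : F) :
    mfderiv I 𝓘(ℝ, F) φ.symm (φ u) (mfderiv 𝓘(ℝ, F) I φ u a) = a := by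
  have h1 : MDifferentiableAt I 𝓘(ℝ, F) φ.symm (φ u) :=
    φ.symm.mdifferentiableAt (by simp) (φ.map_source hu)
  have h2 := mfderiv_comp u h1 (φ.mdifferentiableAt (by simp) hu)
  have h3 : (φ.symm ∘ φ : F → F) =ᶠ[𝓝 u] id := by
    filter_upwards [φ.open_source.mem_nhds hu] with x hx using φ.left_inv hx
  rw [h3.mfderiv_eq, mfderiv_id] at h2
  exact (DFunLike.congr_fun h2 a).symm

theorem mfderiv_apply_mfderiv_symm {m : M} (hm : m ∈ φ.target) (v : TangentSpace I m) :
    mfderiv 𝓘(ℝ, F) I φ (φ.symm m) (mfderiv I 𝓘(ℝ, F) φ.symm m v) = v := by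
  have h1 : MDifferentiableAt I 𝓘(ℝ, F) φ.symm m := φ.symm.mdifferentiableAt (by simp) hm
  have h2 := mfderiv_comp m (φ.mdifferentiableAt (by simp) (φ.map_target hm)) h1
  have h3 : (φ ∘ φ.symm : M → M) =ᶠ[𝓝 m] id := by
    filter_upwards [φ.open_target.mem_nhds hm] with x hx using φ.right_inv hx
  have h4 := h2.symm.trans (h3.mfderiv_eq.trans mfderiv_id)
  exact DFunLike.congr_fun h4 v

theorem isInvertible_mfderiv {u : F} (hu : u ∈ φ.source) :
    (mfderiv 𝓘(ℝ, F) I φ u).IsInvertible :=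
  ⟨(PartialDiffeomorph.isLocalDiffeomorphAt _ _ _ φ hu).mfderivToContinuousLinearEquiv
    (by simp), rfl⟩

theorem isInvertible_mfderiv_symm {m : M} (hm : m ∈ φ.target) :
    (mfderiv I 𝓘(ℝ, F) φ.symm m).IsInvertible :=
  ⟨(PartialDiffeomorph.isLocalDiffeomorphAt _ _ _ φ.symm hm).mfderivToContinuousLinearEquiv
    (by simp), rfl⟩

theorem mfderiv_surjective {u : F} (hu : u ∈ φ.source) (v : TangentSpace I (φ u)) :
    ∃ a : F, mfderiv 𝓘(ℝ, F) I φ u a = v := by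
  obtain ⟨A, hA⟩ := isInvertible_mfderiv φ hu
  exact ⟨A.symm v, by rw [← hA]; exact A.apply_symm_apply v⟩

/-- The coordinate expression of a vector field on `M` in the parametrization `φ`. -/
def coordField (Y : Π x : M, TangentSpace I x) (u : F) : F :=
  VectorField.mpullback 𝓘(ℝ, F) I φ Y u

/-- The vector field on the image of `φ` with a given coordinate expression. -/
def pushField (y : F → F) : Π x : M, TangentSpace I x :=
  VectorField.mpullback I 𝓘(ℝ, F) φ.symm y

theorem mfderiv_coordField (Y : Π x : M, TangentSpace I x) {u : F} (hu : u ∈ φ.source) :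
    mfderiv 𝓘(ℝ, F) I φ u (coordField φ Y u : F) = Y (φ u) :=
  (isInvertible_mfderiv φ hu).self_apply_inverse (Y (φ u))

theorem pushField_apply (y : F → F) {m : M} (hm : m ∈ φ.target) :
    pushField φ y m = mfderiv 𝓘(ℝ, F) I φ (φ.symm m) (y (φ.symm m)) := by
  obtain ⟨A, hA⟩ := isInvertible_mfderiv_symm φ hm
  have h : mfderiv I 𝓘(ℝ, F) φ.symm m (pushField φ y m) = y (φ.symm m) :=
    (isInvertible_mfderiv_symm φ hm).self_apply_inverse _
  rw [← h, mfderiv_apply_mfderiv_symm φ hm]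

theorem pushField_param (y : F → F) {u : F} (hu : u ∈ φ.source) :
    pushField φ y (φ u) = mfderiv 𝓘(ℝ, F) I φ u (y u) := by
  have h := pushField_apply φ y (φ.map_source hu)
  have h2 : φ.symm (φ u) = u := φ.left_inv hu
  obtain ⟨A, hA⟩ := isInvertible_mfderiv_symm φ (φ.map_source hu)
  have h3 : mfderiv I 𝓘(ℝ, F) φ.symm (φ u) (pushField φ y (φ u)) = y (φ.symm (φ u)) :=
    (isInvertible_mfderiv_symm φ (φ.map_source hu)).self_apply_inverse _
  have h4 := mfderiv_symm_apply_mfderiv φ hu (y u)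
  rw [h2] at h3
  rw [← hA] at h3 h4
  exact A.injective (h3.trans h4.symm)

theorem eventuallyEq_pushField {Y : Π x : M, TangentSpace I x} {y : F → F} {u : F}
    (hu : u ∈ φ.source) (hY : ∀ᶠ w in 𝓝 u, Y (φ w) = mfderiv 𝓘(ℝ, F) I φ w (y w)) :
    Y =ᶠ[𝓝 (φ u)] pushField φ y := by
  have hsu : φ.symm (φ u) = u := φ.left_inv hu
  have hc : ContinuousAt φ.symm (φ u) :=
    (φ.symm.contMDiffOn.contMDiffAt (φ.open_target.mem_nhds (φ.map_source hu))).continuousAt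
  have h1 : ∀ᶠ m in 𝓝 (φ u), Y (φ (φ.symm m)) =
      mfderiv 𝓘(ℝ, F) I φ (φ.symm m) (y (φ.symm m)) :=
    hc.eventually (by rw [hsu]; exact hY)
  filter_upwards [h1, φ.open_target.mem_nhds (φ.map_source hu)] with m hm hmt
  have h2 : φ (φ.symm m) = m := φ.right_inv hmt
  have h3 := pushField_param φ y (φ.map_target hmt)
  have h4 : Y (φ (φ.symm m)) = pushField φ y (φ (φ.symm m)) := hm.trans h3.symm
  rwa [h2] at h4

variable [IsManifold I ∞ M] [CompleteSpace E]

theorem contMDiffAt_pushField {y : F → F} {m : M} (hm : m ∈ φ.target)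
    (hy : ContDiffAt ℝ ∞ y (φ.symm m)) :
    ContMDiffAt I I.tangent ∞ (T% (pushField φ y)) m := by
  have : IsManifold I 1 M := IsManifold.of_le (n := ∞) (by simp)
  exact ContMDiffAt.mpullback_vectorField_preimage (n := ∞)
    (contMDiffAt_vectorSpace_iff_contDiffAt.2 hy)
    (φ.symm.contMDiffOn.contMDiffAt (φ.open_target.mem_nhds hm))
    (isInvertible_mfderiv_symm φ hm) (by simp)

theorem mdifferentiableAt_pushField {y : F → F} {u : F} (hu : u ∈ φ.source)
    (hy : DifferentiableAt ℝ y u) :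
    MDiffAt (T% (pushField φ y)) (φ u) := by
  have : IsManifold I 1 M := IsManifold.of_le (n := ∞) (by simp)
  have h2 : (2 : WithTop ℕ∞) ≤ ∞ := WithTop.coe_le_coe.2 (le_top : (2 : ℕ∞) ≤ ⊤)
  have : IsManifold I 2 M := IsManifold.of_le (n := ∞) h2
  refine MDifferentiableAt.mpullback_vectorField (n := ∞) ?_
    (φ.symm.contMDiffOn.contMDiffAt (φ.open_target.mem_nhds (φ.map_source hu)))
    (isInvertible_mfderiv_symm φ (φ.map_source hu)) h2
  have h2 : φ.symm (φ u) = u := φ.left_inv hu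
  rw [h2]
  exact mdifferentiableAt_vectorSpace hy

theorem contMDiffAt_of_coord {Y : Π x : M, TangentSpace I x} {y : F → F} {u : F}
    (hu : u ∈ φ.source) (hY : ∀ᶠ w in 𝓝 u, Y (φ w) = mfderiv 𝓘(ℝ, F) I φ w (y w))
    (hy : ContDiffAt ℝ ∞ y u) : ContMDiffAt I I.tangent ∞ (T% Y) (φ u) := by
  have hsu : φ.symm (φ u) = u := φ.left_inv hu
  refine (contMDiffAt_pushField φ (φ.map_source hu) (by rwa [hsu])).congr_of_eventuallyEq ?_
  filter_upwards [eventuallyEq_pushField φ hu hY] with m hm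
  rw [hm]

omit [CompleteSpace E] in
theorem contDiffAt_coordField {Y : Π x : M, TangentSpace I x} {u : F} (hu : u ∈ φ.source)
    (hY : ContMDiffAt I I.tangent ∞ (T% Y) (φ u)) [CompleteSpace F] :
    ContDiffAt ℝ ∞ (coordField φ Y) u := by
  have : IsManifold I 1 M := IsManifold.of_le (n := ∞) (by simp)
  exact contMDiffAt_vectorSpace_iff_contDiffAt.1 <|
    ContMDiffAt.mpullback_vectorField_preimage (n := ∞) hY
    (φ.contMDiffOn.contMDiffAt (φ.open_source.mem_nhds hu))
    (isInvertible_mfderiv φ hu) (by simp)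

theorem mlieBracket_pushField {y z : F → F} {u : F} (hu : u ∈ φ.source)
    (hy : DifferentiableAt ℝ y u) (hz : DifferentiableAt ℝ z u) :
    VectorField.mlieBracket I (pushField φ y) (pushField φ z) (φ u) =
      mfderiv 𝓘(ℝ, F) I φ u (VectorField.lieBracket ℝ (E := F) y z u) := by
  have : IsManifold I 1 M := IsManifold.of_le (n := ∞) (by simp)
  have h2 : (2 : WithTop ℕ∞) ≤ ∞ := WithTop.coe_le_coe.2 (le_top : (2 : ℕ∞) ≤ ⊤)
  have : IsManifold I 2 M := IsManifold.of_le (n := ∞) h2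
  have : IsManifold I (minSmoothness ℝ 3) M := IsManifold.of_le (n := ∞) (by
    simp only [minSmoothness_of_isRCLikeNormedField]
    exact WithTop.coe_le_coe.2 (le_top : (3 : ℕ∞) ≤ ⊤))
  have hsu : φ.symm (φ u) = u := φ.left_inv hu
  have key := VectorField.mpullback_mlieBracket (I := I) (I' := 𝓘(ℝ, F)) (f := φ.symm) (V := y)
    (W := z) (x₀ := φ u) (n := ∞) ?_ ?_
    (φ.symm.contMDiffOn.contMDiffAt (φ.open_target.mem_nhds (φ.map_source hu))) (by simpa using h2)
  · exact key.symm.trans ((congrArg (fun V => VectorField.mpullback I 𝓘(ℝ, F) φ.symm V (φ u))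
      mlieBracket_eq_lieBracket).trans (pushField_param φ (VectorField.lieBracket ℝ y z) hu))
  · rw [hsu]
    exact mdifferentiableAt_vectorSpace hy
  · rw [hsu]
    exact mdifferentiableAt_vectorSpace hz

end Parametrization

section CoordinateMetric

variable {E : Type*} [NormedAddCommGroup E] [NormedSpace ℝ E]
  {H : Type*} [TopologicalSpace H] {I : ModelWithCorners ℝ E H}
  {M : Type*} [TopologicalSpace M] [ChartedSpace H M]
  [RiemannianBundle (fun x : M => TangentSpace I x)]
  {F : Type*} [NormedAddCommGroup F] [NormedSpace ℝ F]
  (φ : PartialDiffeomorph 𝓘(ℝ, F) I F M ∞)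

/-- The metric of `M` in the parametrization `φ`. -/
def coordMetric (u : F) : F →L[ℝ] F →L[ℝ] ℝ :=
  (innerSL ℝ (E := TangentSpace I (φ u))).bilinearComp (mfderiv 𝓘(ℝ, F) I φ u)
    (mfderiv 𝓘(ℝ, F) I φ u)

theorem coordMetric_apply (u a b : F) :
    coordMetric φ u a b = inner ℝ (mfderiv 𝓘(ℝ, F) I φ u a : TangentSpace I (φ u))
      (mfderiv 𝓘(ℝ, F) I φ u b : TangentSpace I (φ u)) := rfl

theorem coordMetric_symm (u a b : F) : coordMetric φ u a b = coordMetric φ u b a :=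
  real_inner_comm (mfderiv 𝓘(ℝ, F) I φ u b : TangentSpace I (φ u))
    (mfderiv 𝓘(ℝ, F) I φ u a : TangentSpace I (φ u))

theorem coordMetric_self_pos {u : F} (hu : u ∈ φ.source) {a : F} (ha : a ≠ 0) :
    0 < coordMetric φ u a a := by
  obtain ⟨A, hA⟩ := isInvertible_mfderiv φ hu
  rw [coordMetric_apply, ← hA]
  exact real_inner_self_pos.2 (A.map_ne_zero_iff.2 ha)

variable [IsManifold I ∞ M] [IsContMDiffRiemannianBundle I ∞ E (fun x : M => TangentSpace I x)]
  [FiniteDimensional ℝ E] [FiniteDimensional ℝ F]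

omit [FiniteDimensional ℝ E] in
theorem contMDiffAt_inner {x : M} {X Y : Π x : M, TangentSpace I x}
    (hX : ContMDiffAt I I.tangent ∞ (T% X) x) (hY : ContMDiffAt I I.tangent ∞ (T% Y) x) :
    ContMDiffAt I 𝓘(ℝ, ℝ) ∞ (fun y => (inner ℝ (X y) (Y y) : ℝ)) x :=
  ContMDiffAt.inner_bundle (IB := I) (F := E) (E := fun x : M => TangentSpace I x)
    (b := fun y => y) hX hY

theorem contDiffOn_coordMetric : ContDiffOn ℝ ∞ (coordMetric φ) φ.source := by
  have : CompleteSpace E := FiniteDimensional.complete ℝ E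
  rw [contDiffOn_clm_apply]
  intro a
  rw [contDiffOn_clm_apply]
  intro b u hu
  have h (c : F) : ContMDiffAt I I.tangent ∞ (T% (pushField φ fun _ => c)) (φ u) :=
    contMDiffAt_pushField φ (φ.map_source hu) contDiffAt_const
  have h1 := (contMDiffAt_inner (h a) (h b)).comp u
    (φ.contMDiffOn.contMDiffAt (φ.open_source.mem_nhds hu))
  refine (contMDiffAt_iff_contDiffAt.1 (h1.congr_of_eventuallyEq ?_)).contDiffWithinAt
  filter_upwards [φ.open_source.mem_nhds hu] with w hw
  simp only [Function.comp_apply]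
  rw [pushField_param φ _ hw, pushField_param φ _ hw]
  rfl

omit [RiemannianBundle (fun x : M => TangentSpace I x)]
  [IsContMDiffRiemannianBundle I ∞ E (fun x : M => TangentSpace I x)] [FiniteDimensional ℝ E]
  [FiniteDimensional ℝ F] [IsManifold I ∞ M] in
theorem mvfderiv_param {h : M → ℝ} {k : F → ℝ} {u : F} (hu : u ∈ φ.source)
    (hh : MDifferentiableAt I 𝓘(ℝ, ℝ) h (φ u)) (hk : ∀ᶠ w in 𝓝 u, h (φ w) = k w) (a : F) :
    mvfderiv I h (φ u) (mfderiv 𝓘(ℝ, F) I φ u a) = fderiv ℝ k u a := by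
  have h1 := mfderiv_comp u hh (φ.mdifferentiableAt (by simp) hu)
  have h2 : (h ∘ φ : F → ℝ) =ᶠ[𝓝 u] k := hk
  rw [h2.mfderiv_eq, mfderiv_eq_fderiv] at h1
  exact (DFunLike.congr_fun h1 a).symm

/-- The Christoffel formula: the Levi-Civita connection in a parametrization. -/
theorem inner_leviCivita_coord {Y : Π x : M, TangentSpace I x} {y : F → F} {u : F}
    (hu : u ∈ φ.source) (hy : DifferentiableAt ℝ y u)
    (hY : ∀ᶠ w in 𝓝 u, Y (φ w) = mfderiv 𝓘(ℝ, F) I φ w (y w)) (a b : F) :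
    inner ℝ (leviCivita I Y (φ u) (mfderiv 𝓘(ℝ, F) I φ u a))
      (mfderiv 𝓘(ℝ, F) I φ u b : TangentSpace I (φ u)) =
      (1 / 2) * (fderiv ℝ (coordMetric φ) u a (y u) b + fderiv ℝ (coordMetric φ) u (y u) a b
        - fderiv ℝ (coordMetric φ) u b a (y u)) + coordMetric φ u (fderiv ℝ y u a) b := by
  have : CompleteSpace E := FiniteDimensional.complete ℝ E
  set G := coordMetric φ with hG
  have hGd : DifferentiableAt ℝ G u :=
    ((contDiffOn_coordMetric φ).contDiffAt (φ.open_source.mem_nhds hu)).differentiableAt (by simp)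
  have hev : ∀ᶠ w in 𝓝 u, w ∈ φ.source := φ.open_source.mem_nhds hu
  -- `Y` agrees near `φ u` with the field that has the coordinate expression `y`.
  have hYP := eventuallyEq_pushField φ hu hY
  let C (c : F) : Π x : M, TangentSpace I x := pushField φ fun _ => c
  have hC (c : F) : MDiffAt (T% (C c)) (φ u) :=
    mdifferentiableAt_pushField φ hu (differentiableAt_const c)
  have hP : MDiffAt (T% (pushField φ y)) (φ u) := mdifferentiableAt_pushField φ hu hy
  have hYd : MDiffAt (T% Y) (φ u) := by
    refine hP.congr_of_eventuallyEq ?_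
    filter_upwards [hYP] with m hm
    rw [hm]
  have hCu (c : F) {w : F} (hw : w ∈ φ.source) : C c (φ w) = mfderiv 𝓘(ℝ, F) I φ w c :=
    pushField_param φ _ hw
  have hYu : Y (φ u) = mfderiv 𝓘(ℝ, F) I φ u (y u) := hY.self_of_nhds
  have key := inner_leviCivita (hC a) hYd (hC b)
  rw [hCu a hu, hCu b hu] at key
  rw [key, koszul, hCu a hu, hCu b hu, hYu]
  have t1 : mvfderiv I (fun m => inner ℝ (Y m) (C b m)) (φ u) (mfderiv 𝓘(ℝ, F) I φ u a) =
      fderiv ℝ G u a (y u) b + G u (fderiv ℝ y u a) b := by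
    rw [mvfderiv_param φ hu (mdifferentiableAt_inner hYd (hC b)) (k := fun w => G w (y w) b) ?_,
      fderiv_bilin_apply hGd hy]
    filter_upwards [hev, hY] with w hw hw2
    rw [hw2, hCu b hw]; rfl
  have t2 : mvfderiv I (fun m => inner ℝ (C b m) (C a m)) (φ u) (mfderiv 𝓘(ℝ, F) I φ u (y u)) =
      fderiv ℝ G u (y u) a b := by
    rw [mvfderiv_param φ hu (mdifferentiableAt_inner (hC b) (hC a)) (k := fun w => G w a b) ?_,
      fderiv_bilin_const_apply hGd]
    filter_upwards [hev] with w hw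
    rw [hCu a hw, hCu b hw, hG, coordMetric_symm]; rfl
  have t3 : mvfderiv I (fun m => inner ℝ (C a m) (Y m)) (φ u) (mfderiv 𝓘(ℝ, F) I φ u b) =
      fderiv ℝ G u b (y u) a + G u (fderiv ℝ y u b) a := by
    rw [mvfderiv_param φ hu (mdifferentiableAt_inner (hC a) hYd) (k := fun w => G w (y w) a) ?_,
      fderiv_bilin_apply hGd hy]
    filter_upwards [hev, hY] with w hw hw2
    rw [hw2, hCu a hw, hG, coordMetric_symm]; rfl
  have br (c : F) : VectorField.mlieBracket I (C c) Y (φ u) =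
      mfderiv 𝓘(ℝ, F) I φ u (fderiv ℝ y u c) := by
    refine (Filter.EventuallyEq.mlieBracket_vectorField_eq (Filter.EventuallyEq.refl _ _)
      hYP).trans ?_
    refine (mlieBracket_pushField φ hu (differentiableAt_const c) hy).trans ?_
    have hb : VectorField.lieBracket ℝ (fun _ : F => c) y u = fderiv ℝ y u c := by
      simp [VectorField.lieBracket]
    exact congrArg (mfderiv 𝓘(ℝ, F) I φ u) hb
  have br0 : VectorField.mlieBracket I (C b) (C a) (φ u) = 0 := by
    refine (mlieBracket_pushField φ hu (differentiableAt_const b)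
      (differentiableAt_const a)).trans ?_
    have : VectorField.lieBracket ℝ (fun _ : F => b) (fun _ : F => a) u = 0 := by
      simp [VectorField.lieBracket]
    rw [this]
    exact map_zero _
  rw [t1, t2, t3, br a, VectorField.mlieBracket_swap_apply (V := Y), br b, br0, inner_zero_left,
    inner_neg_left]
  have e1 (c d : F) : (inner ℝ (mfderiv 𝓘(ℝ, F) I φ u c : TangentSpace I (φ u))
      (mfderiv 𝓘(ℝ, F) I φ u d : TangentSpace I (φ u)) : ℝ) = G u c d := rfl
  have e2 : fderiv ℝ G u b (y u) a = fderiv ℝ G u b a (y u) :=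
    fderiv_bilin_symm hGd (Filter.Eventually.of_forall fun w => coordMetric_symm φ w) _ _ _
  rw [e1, e1, e2]
  ring

end CoordinateMetric

/-! ### Killing fields and adapted coordinates -/

section KillingCoordinates

variable {E : Type*} [NormedAddCommGroup E] [NormedSpace ℝ E] [FiniteDimensional ℝ E]
  {H : Type*} [TopologicalSpace H] {I : ModelWithCorners ℝ E H}
  {M : Type*} [TopologicalSpace M] [ChartedSpace H M] [IsManifold I ∞ M]
  [RiemannianBundle (fun x : M => TangentSpace I x)]
  [IsContMDiffRiemannianBundle I ∞ E (fun x : M => TangentSpace I x)]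
  {F : Type*} [NormedAddCommGroup F] [NormedSpace ℝ F] [FiniteDimensional ℝ F]
  (φ : PartialDiffeomorph 𝓘(ℝ, F) I F M ∞)

theorem differentiableAt_coordMetric {u : F} (hu : u ∈ φ.source) :
    DifferentiableAt ℝ (coordMetric φ) u :=
  ((contDiffOn_coordMetric φ).contDiffAt (φ.open_source.mem_nhds hu)).differentiableAt (by simp)

/-- The symmetrised covariant derivative of `Y` is the Lie derivative of the metric along `Y`. -/
theorem leviCivita_symmetrized_coord {Y : Π x : M, TangentSpace I x} {y : F → F} {u : F}
    (hu : u ∈ φ.source) (hy : DifferentiableAt ℝ y u)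
    (hY : ∀ᶠ w in 𝓝 u, Y (φ w) = mfderiv 𝓘(ℝ, F) I φ w (y w)) (a b : F) :
    (inner ℝ (leviCivita I Y (φ u) (mfderiv 𝓘(ℝ, F) I φ u a))
      (mfderiv 𝓘(ℝ, F) I φ u b : TangentSpace I (φ u)) : ℝ) +
    inner ℝ (mfderiv 𝓘(ℝ, F) I φ u a : TangentSpace I (φ u))
      (leviCivita I Y (φ u) (mfderiv 𝓘(ℝ, F) I φ u b)) =
      fderiv ℝ (coordMetric φ) u (y u) a b + coordMetric φ u (fderiv ℝ y u a) b
        + coordMetric φ u (fderiv ℝ y u b) a := by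
  rw [real_inner_comm (leviCivita I Y (φ u) (mfderiv 𝓘(ℝ, F) I φ u b)),
    inner_leviCivita_coord φ hu hy hY, inner_leviCivita_coord φ hu hy hY]
  have hs := fderiv_bilin_symm (differentiableAt_coordMetric φ hu)
    (Filter.Eventually.of_forall fun w => coordMetric_symm φ w)
  rw [hs a (y u) b, hs (y u) b a, hs b a (y u)]
  ring

/-- The Killing equation in a parametrization: the Lie derivative of the metric vanishes. -/
theorem IsKillingField.coord {ξ : Π x : M, TangentSpace I x} (hξ : IsKillingField I ξ) {y : F → F}
    {u : F} (hu : u ∈ φ.source) (hy : DifferentiableAt ℝ y u)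
    (hY : ∀ᶠ w in 𝓝 u, ξ (φ w) = mfderiv 𝓘(ℝ, F) I φ w (y w)) (a b : F) :
    fderiv ℝ (coordMetric φ) u (y u) a b + coordMetric φ u (fderiv ℝ y u a) b
        + coordMetric φ u (fderiv ℝ y u b) a = 0 := by
  rw [← leviCivita_symmetrized_coord φ hu hy hY a b]
  exact hξ.skew _ _ _

end KillingCoordinates

section AdaptedCoordinates

variable {V : Type*} [NormedAddCommGroup V] [NormedSpace ℝ V]

theorem fderiv_bilin_fst {G : ℝ × V → (ℝ × V) →L[ℝ] (ℝ × V) →L[ℝ] ℝ} {u : ℝ × V}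
    (hG : DifferentiableAt ℝ G u) (a b : ℝ × V) :
    HasDerivAt (fun s => G (s, u.2) a b) (fderiv ℝ G u (1, 0) a b) u.1 := by
  have h1 : HasDerivAt (fun s : ℝ => (s, u.2)) ((1 : ℝ), (0 : V)) u.1 :=
    (hasDerivAt_id _).prodMk (hasDerivAt_const _ _)
  rw [← fderiv_bilin_const_apply hG]
  exact (hasFDerivAt_bilin_apply hG (differentiableAt_const a) b).differentiableAt.hasFDerivAt
    |>.comp_hasDerivAt u.1 h1

theorem fderiv_bilin_snd {G : ℝ × V → (ℝ × V) →L[ℝ] (ℝ × V) →L[ℝ] ℝ} {u : ℝ × V}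
    (hG : DifferentiableAt ℝ G u) (z : V) (a b : ℝ × V) :
    fderiv ℝ G u (0, z) a b = fderiv ℝ (fun x => G (u.1, x) a b) u.2 z := by
  have h1 : HasFDerivAt (fun x : V => (u.1, x)) (ContinuousLinearMap.inr ℝ ℝ V) u.2 :=
    (hasFDerivAt_const _ _).prodMk (hasFDerivAt_id _)
  rw [← fderiv_bilin_const_apply hG]
  have h2 := (hasFDerivAt_bilin_apply hG (differentiableAt_const a) b).differentiableAt.hasFDerivAt
    |>.comp u.2 h1
  have h3 : HasFDerivAt (fun x => G (u.1, x) a b) _ u.2 := h2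
  rw [h3.fderiv]
  simp

variable {E : Type*} [NormedAddCommGroup E] [NormedSpace ℝ E] [FiniteDimensional ℝ E]
  {H : Type*} [TopologicalSpace H] {I : ModelWithCorners ℝ E H}
  {M : Type*} [TopologicalSpace M] [ChartedSpace H M] [IsManifold I ∞ M]
  [RiemannianBundle (fun x : M => TangentSpace I x)]
  [IsContMDiffRiemannianBundle I ∞ E (fun x : M => TangentSpace I x)]
  [FiniteDimensional ℝ V]
  (φ : PartialDiffeomorph 𝓘(ℝ, ℝ × V) I (ℝ × V) M ∞)

/-- In coordinates `(t, x)` in which `ν = ∂_t` has constant products with the coordinate fields,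
`∇ν` is half of the `t`-derivative of the metric. -/
theorem inner_leviCivita_adapted {ν : Π x : M, TangentSpace I x} {u : ℝ × V}
    (hu : u ∈ φ.source)
    (hν : ∀ᶠ w in 𝓝 u, ν (φ w) = mfderiv 𝓘(ℝ, ℝ × V) I φ w ((1, 0) : ℝ × V))
    (hG : ∀ᶠ w in 𝓝 u, ∀ b, coordMetric φ w (1, 0) b = b.1) (a b : ℝ × V) :
    inner ℝ (leviCivita I ν (φ u) (mfderiv 𝓘(ℝ, ℝ × V) I φ u a))
      (mfderiv 𝓘(ℝ, ℝ × V) I φ u b : TangentSpace I (φ u)) =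
      (1 / 2) * fderiv ℝ (coordMetric φ) u (1, 0) a b := by
  have hd := differentiableAt_coordMetric φ hu
  have h0 (c v : ℝ × V) : fderiv ℝ (coordMetric φ) u v (1, 0) c = 0 := by
    rw [← fderiv_bilin_const_apply hd]
    have h : (fun w => coordMetric φ w (1, 0) c) =ᶠ[𝓝 u] fun _ => c.1 := hG.mono fun w hw => hw c
    rw [h.fderiv_eq]
    simp
  have hs := fderiv_bilin_symm hd (Filter.Eventually.of_forall fun w => coordMetric_symm φ w)
  rw [inner_leviCivita_coord φ hu (differentiableAt_const ((1, 0) : ℝ × V)) hν a b, h0,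
    hs b a (1, 0), h0]
  simp

end AdaptedCoordinates

section ChartParametrization

variable {E : Type*} [NormedAddCommGroup E] [NormedSpace ℝ E]
  {H : Type*} [TopologicalSpace H] (I : ModelWithCorners ℝ E H) [I.Boundaryless]
  {M : Type*} [TopologicalSpace M] [ChartedSpace H M] [IsManifold I ∞ M]

/-- The inverse of a chart, as a parametrization by an open subset of the model vector space. -/
def chartParam (x₀ : M) : PartialDiffeomorph 𝓘(ℝ, E) I E M ∞ where
  toPartialEquiv := (extChartAt I x₀).symm
  open_source := isOpen_extChartAt_target x₀
  open_target := isOpen_extChartAt_source x₀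
  contMDiffOn_toFun := contMDiffOn_extChartAt_symm x₀
  contMDiffOn_invFun := by
    have h := contMDiffOn_extChartAt (I := I) (n := ∞) (x := x₀)
    rwa [← extChartAt_source I] at h

end ChartParametrization

section LocallyConstant

variable {V : Type*} [NormedAddCommGroup V] [NormedSpace ℝ V]
  {N : Type*} [TopologicalSpace N] [ChartedSpace V N] [IsManifold 𝓘(ℝ, V) ∞ N]
  [PreconnectedSpace N]

/-- A function with zero differential on a connected manifold is constant. -/
theorem eq_of_mfderiv_eq_zero {f : N → ℝ} (hf : MDifferentiable 𝓘(ℝ, V) 𝓘(ℝ, ℝ) f)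
    (h0 : ∀ y, mfderiv 𝓘(ℝ, V) 𝓘(ℝ, ℝ) f y = 0) (y z : N) : f y = f z := by
  have hloc : IsLocallyConstant f := by
    rw [IsLocallyConstant.iff_eventually_eq]
    intro x
    let κ := chartParam 𝓘(ℝ, V) x
    have hx : x ∈ κ.target := mem_extChartAt_source (I := 𝓘(ℝ, V)) x
    obtain ⟨ε, hε, hball⟩ := Metric.isOpen_iff.1 κ.open_source _ (κ.map_target hx)
    have hd : ∀ w ∈ Metric.ball (κ.symm x) ε, HasFDerivAt (f ∘ κ) (0 : V →L[ℝ] ℝ) w := by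
      intro w hw
      have h1 := (hf (κ w)).hasMFDerivAt.comp w
        (κ.mdifferentiableAt (by simp) (hball hw)).hasMFDerivAt
      rw [h0] at h1
      have h2 := h1.hasFDerivAt
      exact h2.congr_fderiv (ContinuousLinearMap.zero_comp _)
    have hc : ContinuousAt κ.symm x :=
      (κ.symm.contMDiffOn.contMDiffAt (κ.open_target.mem_nhds hx)).continuousAt
    filter_upwards [hc (Metric.ball_mem_nhds _ hε), κ.open_target.mem_nhds hx] with m hm hmt
    have h3 := (convex_ball (κ.symm x) ε).is_const_of_fderivWithin_eq_zero (𝕜 := ℝ) (f := f ∘ κ)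
      (fun w hw => (hd w hw).differentiableAt.differentiableWithinAt)
      (fun w hw => (hd w hw).hasFDerivWithinAt.fderivWithin
        (Metric.isOpen_ball.uniqueDiffWithinAt hw)) hm (Metric.mem_ball_self hε)
    have e1 : κ (κ.symm m) = m := κ.right_inv hmt
    have e2 : κ (κ.symm x) = x := κ.right_inv hx
    simpa only [Function.comp_apply, e1, e2] using h3
  exact hloc.apply_eq_of_preconnectedSpace y z

end LocallyConstant

/-! ### Local diffeomorphisms, warped forms and the carrier of a doubly warped product -/

section

variable {E : Type*} [NormedAddCommGroup E] [NormedSpace ℝ E]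
  {H : Type*} [TopologicalSpace H] {I : ModelWithCorners ℝ E H}
  {M : Type*} [TopologicalSpace M] [ChartedSpace H M]
  {E' : Type*} [NormedAddCommGroup E'] [NormedSpace ℝ E']
  {H' : Type*} [TopologicalSpace H'] {J : ModelWithCorners ℝ E' H'}
  {N : Type*} [TopologicalSpace N] [ChartedSpace H' N]

theorem eq_localInverse_symm {f : M → N} {x : M} (hf : IsLocalDiffeomorphAt I J ∞ f x) {z : M}
    (hz : z ∈ hf.localInverse.target) : f z = hf.localInverse.invFun z := by
  have h1 := hf.localInverse_right_inv (hf.localInverse.map_target hz)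
  have h2 : hf.localInverse (hf.localInverse.invFun z) = z := hf.localInverse.right_inv hz
  exact (congrArg f h2).symm.trans h1

/-- A local diffeomorphism, restricted to a neighbourhood of a point on which it has an inverse. -/
def partialDiffeomorphAt {f : M → N} {x : M} (hf : IsLocalDiffeomorphAt I J ∞ f x) :
    PartialDiffeomorph I J M N ∞ where
  toFun := f
  invFun := hf.localInverse
  source := hf.localInverse.target
  target := hf.localInverse.source
  map_source' := fun z hz => by
    rw [eq_localInverse_symm hf hz]
    exact hf.localInverse.map_target hz
  map_target' := fun z hz => hf.localInverse.map_source hz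
  left_inv' := fun z hz => hf.localInverse_left_inv hz
  right_inv' := fun z hz => hf.localInverse_right_inv hz
  open_source := hf.localInverse.open_target
  open_target := hf.localInverse.open_source
  contMDiffOn_toFun :=
    hf.localInverse.contMDiffOn_invFun.congr fun _ hz => eq_localInverse_symm hf hz
  contMDiffOn_invFun := hf.localInverse.contMDiffOn_toFun

theorem mem_source_partialDiffeomorphAt {f : M → N} {x : M}
    (hf : IsLocalDiffeomorphAt I J ∞ f x) : x ∈ (partialDiffeomorphAt hf).source :=
  hf.localInverse_mem_target

end

section WarpedCalculus

variable {V : Type*} [NormedAddCommGroup V] [NormedSpace ℝ V]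

/-- The coordinate expression of the metric `dt² + ρ² ĝ_ŷ + σ² ĝ_ŷ^⊥`. -/
def warpedForm (ρ σ : ℝ → ℝ) (g : V → V →L[ℝ] V →L[ℝ] ℝ) (y : V → V) (w a b : ℝ × V) : ℝ :=
  a.1 * b.1 + ρ w.1 ^ 2 * (g w.2 a.2 (y w.2) * g w.2 b.2 (y w.2))
    + σ w.1 ^ 2 * (g w.2 a.2 b.2 - g w.2 a.2 (y w.2) * g w.2 b.2 (y w.2))

variable {ρ σ : ℝ → ℝ} {g : V → V →L[ℝ] V →L[ℝ] ℝ} {y : V → V}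
  {G : ℝ × V → (ℝ × V) →L[ℝ] (ℝ × V) →L[ℝ] ℝ} {u : ℝ × V}

theorem fderiv_fst_warpedForm (hG : DifferentiableAt ℝ G u)
    (hGw : ∀ᶠ w in 𝓝 u, ∀ a b, G w a b = warpedForm ρ σ g y w a b)
    (hρ : DifferentiableAt ℝ ρ u.1) (hσ : DifferentiableAt ℝ σ u.1) (a b : ℝ × V) :
    fderiv ℝ G u (1, 0) a b =
      2 * ρ u.1 * deriv ρ u.1 * (g u.2 a.2 (y u.2) * g u.2 b.2 (y u.2))
      + 2 * σ u.1 * deriv σ u.1 * (g u.2 a.2 b.2 - g u.2 a.2 (y u.2) * g u.2 b.2 (y u.2)) := by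
  have h1 := fderiv_bilin_fst hG a b
  have h2 : (fun s => G (s, u.2) a b) =ᶠ[𝓝 u.1] fun s => warpedForm ρ σ g y (s, u.2) a b := by
    have hc : ContinuousAt (fun s : ℝ => (s, u.2)) u.1 := by fun_prop
    exact (hc.eventually hGw).mono fun s hs => hs a b
  have h3 := ((hasDerivAt_const u.1 (a.1 * b.1)).add ((hρ.hasDerivAt.pow 2).mul_const
    (g u.2 a.2 (y u.2) * g u.2 b.2 (y u.2)))).add ((hσ.hasDerivAt.pow 2).mul_const
    (g u.2 a.2 b.2 - g u.2 a.2 (y u.2) * g u.2 b.2 (y u.2)))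
  rw [h1.unique (h3.congr_of_eventuallyEq h2)]
  simp

/-- If `y` is a unit Killing field of `g`, then `(0, y)` is a Killing field of the warped metric. -/
theorem warpedForm_killing (hG : DifferentiableAt ℝ G u)
    (hGw : ∀ᶠ w in 𝓝 u, ∀ a b, G w a b = warpedForm ρ σ g y w a b)
    (hg : DifferentiableAt ℝ g u.2) (hy : DifferentiableAt ℝ y u.2)
    (hs : ∀ᶠ x in 𝓝 u.2, ∀ a b, g x a b = g x b a)
    (hk : ∀ a b, fderiv ℝ g u.2 (y u.2) a b + g u.2 (fderiv ℝ y u.2 a) b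
      + g u.2 (fderiv ℝ y u.2 b) a = 0) (a b : ℝ × V) :
    fderiv ℝ G u (0, y u.2) a b + G u (0, fderiv ℝ y u.2 a.2) b
      + G u (0, fderiv ℝ y u.2 b.2) a = 0 := by
  have hsu := hs.self_of_nhds
  -- The dual form of `y` is invariant under `y`.
  have hθ (c : V) : HasFDerivAt (fun x => g x c (y x))
      (((fderiv ℝ g u.2).flip (y u.2) + (g u.2).comp (fderiv ℝ y u.2)).flip c) u.2 := by
    refine (hasFDerivAt_bilin_apply hg hy c).congr_of_eventuallyEq ?_
    exact hs.mono fun x hx => hx _ _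
  have hθy (c : V) : (((fderiv ℝ g u.2).flip (y u.2) + (g u.2).comp (fderiv ℝ y u.2)).flip c)
      (y u.2) = - g u.2 (fderiv ℝ y u.2 c) (y u.2) := by
    have := hk (y u.2) c
    simp only [ContinuousLinearMap.flip_apply, add_apply,
      ContinuousLinearMap.comp_apply]
    linarith
  have hgab : HasFDerivAt (fun x => g x a.2 b.2) (fderiv ℝ (fun x => g x a.2 b.2) u.2) u.2 :=
    (hasFDerivAt_bilin_apply hg (differentiableAt_const a.2) b.2).differentiableAt.hasFDerivAt
  have h2 : (fun x => G (u.1, x) a b) =ᶠ[𝓝 u.2] fun x => warpedForm ρ σ g y (u.1, x) a b := by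
    have hc : ContinuousAt (fun x : V => (u.1, x)) u.2 := by fun_prop
    exact (hc.eventually hGw).mono fun s hs => hs a b
  have h3 := ((hasFDerivAt_const (a.1 * b.1) u.2).add (((hθ a.2).mul (hθ b.2)).const_mul
    (ρ u.1 ^ 2))).add ((hgab.sub ((hθ a.2).mul (hθ b.2))).const_mul (σ u.1 ^ 2))
  have h4 := hGw.self_of_nhds
  rw [fderiv_bilin_snd hG, (h3.congr_of_eventuallyEq h2).fderiv, h4, h4]
  have e1 := fderiv_bilin_const_apply hg a.2 b.2 (y u.2)
  have e2 := hk a.2 b.2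
  have e3 := hθy a.2
  have e4 := hθy b.2
  simp only [warpedForm, add_apply, sub_apply,
    smul_apply, smul_eq_mul, zero_mul,
    e1, e3, e4, zero_add]
  rw [hsu (fderiv ℝ y u.2 b.2) a.2] at e2 ⊢
  have e5 : fderiv ℝ g u.2 (y u.2) a.2 b.2 = - g u.2 (fderiv ℝ y u.2 a.2) b.2
      - g u.2 a.2 (fderiv ℝ y u.2 b.2) := by linarith
  rw [e5]
  ring

end WarpedCalculus

namespace DoublyWarpedProduct

variable {n : ℕ} (D : DoublyWarpedProduct.{u} n)

theorem extChartAt_interval (t₀ t : D.interval) : extChartAt 𝓘(ℝ, ℝ) t₀ t = (t : ℝ) := by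
  simp [extChartAt, TopologicalSpace.Opens.chartAt_eq, chartAt_self_eq]

/-- The parametrization `(t, x) ↦ (t, κ x)` of the doubly warped product, where `κ` is the inverse
of a chart of `Mhat`. -/
def carrierParam (q : D.Carrier) :
    PartialDiffeomorph 𝓘(ℝ, ℝ × EuclideanSpace ℝ (Fin n)) (𝓘(ℝ, ℝ).prod (𝓡 n))
      (ℝ × EuclideanSpace ℝ (Fin n)) D.Carrier ∞ :=
  chartParam (𝓘(ℝ, ℝ).prod (𝓡 n)) q

theorem mem_target_carrierParam (q : D.Carrier) : q ∈ (D.carrierParam q).target :=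
  mem_extChartAt_source (I := 𝓘(ℝ, ℝ).prod (𝓡 n)) q

theorem carrierParam_fst (q : D.Carrier) {u : ℝ × EuclideanSpace ℝ (Fin n)}
    (hu : u ∈ (D.carrierParam q).source) : ((D.carrierParam q u).1 : ℝ) = u.1 := by
  have h : extChartAt (𝓘(ℝ, ℝ).prod (𝓡 n)) q (D.carrierParam q u) = u :=
    (D.carrierParam q).left_inv hu
  rw [extChartAt_prod] at h
  rw [← D.extChartAt_interval q.1]
  exact congrArg Prod.fst h

theorem carrierParam_mem_source (q : D.Carrier) {u : ℝ × EuclideanSpace ℝ (Fin n)}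
    (hu : u ∈ (D.carrierParam q).source) :
    u.1 ∈ D.interval ∧ u.2 ∈ (chartParam (𝓡 n) q.2).source := by
  have h : u ∈ (extChartAt (𝓘(ℝ, ℝ).prod (𝓡 n)) q).target := hu
  rw [extChartAt_prod] at h
  exact ⟨D.carrierParam_fst q hu ▸ (D.carrierParam q u).1.2, h.2⟩

theorem carrierParam_snd (q : D.Carrier) (u : ℝ × EuclideanSpace ℝ (Fin n)) :
    (D.carrierParam q u).2 = chartParam (𝓡 n) q.2 u.2 := by
  have h : D.carrierParam q u = (extChartAt (𝓘(ℝ, ℝ).prod (𝓡 n)) q).symm u := rfl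
  rw [h, extChartAt_prod]
  rfl

theorem mdifferentiableAt_interval_coord (q : D.Carrier) :
    MDifferentiableAt (𝓘(ℝ, ℝ).prod (𝓡 n)) 𝓘(ℝ, ℝ)
      (fun q' : D.Carrier => ((q'.1 : D.interval) : ℝ)) q :=
  ((contMDiff_subtype_val (n := ∞)).comp contMDiff_fst).contMDiffAt.mdifferentiableAt (by simp)

theorem dt_carrierParam (q : D.Carrier) {u : ℝ × EuclideanSpace ℝ (Fin n)}
    (hu : u ∈ (D.carrierParam q).source) (a : ℝ × EuclideanSpace ℝ (Fin n)) :
    D.dt (D.carrierParam q u)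
      (mfderiv 𝓘(ℝ, ℝ × EuclideanSpace ℝ (Fin n)) (𝓘(ℝ, ℝ).prod (𝓡 n)) (D.carrierParam q) u a) =
      a.1 := by
  refine (mvfderiv_param (D.carrierParam q) (k := Prod.fst) hu
    (D.mdifferentiableAt_interval_coord _) ?_ a).trans ?_
  · filter_upwards [(D.carrierParam q).open_source.mem_nhds hu] with w hw
    exact D.carrierParam_fst q hw
  · rw [fderiv_fst]; rfl

theorem dproj_carrierParam (q : D.Carrier) {u : ℝ × EuclideanSpace ℝ (Fin n)}
    (hu : u ∈ (D.carrierParam q).source) (a : ℝ × EuclideanSpace ℝ (Fin n)) :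
    (D.dproj (D.carrierParam q u)
      (mfderiv 𝓘(ℝ, ℝ × EuclideanSpace ℝ (Fin n)) (𝓘(ℝ, ℝ).prod (𝓡 n)) (D.carrierParam q) u a) :
      EuclideanSpace ℝ (Fin n)) =
      (mfderiv 𝓘(ℝ, EuclideanSpace ℝ (Fin n)) (𝓡 n) (chartParam (𝓡 n) q.2) u.2 a.2 :
        EuclideanSpace ℝ (Fin n)) := by
  have h1 : HasMFDerivAt 𝓘(ℝ, ℝ × EuclideanSpace ℝ (Fin n)) (𝓡 n)
      (fun w => (D.carrierParam q w).2) u _ :=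
    HasMFDerivAt.comp u (g := (Prod.snd : D.Carrier → D.Mhat))
      ((contMDiff_snd (n := ∞)).contMDiffAt.mdifferentiableAt (by simp)).hasMFDerivAt
      ((D.carrierParam q).mdifferentiableAt (by simp) hu).hasMFDerivAt
  have h2 : HasMFDerivAt 𝓘(ℝ, ℝ × EuclideanSpace ℝ (Fin n)) 𝓘(ℝ, EuclideanSpace ℝ (Fin n))
      (Prod.snd : ℝ × EuclideanSpace ℝ (Fin n) → EuclideanSpace ℝ (Fin n)) u
      (ContinuousLinearMap.snd ℝ ℝ (EuclideanSpace ℝ (Fin n))) :=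
    hasFDerivAt_snd.hasMFDerivAt
  have h3 := HasMFDerivAt.comp u (g := chartParam (𝓡 n) q.2)
    ((chartParam (𝓡 n) q.2).mdifferentiableAt (by simp)
      (D.carrierParam_mem_source q hu).2).hasMFDerivAt h2
  have h4 := h3.congr_of_eventuallyEq
    (Filter.Eventually.of_forall fun w => D.carrierParam_snd q w)
  exact DFunLike.congr_fun (hasMFDerivAt_unique h1 h4) a

/-- Every point lies in the image of its own coordinate parametrization. -/
theorem exists_carrierParam_eq (q : D.Carrier) :
    ∃ u ∈ (D.carrierParam q).source, D.carrierParam q u = q :=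
  ⟨(D.carrierParam q).symm q, (D.carrierParam q).map_target (D.mem_target_carrierParam q),
    (D.carrierParam q).right_inv (D.mem_target_carrierParam q)⟩

/-- The components of a tangent vector along the two factors can be prescribed. -/
theorem exists_lift (q : D.Carrier) (s : ℝ) (w : TangentSpace (𝓡 n) q.2) :
    ∃ v : TangentSpace (𝓘(ℝ, ℝ).prod (𝓡 n)) q, D.dt q v = s ∧ D.dproj q v = w := by
  have key : ∀ q₀ : D.Carrier, ∀ u ∈ (D.carrierParam q₀).source, ∀ q', D.carrierParam q₀ u = q' →
      ∀ w : TangentSpace (𝓡 n) q'.2,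
      ∃ v : TangentSpace (𝓘(ℝ, ℝ).prod (𝓡 n)) q', D.dt q' v = s ∧ D.dproj q' v = w := by
    rintro q₀ u hu _ rfl w
    obtain ⟨A, hA⟩ := isInvertible_mfderiv (chartParam (𝓡 n) q₀.2)
      (D.carrierParam_mem_source q₀ hu).2
    refine ⟨_, D.dt_carrierParam q₀ hu (s, A.symm w), ?_⟩
    refine (D.dproj_carrierParam q₀ hu (s, A.symm w)).trans ?_
    rw [← hA]
    exact A.apply_symm_apply w
  obtain ⟨u, hu, h⟩ := D.exists_carrierParam_eq q
  exact key q u hu q h w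

/-- A tangent vector is determined by its components along the two factors. -/
theorem eq_of_dt_eq_of_dproj_eq (q : D.Carrier) {v w : TangentSpace (𝓘(ℝ, ℝ).prod (𝓡 n)) q}
    (h1 : D.dt q v = D.dt q w) (h2 : D.dproj q v = D.dproj q w) : v = w := by
  have key : ∀ q₀ : D.Carrier, ∀ u ∈ (D.carrierParam q₀).source, ∀ q', D.carrierParam q₀ u = q' →
      ∀ v w : TangentSpace (𝓘(ℝ, ℝ).prod (𝓡 n)) q',
      D.dt q' v = D.dt q' w → D.dproj q' v = D.dproj q' w → v = w := by
    rintro q₀ u hu _ rfl v w h1 h2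
    obtain ⟨A, hA⟩ := isInvertible_mfderiv (chartParam (𝓡 n) q₀.2)
      (D.carrierParam_mem_source q₀ hu).2
    obtain ⟨a, rfl⟩ := mfderiv_surjective (D.carrierParam q₀) hu v
    obtain ⟨b, rfl⟩ := mfderiv_surjective (D.carrierParam q₀) hu w
    rw [D.dt_carrierParam q₀ hu, D.dt_carrierParam q₀ hu] at h1
    have h3 := (D.dproj_carrierParam q₀ hu a).symm.trans (h2.trans (D.dproj_carrierParam q₀ hu b))
    rw [← hA] at h3
    rw [Prod.ext h1 (A.injective h3)]
  obtain ⟨u, hu, h⟩ := D.exists_carrierParam_eq q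
  exact key q u hu q h v w h1 h2

end DoublyWarpedProduct

/-! ### Doubly warped products in coordinates -/

namespace DoublyWarpedProduct

variable {n : ℕ} (D : DoublyWarpedProduct.{u} n)
  {M : Type*} [TopologicalSpace M]
  [ChartedSpace (EuclideanSpace ℝ (Fin (n + 1))) M] [IsManifold (𝓡 (n + 1)) ∞ M]
  [RiemannianBundle (fun x : M => TangentSpace (𝓡 (n + 1)) x)]

/-- The coordinate expression of `etahat` in the chart of `Mhat` at `x₀`. -/
def etaCoord (x₀ : D.Mhat) : EuclideanSpace ℝ (Fin n) → EuclideanSpace ℝ (Fin n) :=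
  coordField (chartParam (𝓡 n) x₀) D.etahat

/-- The metric of `Mhat` in the chart at `x₀`. -/
def hatCoordMetric (x₀ : D.Mhat) : EuclideanSpace ℝ (Fin n) →
    EuclideanSpace ℝ (Fin n) →L[ℝ] EuclideanSpace ℝ (Fin n) →L[ℝ] ℝ :=
  coordMetric (chartParam (𝓡 n) x₀)

theorem metric_carrierParam (q : D.Carrier) {u : ℝ × EuclideanSpace ℝ (Fin n)}
    (hu : u ∈ (D.carrierParam q).source) (a b : ℝ × EuclideanSpace ℝ (Fin n)) :
    D.metric (D.carrierParam q u)
      (mfderiv 𝓘(ℝ, ℝ × EuclideanSpace ℝ (Fin n)) (𝓘(ℝ, ℝ).prod (𝓡 n)) (D.carrierParam q) u a)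
      (mfderiv 𝓘(ℝ, ℝ × EuclideanSpace ℝ (Fin n)) (𝓘(ℝ, ℝ).prod (𝓡 n)) (D.carrierParam q) u b) =
    warpedForm D.rho D.sigma (D.hatCoordMetric q.2) (D.etaCoord q.2) u a b := by
  have key (x : D.Mhat) (hx : (D.carrierParam q u).2 = x) (v w : TangentSpace (𝓡 n) x)
      (v' w' : TangentSpace (𝓡 n) (D.carrierParam q u).2)
      (hv : (v' : EuclideanSpace ℝ (Fin n)) = v) (hw : (w' : EuclideanSpace ℝ (Fin n)) = w) :
      D.ghatEta _ v' w' = D.ghatEta x v w ∧ D.ghatPerp _ v' w' = D.ghatPerp x v w := by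
    subst hx
    cases hv
    cases hw
    exact ⟨rfl, rfl⟩
  have hκ := (D.carrierParam_mem_source q hu).2
  have h1 := key _ (D.carrierParam_snd q u) _ _ _ _ (D.dproj_carrierParam q hu a)
    (D.dproj_carrierParam q hu b)
  rw [metric, h1.1, h1.2, D.dt_carrierParam q hu, D.dt_carrierParam q hu, D.carrierParam_fst q hu,
    ghatPerp, ghatEta, warpedForm]
  have h2 : mfderiv 𝓘(ℝ, EuclideanSpace ℝ (Fin n)) (𝓡 n) (chartParam (𝓡 n) q.2) u.2
      (D.etaCoord q.2 u.2) = D.etahat (chartParam (𝓡 n) q.2 u.2) :=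
    mfderiv_coordField _ D.etahat hκ
  rw [← h2]
  rfl

theorem dproj_carrierParam_etaCoord (q : D.Carrier) {u : ℝ × EuclideanSpace ℝ (Fin n)}
    (hu : u ∈ (D.carrierParam q).source) :
    D.dproj (D.carrierParam q u)
      (mfderiv 𝓘(ℝ, ℝ × EuclideanSpace ℝ (Fin n)) (𝓘(ℝ, ℝ).prod (𝓡 n)) (D.carrierParam q) u
        ((0, D.etaCoord q.2 u.2) : ℝ × EuclideanSpace ℝ (Fin n))) =
      D.etahat (D.carrierParam q u).2 := by
  have hκ := (D.carrierParam_mem_source q hu).2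
  refine (D.dproj_carrierParam q hu (0, D.etaCoord q.2 u.2)).trans ?_
  refine (mfderiv_coordField (chartParam (𝓡 n) q.2) D.etahat hκ).trans ?_
  rw [D.carrierParam_snd q u]

theorem contDiffAt_etaCoord (x₀ : D.Mhat) {x : EuclideanSpace ℝ (Fin n)}
    (hx : x ∈ (chartParam (𝓡 n) x₀).source) : ContDiffAt ℝ ∞ (D.etaCoord x₀) x :=
  contDiffAt_coordField _ hx (D.killing.smooth _)

theorem hatCoordMetric_killing (x₀ : D.Mhat) {x : EuclideanSpace ℝ (Fin n)}
    (hx : x ∈ (chartParam (𝓡 n) x₀).source) (a b : EuclideanSpace ℝ (Fin n)) :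
    fderiv ℝ (D.hatCoordMetric x₀) x (D.etaCoord x₀ x) a b
      + D.hatCoordMetric x₀ x (fderiv ℝ (D.etaCoord x₀) x a) b
      + D.hatCoordMetric x₀ x (fderiv ℝ (D.etaCoord x₀) x b) a = 0 := by
  refine D.killing.coord (chartParam (𝓡 n) x₀) hx
    ((D.contDiffAt_etaCoord x₀ hx).differentiableAt (by simp)) ?_ a b
  filter_upwards [(chartParam (𝓡 n) x₀).open_source.mem_nhds hx] with w hw
  exact (mfderiv_coordField _ _ hw).symm

theorem hatCoordMetric_etaCoord (x₀ : D.Mhat) {x : EuclideanSpace ℝ (Fin n)}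
    (hx : x ∈ (chartParam (𝓡 n) x₀).source) :
    D.hatCoordMetric x₀ x (D.etaCoord x₀ x) (D.etaCoord x₀ x) = 1 := by
  have h : mfderiv 𝓘(ℝ, EuclideanSpace ℝ (Fin n)) (𝓡 n) (chartParam (𝓡 n) x₀) x
      (D.etaCoord x₀ x) = D.etahat (chartParam (𝓡 n) x₀ x) :=
    mfderiv_coordField _ D.etahat hx
  rw [hatCoordMetric, coordMetric_apply, h, D.unit]

end DoublyWarpedProduct

/-! ### The local DWP-structure of a doubly warped product -/

namespace DoublyWarpedProduct

variable {n : ℕ} (D : DoublyWarpedProduct.{u} n)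
  {M : Type u} [TopologicalSpace M]
  [ChartedSpace (EuclideanSpace ℝ (Fin (n + 1))) M] [IsManifold (𝓡 (n + 1)) ∞ M]
  [RiemannianBundle (fun x : M => TangentSpace (𝓡 (n + 1)) x)]

section Param

variable {Φ : D.Carrier → M}
  (hΦ : IsLocalDiffeomorph (𝓘(ℝ, ℝ).prod (𝓡 n)) (𝓡 (n + 1)) ∞ Φ)

/-- Coordinates `(t, x)` on the target of a local diffeomorphism from a doubly warped product. -/
def targetParam (q : D.Carrier) :
    PartialDiffeomorph 𝓘(ℝ, ℝ × EuclideanSpace ℝ (Fin n)) (𝓡 (n + 1))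
      (ℝ × EuclideanSpace ℝ (Fin n)) M ∞ :=
  (D.carrierParam q).trans (partialDiffeomorphAt (hΦ q))

omit [IsManifold (𝓡 (n + 1)) ∞ M] [RiemannianBundle (fun x : M => TangentSpace (𝓡 (n + 1)) x)] in
theorem exists_targetParam_eq (q : D.Carrier) :
    ∃ u ∈ (D.targetParam hΦ q).source, D.carrierParam q u = q := by
  obtain ⟨u, hu, h⟩ := D.exists_carrierParam_eq q
  refine ⟨u, ⟨hu, ?_⟩, h⟩
  change D.carrierParam q u ∈ (partialDiffeomorphAt (hΦ q)).source
  rw [h]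
  exact mem_source_partialDiffeomorphAt (hΦ q)

omit [IsManifold (𝓡 (n + 1)) ∞ M] [RiemannianBundle (fun x : M => TangentSpace (𝓡 (n + 1)) x)] in
theorem mfderiv_targetParam (q : D.Carrier) {u : ℝ × EuclideanSpace ℝ (Fin n)}
    (hu : u ∈ (D.targetParam hΦ q).source) (a : ℝ × EuclideanSpace ℝ (Fin n)) :
    mfderiv 𝓘(ℝ, ℝ × EuclideanSpace ℝ (Fin n)) (𝓡 (n + 1)) (D.targetParam hΦ q) u a =
      mfderiv (𝓘(ℝ, ℝ).prod (𝓡 n)) (𝓡 (n + 1)) Φ (D.carrierParam q u)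
        (mfderiv 𝓘(ℝ, ℝ × EuclideanSpace ℝ (Fin n)) (𝓘(ℝ, ℝ).prod (𝓡 n)) (D.carrierParam q) u a) :=
  DFunLike.congr_fun (mfderiv_comp u (hΦ.mdifferentiable (by simp) _)
    ((D.carrierParam q).mdifferentiableAt (by simp) hu.1)) a

omit [IsManifold (𝓡 (n + 1)) ∞ M] in
theorem coordMetric_targetParam
    (hm : ∀ (q : D.Carrier) (v w : TangentSpace (𝓘(ℝ, ℝ).prod (𝓡 n)) q),
      (inner ℝ (mfderiv (𝓘(ℝ, ℝ).prod (𝓡 n)) (𝓡 (n + 1)) Φ q v)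
        (mfderiv (𝓘(ℝ, ℝ).prod (𝓡 n)) (𝓡 (n + 1)) Φ q w) : ℝ) = D.metric q v w)
    (q : D.Carrier) {u : ℝ × EuclideanSpace ℝ (Fin n)}
    (hu : u ∈ (D.targetParam hΦ q).source) (a b : ℝ × EuclideanSpace ℝ (Fin n)) :
    coordMetric (D.targetParam hΦ q) u a b =
      warpedForm D.rho D.sigma (D.hatCoordMetric q.2) (D.etaCoord q.2) u a b := by
  rw [coordMetric_apply, D.mfderiv_targetParam hΦ q hu, D.mfderiv_targetParam hΦ q hu,
    ← D.metric_carrierParam q hu.1 a b]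
  exact hm _ _ _

end Param

section Slice

variable (t : D.interval) (y : D.Mhat)

/-- The slice `{t} × Mhat` of the doubly warped product. -/
def slice (x : D.Mhat) : D.Carrier := (t, x)

theorem contMDiff_slice : ContMDiff (𝓡 n) (𝓘(ℝ, ℝ).prod (𝓡 n)) ∞ (D.slice t) :=
  contMDiff_const.prodMk contMDiff_id

theorem dt_slice (w : TangentSpace (𝓡 n) y) :
    D.dt (D.slice t y) (mfderiv (𝓡 n) (𝓘(ℝ, ℝ).prod (𝓡 n)) (D.slice t) y w) = 0 := by
  have h := mfderiv_comp y (D.mdifferentiableAt_interval_coord (D.slice t y))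
    ((D.contMDiff_slice t).contMDiffAt.mdifferentiableAt (by simp))
  have h2 : ((fun q' : D.Carrier => ((q'.1 : D.interval) : ℝ)) ∘ D.slice t) =
      fun _ => (t : ℝ) := rfl
  rw [h2, mfderiv_const] at h
  exact (DFunLike.congr_fun h w).symm

theorem dproj_slice (w : TangentSpace (𝓡 n) y) :
    D.dproj (D.slice t y) (mfderiv (𝓡 n) (𝓘(ℝ, ℝ).prod (𝓡 n)) (D.slice t) y w) = w := by
  have h := mfderiv_comp y (g := (Prod.snd : D.Carrier → D.Mhat))
    ((contMDiff_snd (n := ∞)).contMDiffAt.mdifferentiableAt (by simp))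
    ((D.contMDiff_slice t).contMDiffAt.mdifferentiableAt (by simp))
  have h2 : ((Prod.snd : D.Carrier → D.Mhat) ∘ D.slice t) = id := rfl
  rw [h2, mfderiv_id] at h
  exact (DFunLike.congr_fun h w).symm

theorem metric_of_dproj_eq_zero {q : D.Carrier} {v : TangentSpace (𝓘(ℝ, ℝ).prod (𝓡 n)) q}
    (hv : D.dproj q v = 0) (w : TangentSpace (𝓘(ℝ, ℝ).prod (𝓡 n)) q) :
    D.metric q v w = D.dt q v * D.dt q w := by
  simp [metric, ghatEta, ghatPerp, hv]

end Slice

variable [IsContMDiffRiemannianBundle (𝓡 (n + 1)) ∞ (EuclideanSpace ℝ (Fin (n + 1)))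
      (fun x : M => TangentSpace (𝓡 (n + 1)) x)]

set_option maxHeartbeats 1000000 in
set_option synthInstance.maxHeartbeats 400000 in
/-- A manifold isometric to a doubly warped product has a local DWP-structure: `ν = ∂_t` and `η` is
the lift of the Killing field `etahat`. -/
theorem exists_isLocalDWPStructure (hD : D.IsIsometricTo (Set.univ : Set M)) :
    ∃ ν η : Π x : M, TangentSpace (𝓡 (n + 1)) x, IsLocalDWPStructure ν η := by
  obtain ⟨Φ, hΦ, hinj, hrange, hm⟩ := hD
  have hsurj : Surjective Φ := range_eq_univ.1 hrange
  choose inv hinv using hsurj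
  have hinv' (q : D.Carrier) : inv (Φ q) = q := hinj (hinv _)
  choose V0 hV0 hV0' using fun q => D.exists_lift q 1 0
  choose V1 hV1 hV1' using fun q => D.exists_lift q 0 (D.etahat q.2)
  let ν : Π x : M, TangentSpace (𝓡 (n + 1)) x := fun m =>
    (mfderiv (𝓘(ℝ, ℝ).prod (𝓡 n)) (𝓡 (n + 1)) Φ (inv m) (V0 (inv m)) :
      EuclideanSpace ℝ (Fin (n + 1)))
  let η : Π x : M, TangentSpace (𝓡 (n + 1)) x := fun m =>
    (mfderiv (𝓘(ℝ, ℝ).prod (𝓡 n)) (𝓡 (n + 1)) Φ (inv m) (V1 (inv m)) :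
      EuclideanSpace ℝ (Fin (n + 1)))
  let τ : M → ℝ := fun m => ((inv m).1 : ℝ)
  have hνΦ (q : D.Carrier) : ν (Φ q) =
      mfderiv (𝓘(ℝ, ℝ).prod (𝓡 n)) (𝓡 (n + 1)) Φ q (V0 q) := by
    have : ∀ q' : D.Carrier, q' = q →
        (mfderiv (𝓘(ℝ, ℝ).prod (𝓡 n)) (𝓡 (n + 1)) Φ q' (V0 q') :
          EuclideanSpace ℝ (Fin (n + 1))) =
        mfderiv (𝓘(ℝ, ℝ).prod (𝓡 n)) (𝓡 (n + 1)) Φ q (V0 q) := by rintro _ rfl; rfl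
    exact this _ (hinv' q)
  have hηΦ (q : D.Carrier) : η (Φ q) =
      mfderiv (𝓘(ℝ, ℝ).prod (𝓡 n)) (𝓡 (n + 1)) Φ q (V1 q) := by
    have : ∀ q' : D.Carrier, q' = q →
        (mfderiv (𝓘(ℝ, ℝ).prod (𝓡 n)) (𝓡 (n + 1)) Φ q' (V1 q') :
          EuclideanSpace ℝ (Fin (n + 1))) =
        mfderiv (𝓘(ℝ, ℝ).prod (𝓡 n)) (𝓡 (n + 1)) Φ q (V1 q) := by rintro _ rfl; rfl
    exact this _ (hinv' q)
  -- Coordinate expressions of `ν`, `η`, the coordinate `t` and the metric.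
  let χ := D.targetParam hΦ
  have hcover (m : M) : ∃ q, ∃ u ∈ (χ q).source, χ q u = m := by
    obtain ⟨u, hu, h⟩ := D.exists_targetParam_eq hΦ (inv m)
    refine ⟨inv m, u, hu, ?_⟩
    change Φ (D.carrierParam (inv m) u) = m
    rw [h, hinv]
  have hG (q : D.Carrier) {u} (hu : u ∈ (χ q).source) (a b : ℝ × EuclideanSpace ℝ (Fin n)) :
      coordMetric (χ q) u a b =
        warpedForm D.rho D.sigma (D.hatCoordMetric q.2) (D.etaCoord q.2) u a b :=
    D.coordMetric_targetParam hΦ hm q hu a b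
  have hν (q : D.Carrier) {u} (hu : u ∈ (χ q).source) : ν (χ q u) =
      mfderiv 𝓘(ℝ, ℝ × EuclideanSpace ℝ (Fin n)) (𝓡 (n + 1)) (χ q) u
        ((1, 0) : ℝ × EuclideanSpace ℝ (Fin n)) := by
    refine (hνΦ (D.carrierParam q u)).trans ?_
    refine Eq.trans ?_ (D.mfderiv_targetParam hΦ q hu (1, 0)).symm
    congr 1
    refine D.eq_of_dt_eq_of_dproj_eq _ ?_ ?_
    · rw [hV0, D.dt_carrierParam q hu.1]
    · rw [hV0']
      refine Eq.trans ?_ (D.dproj_carrierParam q hu.1 (1, 0)).symm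
      exact (map_zero _).symm
  have hη (q : D.Carrier) {u} (hu : u ∈ (χ q).source) : η (χ q u) =
      mfderiv 𝓘(ℝ, ℝ × EuclideanSpace ℝ (Fin n)) (𝓡 (n + 1)) (χ q) u
        ((0, D.etaCoord q.2 u.2) : ℝ × EuclideanSpace ℝ (Fin n)) := by
    refine (hηΦ (D.carrierParam q u)).trans ?_
    refine Eq.trans ?_ (D.mfderiv_targetParam hΦ q hu (0, D.etaCoord q.2 u.2)).symm
    congr 1
    refine D.eq_of_dt_eq_of_dproj_eq _ ?_ ?_
    · rw [hV1, D.dt_carrierParam q hu.1]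
    · rw [hV1', D.dproj_carrierParam_etaCoord q hu.1]
  have hτ (q : D.Carrier) {u} (hu : u ∈ (χ q).source) : τ (χ q u) = u.1 := by
    change ((inv (Φ (D.carrierParam q u))).1 : ℝ) = u.1
    rw [hinv', D.carrierParam_fst q hu.1]
  have hev (q : D.Carrier) {u} (hu : u ∈ (χ q).source) : ∀ᶠ w in 𝓝 u, w ∈ (χ q).source :=
    (χ q).open_source.mem_nhds hu
  have hκ (q : D.Carrier) {u} (hu : u ∈ (χ q).source) :
      u.1 ∈ D.interval ∧ u.2 ∈ (chartParam (𝓡 n) q.2).source := D.carrierParam_mem_source q hu.1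
  have hunit (q : D.Carrier) {u} (hu : u ∈ (χ q).source) :=
    D.hatCoordMetric_etaCoord q.2 (hκ q hu).2
  have hG0 (q : D.Carrier) {u} (hu : u ∈ (χ q).source) (b : ℝ × EuclideanSpace ℝ (Fin n)) :
      coordMetric (χ q) u (1, 0) b = b.1 := by
    rw [hG q hu]; simp [warpedForm]
  have hG1 (q : D.Carrier) {u} (hu : u ∈ (χ q).source) (b : ℝ × EuclideanSpace ℝ (Fin n)) :
      coordMetric (χ q) u (0, D.etaCoord q.2 u.2) b =
        D.rho u.1 ^ 2 * D.hatCoordMetric q.2 u.2 b.2 (D.etaCoord q.2 u.2) := by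
    rw [hG q hu, warpedForm, hunit q hu]
    have := coordMetric_symm (chartParam (𝓡 n) q.2) u.2 b.2 (D.etaCoord q.2 u.2)
    simp only [hatCoordMetric] at this ⊢
    rw [this]
    ring
  -- The covariant derivative of `ν`.
  have hdν (q : D.Carrier) {u} (hu : u ∈ (χ q).source) (a b : ℝ × EuclideanSpace ℝ (Fin n)) :
      (inner ℝ (leviCivita (𝓡 (n + 1)) ν (χ q u)
        (mfderiv 𝓘(ℝ, ℝ × EuclideanSpace ℝ (Fin n)) (𝓡 (n + 1)) (χ q) u a))
      (mfderiv 𝓘(ℝ, ℝ × EuclideanSpace ℝ (Fin n)) (𝓡 (n + 1)) (χ q) u b :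
        TangentSpace (𝓡 (n + 1)) (χ q u)) : ℝ) =
      D.rho u.1 * deriv D.rho u.1 * (D.hatCoordMetric q.2 u.2 a.2 (D.etaCoord q.2 u.2) *
        D.hatCoordMetric q.2 u.2 b.2 (D.etaCoord q.2 u.2))
      + D.sigma u.1 * deriv D.sigma u.1 * (D.hatCoordMetric q.2 u.2 a.2 b.2 -
        D.hatCoordMetric q.2 u.2 a.2 (D.etaCoord q.2 u.2) *
        D.hatCoordMetric q.2 u.2 b.2 (D.etaCoord q.2 u.2)) := by
    have hI := D.interval.isOpen.mem_nhds (hκ q hu).1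
    rw [inner_leviCivita_adapted (χ q) hu ((hev q hu).mono fun w hw => hν q hw)
      ((hev q hu).mono fun w hw => hG0 q hw),
      fderiv_fst_warpedForm (differentiableAt_coordMetric (χ q) hu)
        ((hev q hu).mono fun w hw => hG q hw)
        ((D.rho_smooth.contDiffAt hI).differentiableAt (by simp))
        ((D.sigma_smooth.contDiffAt hI).differentiableAt (by simp))]
    ring
  have hperp (q : D.Carrier) {u} (hu : u ∈ (χ q).source) (a : ℝ × EuclideanSpace ℝ (Fin n)) :
      mfderiv 𝓘(ℝ, ℝ × EuclideanSpace ℝ (Fin n)) (𝓡 (n + 1)) (χ q) u a ∈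
        orthogonalDistribution (𝓡 (n + 1)) ν (χ q u) ↔ a.1 = 0 := by
    rw [orthogonalDistribution, Submodule.mem_orthogonal_singleton_iff_inner_right, hν q hu,
      ← hG0 q hu a]
    rfl
  -- The coordinate `t` is constant along the leaves.
  have hdτ (m : M) : MDifferentiableAt (𝓡 (n + 1)) 𝓘(ℝ, ℝ) τ m ∧
      ∀ v ∈ orthogonalDistribution (𝓡 (n + 1)) ν m, mvfderiv (𝓡 (n + 1)) τ m v = 0 := by
    obtain ⟨q, u, hu, rfl⟩ := hcover m
    have h1 : MDifferentiableAt (𝓡 (n + 1)) 𝓘(ℝ, ℝ) τ (χ q u) := by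
      have h2 : MDifferentiableAt (𝓡 (n + 1)) 𝓘(ℝ, ℝ)
          ((Prod.fst : ℝ × EuclideanSpace ℝ (Fin n) → ℝ) ∘ (χ q).symm) (χ q u) :=
        MDifferentiableAt.comp _ differentiableAt_fst.mdifferentiableAt
          ((χ q).symm.mdifferentiableAt (by simp) ((χ q).map_source hu))
      refine h2.congr_of_eventuallyEq ?_
      filter_upwards [(χ q).open_target.mem_nhds ((χ q).map_source hu)] with m hm
      have h3 : χ q ((χ q).symm m) = m := (χ q).right_inv hm
      have h4 := hτ q ((χ q).map_target hm)
      exact (congrArg τ h3).symm.trans h4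
    refine ⟨h1, fun v hv => ?_⟩
    obtain ⟨a, rfl⟩ := mfderiv_surjective (χ q) hu v
    rw [mvfderiv_param (χ q) (k := Prod.fst) hu h1 ((hev q hu).mono fun w hw => hτ q hw)]
    rw [fderiv_fst]
    exact (hperp q hu a).1 hv
  have hleaf : IsConstantAlongLeaves (𝓡 (n + 1)) (orthogonalDistribution (𝓡 (n + 1)) ν) n τ := by
    intro N _ _ _ _ _ _ i hi y z
    have h1 (x : N) := (hdτ (i x)).1.hasMFDerivAt.comp x
      ((hi.smooth x).mdifferentiableAt (by simp)).hasMFDerivAt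
    refine eq_of_mfderiv_eq_zero (f := τ ∘ i) (fun x => (h1 x).mdifferentiableAt) (fun x => ?_) y z
    refine (h1 x).mfderiv.trans ?_
    ext w
    refine (hdτ (i x)).2 _ ?_
    rw [← SetLike.mem_coe, ← hi.tangent x]
    exact mem_range_self w
  have hηη (m : M) : (inner ℝ (η m) (η m) : ℝ) = D.rho (τ m) ^ 2 ∧ τ m ∈ D.interval := by
    obtain ⟨q, u, hu, rfl⟩ := hcover m
    refine ⟨?_, (inv _).1.2⟩
    rw [hη q hu, hτ q hu]
    refine (hG1 q hu (0, D.etaCoord q.2 u.2)).trans ?_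
    rw [hunit q hu, mul_one]
  -- The Weingarten map, as a bilinear form.
  have hW (q : D.Carrier) {u} (hu : u ∈ (χ q).source) (a b : ℝ × EuclideanSpace ℝ (Fin n)) :
      (inner ℝ (weingarten (𝓡 (n + 1)) ν (χ q u)
        (mfderiv 𝓘(ℝ, ℝ × EuclideanSpace ℝ (Fin n)) (𝓡 (n + 1)) (χ q) u a))
      (mfderiv 𝓘(ℝ, ℝ × EuclideanSpace ℝ (Fin n)) (𝓡 (n + 1)) (χ q) u b :
        TangentSpace (𝓡 (n + 1)) (χ q u)) : ℝ) =
      -(D.rho u.1 * deriv D.rho u.1 * (D.hatCoordMetric q.2 u.2 a.2 (D.etaCoord q.2 u.2) *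
        D.hatCoordMetric q.2 u.2 b.2 (D.etaCoord q.2 u.2))
      + D.sigma u.1 * deriv D.sigma u.1 * (D.hatCoordMetric q.2 u.2 a.2 b.2 -
        D.hatCoordMetric q.2 u.2 a.2 (D.etaCoord q.2 u.2) *
        D.hatCoordMetric q.2 u.2 b.2 (D.etaCoord q.2 u.2))) := by
    rw [← hdν q hu, weingarten, neg_apply, inner_neg_left]
  -- The eigenvalues of the Weingarten map are the logarithmic derivatives `-ρ'/ρ` and `-σ'/σ`.
  refine ⟨ν, η, ⟨fun m => ?_, fun m => ?_, fun m => ?_⟩, fun p => ?_, ⟨fun m => ?_, fun m => ?_⟩,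
    ?_, fun m => ?_, fun N _ _ _ _ _ _ i hi y z => ?_,
    fun m => -(deriv D.rho (τ m) / D.rho (τ m)), fun m => -(deriv D.sigma (τ m) / D.sigma (τ m)),
    fun m v hv => ?_, fun m v hv => ?_, fun N _ _ _ _ _ _ i hi y z => ?_,
    fun N _ _ _ _ _ _ i hi y z => ?_⟩
  · obtain ⟨q, u, hu, rfl⟩ := hcover m
    exact contMDiffAt_of_coord (χ q) hu ((hev q hu).mono fun w hw => hν q hw) contDiffAt_const
  · obtain ⟨q, u, hu, rfl⟩ := hcover m
    rw [hν q hu]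
    exact hG0 q hu (1, 0)
  · obtain ⟨q, u, hu, rfl⟩ := hcover m
    refine ext_inner_right ℝ fun w => ?_
    obtain ⟨b, rfl⟩ := mfderiv_surjective (χ q) hu w
    rw [hν q hu, hdν q hu]
    simp
  · refine ⟨D.Mhat, inferInstance, inferInstance, inferInstance, inferInstance, inferInstance,
      inferInstance, Φ ∘ D.slice (inv p).1, ⟨hΦ.contMDiff.comp (D.contMDiff_slice _), ?_, ?_, ?_⟩,
      (inv p).2, hinv p⟩
    · exact hinj.comp fun x y h => congrArg Prod.snd h
    all_goals
      intro y
      have hd := mfderiv_comp y (hΦ.mdifferentiable (by simp) (D.slice (inv p).1 y))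
        ((D.contMDiff_slice (inv p).1).contMDiffAt.mdifferentiableAt (by simp))
      have hΦd : Bijective (mfderiv (𝓘(ℝ, ℝ).prod (𝓡 n)) (𝓡 (n + 1)) Φ (D.slice (inv p).1 y)) :=
        ((hΦ (D.slice (inv p).1 y)).mfderivToContinuousLinearEquiv (by simp)).bijective
      rw [hd]
    · intro w w' h
      have h2 := congrArg (D.dproj _) (hΦd.1 h)
      exact (D.dproj_slice _ y w).symm.trans (h2.trans (D.dproj_slice _ y w'))
    · have hmem (z) : mfderiv (𝓘(ℝ, ℝ).prod (𝓡 n)) (𝓡 (n + 1)) Φ (D.slice (inv p).1 y) z ∈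
          orthogonalDistribution (𝓡 (n + 1)) ν (Φ (D.slice (inv p).1 y)) ↔ D.dt _ z = 0 := by
        rw [orthogonalDistribution, Submodule.mem_orthogonal_singleton_iff_inner_right, hνΦ, hm,
          D.metric_of_dproj_eq_zero (hV0' _), hV0, one_mul]
      ext v
      obtain ⟨z, rfl⟩ := hΦd.2 v
      refine ⟨?_, fun h => ⟨D.dproj _ z, congrArg _ (D.eq_of_dt_eq_of_dproj_eq _ ?_ ?_)⟩⟩
      · rintro ⟨w, hw⟩
        rw [← hw]
        exact (hmem _).2 (D.dt_slice _ y w)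
      · exact (D.dt_slice _ y _).trans ((hmem z).1 h).symm
      · exact D.dproj_slice _ y _
  · obtain ⟨q, u, hu, rfl⟩ := hcover m
    refine contMDiffAt_of_coord (χ q) hu ((hev q hu).mono fun w hw => hη q hw) ?_
    exact contDiffAt_const.prodMk ((D.contDiffAt_etaCoord q.2 (hκ q hu).2).comp u contDiffAt_snd)
  · obtain ⟨q, u, hu, rfl⟩ := hcover m
    intro v w
    obtain ⟨a, rfl⟩ := mfderiv_surjective (χ q) hu v
    obtain ⟨b, rfl⟩ := mfderiv_surjective (χ q) hu w
    have hy := (D.contDiffAt_etaCoord q.2 (hκ q hu).2).differentiableAt (by simp)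
    have hd : HasFDerivAt (fun w : ℝ × EuclideanSpace ℝ (Fin n) =>
        ((0 : ℝ), D.etaCoord q.2 w.2)) _ u :=
      (hasFDerivAt_const _ _).prodMk (hy.hasFDerivAt.comp u hasFDerivAt_snd)
    rw [leviCivita_symmetrized_coord (χ q) hu hd.differentiableAt
      ((hev q hu).mono fun w hw => hη q hw), hd.fderiv]
    exact warpedForm_killing (differentiableAt_coordMetric (χ q) hu)
      ((hev q hu).mono fun w hw => hG q hw) (differentiableAt_coordMetric _ (hκ q hu).2) hy
      (Filter.Eventually.of_forall fun x => coordMetric_symm _ x)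
      (D.hatCoordMetric_killing q.2 (hκ q hu).2) a b
  · obtain ⟨t, ht⟩ := D.interval_nonempty
    obtain ⟨x⟩ := (inferInstance : Nonempty D.Mhat)
    refine ⟨Φ (⟨t, ht⟩, x), fun h => ?_⟩
    have h1 := hηη (Φ (⟨t, ht⟩, x))
    rw [h, inner_zero_left] at h1
    exact (pow_pos (D.rho_pos _ h1.2) 2).ne h1.1
  · obtain ⟨q, u, hu, rfl⟩ := hcover m
    rw [hη q hu, hν q hu, real_inner_comm]
    exact hG0 q hu (0, D.etaCoord q.2 u.2)
  · simp only [(hηη _).1, Real.sqrt_sq (D.rho_pos _ (hηη _).2).le, hleaf N i hi y z]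
  · obtain ⟨q, u, hu, rfl⟩ := hcover m
    obtain ⟨c, rfl⟩ := Submodule.mem_span_singleton.1 hv
    refine ext_inner_right ℝ fun w => ?_
    obtain ⟨b, rfl⟩ := mfderiv_surjective (χ q) hu w
    have h1 := hW q hu (0, D.etaCoord q.2 u.2) b
    have h2 := hG1 q hu b
    rw [coordMetric_apply] at h2
    have h3 : D.rho u.1 ≠ 0 := (D.rho_pos _ (hκ q hu).1).ne'
    have h4 : D.hatCoordMetric q.2 u.2 (D.etaCoord q.2 u.2) b.2 =
      D.hatCoordMetric q.2 u.2 b.2 (D.etaCoord q.2 u.2) := coordMetric_symm _ _ _ _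
    rw [hη q hu, map_smul, inner_smul_left, inner_smul_left, inner_smul_left, h1, h2]
    simp only [conj_trivial]
    rw [hτ q hu, hunit q hu, h4]
    field_simp
    ring
  · obtain ⟨q, u, hu, rfl⟩ := hcover m
    obtain ⟨a, rfl⟩ := mfderiv_surjective (χ q) hu v
    refine ext_inner_right ℝ fun w => ?_
    obtain ⟨b, rfl⟩ := mfderiv_surjective (χ q) hu w
    have ha := (hperp q hu a).1 hv.2
    have h1 := hW q hu a b
    have h2 := hG q hu a b
    rw [coordMetric_apply] at h2
    have h3 : D.rho u.1 ≠ 0 := (D.rho_pos _ (hκ q hu).1).ne'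
    have h3' : D.sigma u.1 ≠ 0 := (D.sigma_pos _ (hκ q hu).1).ne'
    have h4 : D.hatCoordMetric q.2 u.2 a.2 (D.etaCoord q.2 u.2) = 0 := by
      have h5 := Submodule.mem_orthogonal_singleton_iff_inner_right.1 hv.1
      rw [hη q hu] at h5
      have h6 := (hG1 q hu a).symm.trans h5
      exact (mul_eq_zero.1 h6).resolve_left (pow_ne_zero 2 h3)
    rw [h1, inner_smul_left, h2]
    simp only [conj_trivial]
    rw [hτ q hu, warpedForm, h4, ha]
    field_simp
    ring
  · simp only [hleaf N i hi y z]
  · simp only [hleaf N i hi y z]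

end DoublyWarpedProduct

/-! ### Open subsets of a vector space as Riemannian manifolds -/

/-- A positive definite form on a finite-dimensional space dominates a multiple of the norm. -/
theorem exists_le_bilin_self {V : Type*} [NormedAddCommGroup V] [NormedSpace ℝ V]
    [FiniteDimensional ℝ V] (g : V →L[ℝ] V →L[ℝ] ℝ) (hg : ∀ v, v ≠ 0 → 0 < g v v) :
    ∃ m > 0, ∀ v, m * ‖v‖ ^ 2 ≤ g v v := by
  have hc : Continuous fun v => g v v := by fun_prop
  obtain h0 | ⟨w, hw⟩ := (Metric.sphere (0 : V) 1).eq_empty_or_nonempty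
  · refine ⟨1, one_pos, fun v => ?_⟩
    have hv : v = 0 := by
      by_contra hv
      have : ‖v‖⁻¹ • v ∈ Metric.sphere (0 : V) 1 := by
        simp [norm_smul, norm_ne_zero_iff.2 hv]
      simp [h0] at this
    simp [hv]
  · obtain ⟨z, hz, hmin⟩ := (isCompact_sphere (0 : V) 1).exists_isMinOn ⟨w, hw⟩ hc.continuousOn
    have hz0 : z ≠ 0 := by
      rintro rfl
      simp at hz
    refine ⟨g z z, hg z hz0, fun v => ?_⟩
    by_cases hv : v = 0
    · simp [hv]
    have hv' := norm_pos_iff.2 hv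
    have h1 : g z z ≤ g (‖v‖⁻¹ • v) (‖v‖⁻¹ • v) :=
      hmin (by simp [norm_smul, norm_ne_zero_iff.2 hv] : ‖v‖⁻¹ • v ∈ Metric.sphere (0 : V) 1)
    simp only [map_smul, smul_apply, smul_eq_mul] at h1
    calc g z z * ‖v‖ ^ 2 ≤ (‖v‖⁻¹ * (‖v‖⁻¹ * g v v)) * ‖v‖ ^ 2 := by gcongr
      _ = g v v := by field_simp

section LiftedOpen

variable {V : Type} [NormedAddCommGroup V] [NormedSpace ℝ V]

/-- An open subset of a vector space as a manifold in a given universe, with a single chart. -/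
def LiftedOpen (O : TopologicalSpace.Opens V) : Type u := ULift.{u} O

namespace LiftedOpen

variable (O : TopologicalSpace.Opens V)

/-- The inclusion into the vector space. -/
def emb (x : LiftedOpen.{u} O) : V := x.down.1

/-- A point of the open set as a point of the manifold. -/
def mk (v : V) (hv : v ∈ O) : LiftedOpen.{u} O := ⟨⟨v, hv⟩⟩

instance : TopologicalSpace (LiftedOpen.{u} O) := inferInstanceAs (TopologicalSpace (ULift.{u} O))

omit [NormedSpace ℝ V] in
theorem isOpenEmbedding_emb : Topology.IsOpenEmbedding (emb.{u} O) :=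
  O.isOpenEmbedding'.comp Homeomorph.ulift.isOpenEmbedding

omit [NormedSpace ℝ V] in
theorem range_emb : range (emb.{u} O) = O := by
  ext v
  exact ⟨fun ⟨x, hx⟩ => hx ▸ x.down.2, fun hv => ⟨mk O v hv, rfl⟩⟩

instance : T2Space (LiftedOpen.{u} O) := (isOpenEmbedding_emb O).isEmbedding.t2Space

instance [FiniteDimensional ℝ V] : SecondCountableTopology (LiftedOpen.{u} O) :=
  (isOpenEmbedding_emb O).isEmbedding.secondCountableTopology

variable [hO : Nonempty O]

instance : Nonempty (LiftedOpen.{u} O) := hO.map ULift.up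

omit [NormedSpace ℝ V] in
theorem connectedSpace (h : IsPreconnected (O : Set V)) : ConnectedSpace (LiftedOpen.{u} O) := by
  have : PreconnectedSpace O := isPreconnected_iff_preconnectedSpace.1 h
  have h1 : PreconnectedSpace (LiftedOpen.{u} O) :=
    ⟨((Homeomorph.ulift.{u} (X := O)).isPreconnected_preimage (s := univ)).2 isPreconnected_univ⟩
  exact { toNonempty := inferInstance }

instance : ChartedSpace V (LiftedOpen.{u} O) := (isOpenEmbedding_emb O).singletonChartedSpace

instance : IsManifold 𝓘(ℝ, V) ∞ (LiftedOpen.{u} O) :=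
  (isOpenEmbedding_emb O).isManifold_singleton

theorem extChartAt_target (x : LiftedOpen.{u} O) : (extChartAt 𝓘(ℝ, V) x).target = O := by
  rw [_root_.extChartAt_target]
  simp [range_emb]

theorem extChartAt_source (x : LiftedOpen.{u} O) : (extChartAt 𝓘(ℝ, V) x).source = univ := by
  rw [_root_.extChartAt_source]
  rfl

theorem contMDiff_emb : ContMDiff 𝓘(ℝ, V) 𝓘(ℝ, V) ∞ (emb.{u} O) := fun x =>
  contMDiffAt_extChartAt (I := 𝓘(ℝ, V)) (x := x)

theorem mfderiv_emb (x : LiftedOpen.{u} O) :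
    mfderiv 𝓘(ℝ, V) 𝓘(ℝ, V) (emb O) x = ContinuousLinearMap.id ℝ V := by
  rw [((contMDiff_emb O).mdifferentiable (by simp) x).mfderiv]
  have hx : emb O x ∈ O := x.down.2
  have h : (writtenInExtChartAt 𝓘(ℝ, V) 𝓘(ℝ, V) x (emb O)) =ᶠ[𝓝 (emb O x)] id := by
    filter_upwards [O.isOpen.mem_nhds hx] with v hv
    exact (extChartAt 𝓘(ℝ, V) x).right_inv (by rw [extChartAt_target]; exact hv)
  simp only [modelWithCornersSelf_coe, range_id, fderivWithin_univ]
  exact h.fderiv_eq.trans fderiv_id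

/-- The parametrization of the manifold by the open set. -/
def param (x₀ : LiftedOpen.{u} O) : PartialDiffeomorph 𝓘(ℝ, V) 𝓘(ℝ, V) V (LiftedOpen.{u} O) ∞ :=
  chartParam 𝓘(ℝ, V) x₀

theorem param_source (x₀ : LiftedOpen.{u} O) : (param O x₀).source = O := extChartAt_target O x₀

theorem emb_param (x₀ : LiftedOpen.{u} O) {v : V} (hv : v ∈ O) : emb O (param O x₀ v) = v :=
  (extChartAt 𝓘(ℝ, V) x₀).right_inv (by rw [extChartAt_target]; exact hv)

theorem param_emb (x₀ x : LiftedOpen.{u} O) : param O x₀ (emb O x) = x :=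
  (extChartAt 𝓘(ℝ, V) x₀).left_inv (by rw [extChartAt_source]; trivial)

theorem mfderiv_param (x₀ : LiftedOpen.{u} O) {v : V} (hv : v ∈ O) (w : V) :
    (mfderiv 𝓘(ℝ, V) 𝓘(ℝ, V) (param O x₀) v w : V) = w := by
  have hs : v ∈ (param O x₀).source := by rw [param_source]; exact hv
  have h := mfderiv_comp v ((contMDiff_emb O).mdifferentiable (by simp) (param O x₀ v))
    ((param O x₀).mdifferentiableAt (by simp) hs)
  have h2 : (emb O ∘ param O x₀) =ᶠ[𝓝 v] id := by
    filter_upwards [O.isOpen.mem_nhds hv] with z hz using emb_param O x₀ hz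
  rw [h2.mfderiv_eq, mfderiv_id, mfderiv_emb] at h
  exact (DFunLike.congr_fun h w).symm

theorem mem_chartAt_source (x y : LiftedOpen.{u} O) : y ∈ (chartAt V x).source := by
  have h : y ∈ (extChartAt 𝓘(ℝ, V) x).source := by rw [extChartAt_source]; trivial
  rwa [_root_.extChartAt_source] at h

theorem symm_trivializationAt (x y : LiftedOpen.{u} O) (v : V) :
    ((trivializationAt V (TangentSpace 𝓘(ℝ, V)) x).symm y v : V) = v := by
  have hy := mem_chartAt_source O x y
  have h1 := Trivialization.symmL_apply (R := ℝ) (trivializationAt V (TangentSpace 𝓘(ℝ, V)) x)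
    (b := y) hy v
  have h2 := DFunLike.congr_fun (TangentBundle.symmL_trivializationAt_eq_core
    (I := 𝓘(ℝ, V)) hy) v
  refine h1.symm.trans (h2.trans ?_)
  exact (tangentBundleCore 𝓘(ℝ, V) (LiftedOpen.{u} O)).coordChange_self (achart V x) y hy v

section Metric

variable [FiniteDimensional ℝ V] (g : V → V →L[ℝ] V →L[ℝ] ℝ) (hg : ContDiffOn ℝ ∞ g O)
  (hs : ∀ x ∈ O, ∀ a b, g x a b = g x b a) (hp : ∀ x ∈ O, ∀ a, a ≠ 0 → 0 < g x a a)

/-- The form `g x` on the tangent space at `x`. -/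
def form (x : LiftedOpen.{u} O) :
    TangentSpace 𝓘(ℝ, V) x →L[ℝ] TangentSpace 𝓘(ℝ, V) x →L[ℝ] ℝ :=
  (g (emb O x) : V →L[ℝ] V →L[ℝ] ℝ)

omit [FiniteDimensional ℝ V] in
include hg in
theorem contMDiff_form : ContMDiff 𝓘(ℝ, V) (𝓘(ℝ, V).prod 𝓘(ℝ, V →L[ℝ] V →L[ℝ] ℝ)) ∞
    (fun x : LiftedOpen.{u} O => TotalSpace.mk' (V →L[ℝ] V →L[ℝ] ℝ)
      (E := fun x : LiftedOpen.{u} O =>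
        TangentSpace 𝓘(ℝ, V) x →L[ℝ] TangentSpace 𝓘(ℝ, V) x →L[ℝ] ℝ) x (form O g x)) := by
  intro x
  rw [contMDiffAt_section]
  have h1 : ContMDiffAt 𝓘(ℝ, V) 𝓘(ℝ, V →L[ℝ] V →L[ℝ] ℝ) ∞ (fun y => g (emb O y)) x :=
    ((hg.contDiffAt (O.isOpen.mem_nhds x.down.2)).contMDiffAt).comp x (contMDiff_emb O x)
  convert! h1 using 1
  ext y v w
  refine (inCoordinates_apply_eq₂ (F₁ := V) (F₂ := V) (F₃ := ℝ)
    (E₁ := fun x : LiftedOpen.{u} O => TangentSpace 𝓘(ℝ, V) x)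
    (E₂ := fun x : LiftedOpen.{u} O => TangentSpace 𝓘(ℝ, V) x)
    (E₃ := fun _ : LiftedOpen.{u} O => ℝ) (x₀ := x) (x := y) (ϕ := form O g y) (v := v) (w := w)
    ?_ ?_ (mem_univ _)).trans ?_
  · exact mem_chartAt_source O x y
  · exact mem_chartAt_source O x y
  refine (DFunLike.congr_fun (Bundle.Trivial.linearMapAt_trivialization ℝ _ ℝ y) _).trans ?_
  exact congrArg₂ (fun a b => g (emb O y) a b) (symm_trivializationAt O x y v)
    (symm_trivializationAt O x y w)

/-- The Riemannian metric with given coefficients. -/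
def metric : ContMDiffRiemannianMetric 𝓘(ℝ, V) ∞ V
    (fun x : LiftedOpen.{u} O => TangentSpace 𝓘(ℝ, V) x) where
  inner := form O g
  symm x v w := hs _ x.down.2 v w
  pos x v hv := hp _ x.down.2 v hv
  isVonNBounded x := by
    change Bornology.IsVonNBounded ℝ {v : V | g (emb O x) v v < 1}
    obtain ⟨m, hm, h⟩ := exists_le_bilin_self (g (emb O x)) (hp _ x.down.2)
    rw [NormedSpace.isVonNBounded_iff]
    refine (Metric.isBounded_closedBall (x := (0 : V)) (r := max 1 (1 / m))).subset fun v hv => ?_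
    have h1 : m * ‖v‖ ^ 2 < 1 := (h v).trans_lt hv
    rw [mem_closedBall_zero_iff]
    by_contra! h2
    have h3 := max_lt_iff.1 h2
    have h4 : 1 < ‖v‖ * m := (div_lt_iff₀ hm).1 h3.2
    nlinarith
  contMDiff := contMDiff_form O g hg

theorem coordMetric_param (x₀ : LiftedOpen.{u} O) {v : V} (hv : v ∈ O) (a b : V) :
    letI : RiemannianBundle (fun x : LiftedOpen.{u} O => TangentSpace 𝓘(ℝ, V) x) :=
      ⟨(metric O g hg hs hp).toRiemannianMetric⟩
    coordMetric (param O x₀) v a b = g v a b := by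
  change g (emb O (param O x₀ v)) (mfderiv 𝓘(ℝ, V) 𝓘(ℝ, V) (param O x₀) v a)
    (mfderiv 𝓘(ℝ, V) 𝓘(ℝ, V) (param O x₀) v b) = g v a b
  rw [emb_param O x₀ hv]
  exact congrArg₂ (fun a b => g v a b) (mfderiv_param O x₀ hv a) (mfderiv_param O x₀ hv b)

end Metric

end LiftedOpen

end LiftedOpen

/-! ### Flow-box coordinates -/

/-- A map that is smooth near a point agrees there with a map that is smooth everywhere. -/
theorem exists_contDiff_eventuallyEq {E F : Type*} [NormedAddCommGroup E] [NormedSpace ℝ E]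
    [FiniteDimensional ℝ E] [NormedAddCommGroup F] [NormedSpace ℝ F] {v : E → F} {O : Set E}
    (hO : IsOpen O) (hv : ContDiffOn ℝ ∞ v O) {e₀ : E} (he : e₀ ∈ O) :
    ∃ (v' : E → F) (B : Set E), ContDiff ℝ ∞ v' ∧ IsOpen B ∧ e₀ ∈ B ∧ B ⊆ O ∧ EqOn v' v B := by
  obtain ⟨R, hR, hball⟩ := Metric.nhds_basis_closedBall.mem_iff.1 (hO.mem_nhds he)
  let f : ContDiffBump e₀ := ⟨R / 2, R, by positivity, by linarith⟩
  refine ⟨fun x => f x • v x, Metric.ball e₀ (R / 2), ?_, Metric.isOpen_ball,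
    Metric.mem_ball_self (by positivity), ?_, fun x hx => ?_⟩
  · rw [contDiff_iff_contDiffAt]
    intro x
    by_cases hx : x ∈ O
    · exact f.contDiff.contDiffAt.smul (hv.contDiffAt (hO.mem_nhds hx))
    · have hx' : x ∉ tsupport f := by
        rw [f.tsupport_eq]
        exact fun h => hx (hball h)
      have h0 := notMem_tsupport_iff_eventuallyEq.1 hx'
      refine (contDiffAt_const (c := (0 : F))).congr_of_eventuallyEq ?_
      filter_upwards [h0] with y hy
      simp [hy]
  · exact (Metric.ball_subset_ball (by linarith)).trans (Metric.ball_subset_closedBall.trans hball)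
  · have : f x = 1 := f.one_of_mem_closedBall (Metric.ball_subset_closedBall hx)
    simp [this]

/-- A partial diffeomorphism restricted to a smaller open set. -/
def restrictParam {E : Type*} [NormedAddCommGroup E] [NormedSpace ℝ E]
    {H : Type*} [TopologicalSpace H] {I : ModelWithCorners ℝ E H}
    {M : Type*} [TopologicalSpace M] [ChartedSpace H M]
    {F : Type*} [NormedAddCommGroup F] [NormedSpace ℝ F]
    (φ : PartialDiffeomorph 𝓘(ℝ, F) I F M ∞) {s : Set F} (hs : IsOpen s) (hsφ : s ⊆ φ.source) :
    PartialDiffeomorph 𝓘(ℝ, F) I F M ∞ where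
  toFun := φ
  invFun := φ.symm
  source := s
  target := φ.target ∩ φ.symm ⁻¹' s
  map_source' := fun x hx => ⟨φ.map_source (hsφ hx), by
    have h : φ.symm (φ x) = x := φ.left_inv (hsφ hx)
    rwa [mem_preimage, h]⟩
  map_target' := fun _ hm => hm.2
  left_inv' := fun _ hx => φ.left_inv (hsφ hx)
  right_inv' := fun _ hm => φ.right_inv hm.1
  open_source := hs
  open_target := φ.symm.contMDiffOn.continuousOn.isOpen_inter_preimage φ.open_target hs
  contMDiffOn_toFun := φ.contMDiffOn_toFun.mono hsφ
  contMDiffOn_invFun := φ.contMDiffOn_invFun.mono inter_subset_left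

section Transversal

variable {E : Type*} [NormedAddCommGroup E] [NormedSpace ℝ E] [FiniteDimensional ℝ E]
  {H : Type*} [TopologicalSpace H] {I : ModelWithCorners ℝ E H} [I.Boundaryless]
  {M : Type*} [TopologicalSpace M] [ChartedSpace H M] [IsManifold I ∞ M]
  {V : Type*} [NormedAddCommGroup V] [NormedSpace ℝ V] [FiniteDimensional ℝ V]
  {N : Type*} [TopologicalSpace N] [ChartedSpace V N] [IsManifold 𝓘(ℝ, V) ∞ N]

/-- Flow-box coordinates: the flow of a vector field `ν` that is transversal to an immersed
submanifold gives coordinates `(t, x)` with `∂_t = ν`, in which the submanifold is `t = 0`. -/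
theorem exists_flowBox {ν : Π x : M, TangentSpace I x}
    (hν : ContMDiff I I.tangent ∞ (T% ν)) {i : N → M} (hi : ContMDiff 𝓘(ℝ, V) I ∞ i) (y₀ : N)
    (htrans : Bijective fun a : ℝ × V => (a.1 • ν (i y₀) + mfderiv 𝓘(ℝ, V) I i y₀ a.2 :
      TangentSpace I (i y₀))) :
    ∃ (φ : PartialDiffeomorph 𝓘(ℝ, ℝ × V) I (ℝ × V) M ∞) (ε r : ℝ) (x₀ : V),
      0 < ε ∧ 0 < r ∧ φ.source = Ioo (-ε) ε ×ˢ Metric.ball x₀ r ∧ φ (0, x₀) = i y₀ ∧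
      Metric.ball x₀ r ⊆ (chartParam 𝓘(ℝ, V) y₀).source ∧
      (∀ x ∈ Metric.ball x₀ r, φ (0, x) = i (chartParam 𝓘(ℝ, V) y₀ x)) ∧
      ∀ u ∈ φ.source, ν (φ u) = mfderiv 𝓘(ℝ, ℝ × V) I φ u ((1, 0) : ℝ × V) := by
  have : CompleteSpace E := FiniteDimensional.complete ℝ E
  have : CompleteSpace V := FiniteDimensional.complete ℝ V
  let κ := chartParam I (i y₀)
  let κN := chartParam 𝓘(ℝ, V) y₀
  have hp : i y₀ ∈ κ.target := mem_extChartAt_source (I := I) (i y₀)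
  have hy₀ : y₀ ∈ κN.target := mem_extChartAt_source (I := 𝓘(ℝ, V)) y₀
  let x₀ := κN.symm y₀
  have hx₀ : x₀ ∈ κN.source := κN.map_target hy₀
  have hκx₀ : κN x₀ = y₀ := κN.right_inv hy₀
  let j : V → E := fun x => κ.symm (i (κN x))
  let e₀ : E := κ.symm (i y₀)
  have he₀ : e₀ ∈ κ.source := κ.map_target hp
  have hκe₀ : κ e₀ = i y₀ := κ.right_inv hp
  have hj₀ : j x₀ = e₀ := by simp only [j, hκx₀, e₀]
  -- The coordinate expression of `ν`, modified away from `i y₀`, and its flow.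
  have hv : ContDiffOn ℝ ∞ (coordField κ ν) κ.source := fun e he =>
    (contDiffAt_coordField κ he (hν _)).contDiffWithinAt
  obtain ⟨v, B, hvs, hB, heB, hBO, hBv⟩ := exists_contDiff_eventuallyEq κ.open_source hv he₀
  obtain ⟨W, θ, hW, h0W, hθ, hθ0, hθd⟩ := exists_smooth_flow hvs e₀
  -- The domain on which the flow-box map is defined.
  have hcN : ContMDiffOn 𝓘(ℝ, V) I ∞ (i ∘ κN) κN.source := hi.comp_contMDiffOn κN.contMDiffOn
  let S0 : Set V := κN.source ∩ (i ∘ κN) ⁻¹' κ.target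
  have hS0 : IsOpen S0 := hcN.continuousOn.isOpen_inter_preimage κN.open_source κ.open_target
  have hxS0 : x₀ ∈ S0 := ⟨hx₀, by rw [mem_preimage, comp_apply, hκx₀]; exact hp⟩
  have hj : ContDiffOn ℝ ∞ j S0 := by
    rw [← contMDiffOn_iff_contDiffOn]
    exact κ.symm.contMDiffOn.comp (hcN.mono inter_subset_left) inter_subset_right
  let J : ℝ × V → ℝ × E := fun u => (u.1, j u.2)
  let S1 : Set (ℝ × V) := Prod.snd ⁻¹' S0
  have hS1 : IsOpen S1 := hS0.preimage continuous_snd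
  have hJ : ContDiffOn ℝ ∞ J S1 := contDiff_fst.contDiffOn.prodMk
    (hj.comp contDiff_snd.contDiffOn fun u hu => hu)
  let S2 : Set (ℝ × V) := S1 ∩ J ⁻¹' W
  have hS2 : IsOpen S2 := hJ.continuousOn.isOpen_inter_preimage hS1 hW
  have hθJ : ContDiffOn ℝ ∞ (θ ∘ J) S2 := hθ.comp (hJ.mono inter_subset_left) inter_subset_right
  let S3 : Set (ℝ × V) := S2 ∩ (θ ∘ J) ⁻¹' B
  have hS3 : IsOpen S3 := hθJ.continuousOn.isOpen_inter_preimage hS2 hB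
  have hJ₀ : J (0, x₀) = (0, e₀) := by simp only [J, hj₀]
  have hθ₀ : θ (0, e₀) = e₀ := hθ0 _ h0W
  have h0S3 : ((0, x₀) : ℝ × V) ∈ S3 := by
    refine ⟨⟨hxS0, ?_⟩, ?_⟩
    · rw [mem_preimage, hJ₀]; exact h0W
    · rw [mem_preimage, comp_apply, hJ₀, hθ₀]; exact heB
  let Ψ : ℝ × V → E := fun u => θ (J u)
  have hΨ : ContDiffOn ℝ ∞ Ψ S3 := hθJ.mono inter_subset_left
  have hΨd {u : ℝ × V} (hu : u ∈ S3) : DifferentiableAt ℝ Ψ u :=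
    (hΨ.contDiffAt (hS3.mem_nhds hu)).differentiableAt (by simp)
  have hΨt {u : ℝ × V} (hu : u ∈ S3) : fderiv ℝ Ψ u (1, 0) = v (θ (J u)) := by
    have h1 : HasDerivAt (fun s : ℝ => (s, u.2)) ((1 : ℝ), (0 : V)) u.1 :=
      (hasDerivAt_id _).prodMk (hasDerivAt_const _ _)
    have h2 : HasDerivAt (fun s => Ψ (s, u.2)) _ u.1 :=
      HasFDerivAt.comp_hasDerivAt (l := Ψ) u.1 (hΨd hu).hasFDerivAt h1
    exact h2.unique (hθd _ hu.1.2)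
  have hΨ0 {x : V} (hx : ((0, x) : ℝ × V) ∈ S3) : Ψ (0, x) = j x := hθ0 _ hx.1.2
  have hΨx (w : V) : fderiv ℝ Ψ (0, x₀) (0, w) = fderiv ℝ j x₀ w := by
    have h1 : HasFDerivAt (fun x : V => ((0 : ℝ), x)) (ContinuousLinearMap.inr ℝ ℝ V) x₀ :=
      (hasFDerivAt_const _ _).prodMk (hasFDerivAt_id _)
    have h2 : HasFDerivAt (fun x : V => Ψ (0, x)) _ x₀ :=
      HasFDerivAt.comp x₀ (g := Ψ) (hΨd h0S3).hasFDerivAt h1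
    have h3 : j =ᶠ[𝓝 x₀] fun x : V => Ψ (0, x) := by
      have hc : ContinuousAt (fun x : V => ((0 : ℝ), x)) x₀ := by fun_prop
      filter_upwards [hc.eventually (hS3.mem_nhds h0S3)] with x hx
      exact (hΨ0 hx).symm
    rw [(h2.congr_of_eventuallyEq h3).fderiv]
    rfl
  -- The differential at the base point is an isomorphism by transversality.
  obtain ⟨A, hA⟩ := isInvertible_mfderiv κ he₀
  obtain ⟨AN, hAN⟩ := isInvertible_mfderiv κN hx₀
  have hA1 : (A (v e₀) : E) = ν (i y₀) := by
    have h1 : mfderiv 𝓘(ℝ, E) I κ e₀ (v e₀) = ν (κ e₀) := by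
      rw [hBv heB]
      exact mfderiv_coordField κ ν he₀
    have h2 : (A (v e₀) : E) = mfderiv 𝓘(ℝ, E) I κ e₀ (v e₀) := DFunLike.congr_fun hA (v e₀)
    exact h2.trans (h1.trans (congrArg (fun m => (ν m : E)) hκe₀))
  have hA2 (w : V) : (A (fderiv ℝ j x₀ w) : E) = mfderiv 𝓘(ℝ, V) I i y₀ (AN w : V) := by
    have hjd : DifferentiableAt ℝ j x₀ :=
      (hj.contDiffAt (hS0.mem_nhds hxS0)).differentiableAt (by simp)
    have h1 : HasMFDerivAt 𝓘(ℝ, V) I (κ ∘ j) x₀ _ :=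
      HasMFDerivAt.comp x₀ (κ.mdifferentiableAt (by simp) (by rw [hj₀]; exact he₀)).hasMFDerivAt
        hjd.hasFDerivAt.hasMFDerivAt
    have h2 : HasMFDerivAt 𝓘(ℝ, V) I (i ∘ κN) x₀ _ :=
      HasMFDerivAt.comp x₀ (hi.mdifferentiable (by simp) (κN x₀)).hasMFDerivAt
        (κN.mdifferentiableAt (by simp) hx₀).hasMFDerivAt
    have h3 : (i ∘ κN) =ᶠ[𝓝 x₀] κ ∘ j := by
      filter_upwards [hS0.mem_nhds hxS0] with x hx
      exact (κ.right_inv hx.2).symm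
    have h4 := DFunLike.congr_fun (hasMFDerivAt_unique (h1.congr_of_eventuallyEq h3) h2) w
    have h5 : (A (fderiv ℝ j x₀ w) : E) = mfderiv 𝓘(ℝ, E) I κ (j x₀) (fderiv ℝ j x₀ w) := by
      refine (DFunLike.congr_fun hA _).trans ?_
      exact congrArg (fun e => (mfderiv 𝓘(ℝ, E) I κ e (fderiv ℝ j x₀ w) : E)) hj₀.symm
    have h6 : (mfderiv 𝓘(ℝ, V) I i (κN x₀) (mfderiv 𝓘(ℝ, V) 𝓘(ℝ, V) κN x₀ w : V) : E) =
        mfderiv 𝓘(ℝ, V) I i y₀ (AN w : V) := by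
      refine (congrArg (fun y => (mfderiv 𝓘(ℝ, V) I i y
        (mfderiv 𝓘(ℝ, V) 𝓘(ℝ, V) κN x₀ w : V) : E)) hκx₀).trans ?_
      exact congrArg (mfderiv 𝓘(ℝ, V) I i y₀) (DFunLike.congr_fun hAN w).symm
    exact h5.trans (h4.trans h6)
  have hdΨ (a : ℝ × V) : fderiv ℝ Ψ (0, x₀) a = a.1 • v e₀ + fderiv ℝ j x₀ a.2 := by
    have h1 : a = a.1 • ((1, 0) : ℝ × V) + (0, a.2) := by ext <;> simp
    have h2 := hΨt h0S3
    rw [hJ₀, hθ₀] at h2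
    conv_lhs => rw [h1, map_add, map_smul, hΨx, h2]
  have hbij : Bijective (fderiv ℝ Ψ (0, x₀)) := by
    have h1 : Bijective fun a : ℝ × V => (A (fderiv ℝ Ψ (0, x₀) a) : E) := by
      have h2 : (fun a : ℝ × V => (A (fderiv ℝ Ψ (0, x₀) a) : E)) =
          (fun a : ℝ × V => (a.1 • ν (i y₀) + mfderiv 𝓘(ℝ, V) I i y₀ a.2 : E)) ∘
            Prod.map id AN := by
        funext a
        rw [hdΨ]
        refine (map_add A _ _).trans ?_
        exact congrArg₂ (fun a b : E => a + b) ((map_smul A _ _).trans (congrArg _ hA1)) (hA2 a.2)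
      rw [h2]
      exact htrans.comp (bijective_id.prodMap AN.bijective)
    exact (Bijective.of_comp_iff' A.bijective _).1 h1
  have hinv : (fderiv ℝ Ψ (0, x₀)).IsInvertible :=
    ⟨(LinearEquiv.ofBijective (fderiv ℝ Ψ (0, x₀)).toLinearMap hbij).toContinuousLinearEquiv, rfl⟩
  obtain ⟨e, h0e, heS, heΨ, hes⟩ :=
    exists_openPartialHomeomorph_of_isInvertible hS3 hΨ h0S3 hinv
  let φ₀ : PartialDiffeomorph 𝓘(ℝ, ℝ × V) 𝓘(ℝ, E) (ℝ × V) E ∞ :=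
    { e with
      contMDiffOn_toFun := by
        have h : ContDiffOn ℝ ∞ e e.source := by rw [heΨ]; exact hΨ.mono heS
        exact h.contMDiffOn
      contMDiffOn_invFun := hes.contMDiffOn }
  let φ₁ := φ₀.trans κ
  have hφ₁ (u : ℝ × V) : φ₁ u = κ (Ψ u) := congrArg κ (congrFun heΨ u)
  have hs₁ : φ₁.source = e.source := by
    refine inter_eq_left.2 fun u hu => ?_
    have h : e u ∈ κ.source := by rw [heΨ]; exact hBO (heS hu).2
    exact h
  -- A product neighbourhood of the base point.
  have hn : φ₁.source ∈ 𝓝 ((0 : ℝ), x₀) := φ₁.open_source.mem_nhds (by rw [hs₁]; exact h0e)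
  rw [nhds_prod_eq] at hn
  obtain ⟨⟨ε, r⟩, ⟨hε, hr⟩, hbox⟩ :=
    (Metric.nhds_basis_ball.prod Metric.nhds_basis_ball).mem_iff.1 hn
  rw [Real.ball_eq_Ioo, zero_sub, zero_add] at hbox
  have hmem {u : ℝ × V} (hu : u ∈ Ioo (-ε) ε ×ˢ Metric.ball x₀ r) : u ∈ S3 :=
    heS (by rw [← hs₁]; exact hbox hu)
  have h0 : (0 : ℝ) ∈ Ioo (-ε) ε := ⟨neg_lt_zero.2 hε, hε⟩
  refine ⟨restrictParam φ₁ (isOpen_Ioo.prod Metric.isOpen_ball) hbox, ε, r, x₀, hε, hr, rfl, ?_,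
    fun x hx => ?_, fun x hx => ?_, fun u hu => ?_⟩
  · refine (hφ₁ _).trans ?_
    simp only [Ψ, hJ₀, hθ₀, hκe₀]
  · have h : ((0, x) : ℝ × V) ∈ S3 := hmem ⟨h0, hx⟩
    exact h.1.1.1
  · refine (hφ₁ _).trans ?_
    have hx3 : ((0, x) : ℝ × V) ∈ S3 := hmem ⟨h0, hx⟩
    have h : Ψ (0, x) = j x := hΨ0 hx3
    rw [h]
    exact κ.right_inv hx3.1.1.2
  · have hu3 := hmem hu
    have hκu : Ψ u ∈ κ.source := hBO hu3.2
    have h1 : HasMFDerivAt 𝓘(ℝ, ℝ × V) I (κ ∘ Ψ) u _ :=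
      HasMFDerivAt.comp u (κ.mdifferentiableAt (by simp) hκu).hasMFDerivAt
        (hΨd hu3).hasFDerivAt.hasMFDerivAt
    have h2 : (restrictParam φ₁ (isOpen_Ioo.prod Metric.isOpen_ball) hbox : ℝ × V → M) = κ ∘ Ψ :=
      funext hφ₁
    rw [h2, h1.mfderiv]
    have h3 : fderiv ℝ Ψ u (1, 0) = coordField κ ν (Ψ u) := (hΨt hu3).trans (hBv hu3.2)
    exact (mfderiv_coordField κ ν hκu).symm.trans
      (congrArg (mfderiv 𝓘(ℝ, E) I κ (Ψ u)) h3.symm)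

end Transversal

/-! ### Flow boxes of unit fields with integrable orthogonal distribution -/

section FlowBox

variable {E : Type*} [NormedAddCommGroup E] [NormedSpace ℝ E]
  {H : Type*} [TopologicalSpace H] {I : ModelWithCorners ℝ E H}
  {M : Type*} [TopologicalSpace M] [ChartedSpace H M]
  [RiemannianBundle (fun x : M => TangentSpace I x)]
  {V : Type*} [NormedAddCommGroup V] [NormedSpace ℝ V]

/-- `φ` is a parametrization by `(t, x) ∈ (-ε, ε) × ball x₀ r` in which `ν = ∂_t`, and `ν` is
orthogonal to the hypersurface `t = 0`. -/
structure IsFlowBox (ν : Π x : M, TangentSpace I x)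
    (φ : PartialDiffeomorph 𝓘(ℝ, ℝ × V) I (ℝ × V) M ∞) (ε r : ℝ) (x₀ : V) : Prop where
  eps_pos : 0 < ε
  radius_pos : 0 < r
  source_eq : φ.source = Ioo (-ε) ε ×ˢ Metric.ball x₀ r
  map_fst : ∀ u ∈ φ.source, ν (φ u) = mfderiv 𝓘(ℝ, ℝ × V) I φ u ((1, 0) : ℝ × V)
  orthogonal_zero : ∀ x ∈ Metric.ball x₀ r, ∀ b : V, coordMetric φ (0, x) (1, 0) (0, b) = 0

variable [FiniteDimensional ℝ E] [I.Boundaryless] [IsManifold I ∞ M]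

omit [FiniteDimensional ℝ E] [I.Boundaryless] [IsManifold I ∞ M] in
/-- A unit vector field is transversal to the integral manifolds of its orthogonal distribution. -/
theorem bijective_of_tangent {ν : Π x : M, TangentSpace I x} {n : ℕ}
    (hν : ∀ x, (inner ℝ (ν x) (ν x) : ℝ) = 1)
    {N : Type*} [TopologicalSpace N] [ChartedSpace (EuclideanSpace ℝ (Fin n)) N] {i : N → M}
    (hi : IsIntegralManifold I (orthogonalDistribution I ν) (k := n) i) (y₀ : N) :
    Bijective fun a : ℝ × EuclideanSpace ℝ (Fin n) =>
      (a.1 • ν (i y₀) + mfderiv (𝓡 n) I i y₀ a.2 : TangentSpace I (i y₀)) := by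
  have hperp (w : EuclideanSpace ℝ (Fin n)) :
      (inner ℝ (ν (i y₀)) (mfderiv (𝓡 n) I i y₀ w : TangentSpace I (i y₀)) : ℝ) = 0 := by
    have h : mfderiv (𝓡 n) I i y₀ w ∈ orthogonalDistribution I ν (i y₀) := by
      rw [← SetLike.mem_coe, ← hi.tangent y₀]
      exact mem_range_self w
    exact Submodule.mem_orthogonal_singleton_iff_inner_right.1 h
  have hfst (a : ℝ × EuclideanSpace ℝ (Fin n)) : (inner ℝ (ν (i y₀))
      (a.1 • ν (i y₀) + mfderiv (𝓡 n) I i y₀ a.2 : TangentSpace I (i y₀)) : ℝ) = a.1 := by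
    rw [inner_add_right, inner_smul_right, hν, hperp, mul_one, add_zero]
  refine ⟨fun a b hab => ?_, fun v => ?_⟩
  · have h1 : a.1 = b.1 := by
      rw [← hfst a, ← hfst b]
      exact congrArg (fun v : TangentSpace I (i y₀) => (inner ℝ (ν (i y₀)) v : ℝ)) hab
    simp only [h1] at hab
    exact Prod.ext h1 (hi.immersion y₀ (add_left_cancel hab))
  · have h : v - (inner ℝ (ν (i y₀)) v : ℝ) • ν (i y₀) ∈ orthogonalDistribution I ν (i y₀) := by
      rw [orthogonalDistribution, Submodule.mem_orthogonal_singleton_iff_inner_right,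
        inner_sub_right, inner_smul_right, hν, mul_one, sub_self]
    rw [← SetLike.mem_coe, ← hi.tangent y₀] at h
    obtain ⟨w, hw⟩ := h
    exact ⟨(inner ℝ (ν (i y₀)) v, w), by simp only [hw]; abel⟩

/-- Flow boxes of a unit vector field with integrable orthogonal distribution. -/
theorem exists_isFlowBox {ν : Π x : M, TangentSpace I x} {n : ℕ}
    (hs : ContMDiff I I.tangent ∞ (T% ν)) (hν : ∀ x, (inner ℝ (ν x) (ν x) : ℝ) = 1)
    {N : Type*} [TopologicalSpace N] [ChartedSpace (EuclideanSpace ℝ (Fin n)) N]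
    [IsManifold (𝓡 n) ∞ N] {i : N → M}
    (hi : IsIntegralManifold I (orthogonalDistribution I ν) (k := n) i) (y₀ : N) :
    ∃ (φ : PartialDiffeomorph 𝓘(ℝ, ℝ × EuclideanSpace ℝ (Fin n)) I
      (ℝ × EuclideanSpace ℝ (Fin n)) M ∞) (ε r : ℝ) (x₀ : EuclideanSpace ℝ (Fin n)),
      IsFlowBox ν φ ε r x₀ ∧ φ (0, x₀) = i y₀ := by
  obtain ⟨φ, ε, r, x₀, hε, hr, hsrc, h0, hball, hslice, hmap⟩ :=
    exists_flowBox hs hi.smooth y₀ (bijective_of_tangent hν hi y₀)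
  refine ⟨φ, ε, r, x₀, ⟨hε, hr, hsrc, hmap, fun x hx b => ?_⟩, h0⟩
  have hu : ((0, x) : ℝ × EuclideanSpace ℝ (Fin n)) ∈ φ.source := by
    rw [hsrc]
    exact ⟨⟨neg_lt_zero.2 hε, hε⟩, hx⟩
  -- `dφ (0, b)` is tangent to the leaf.
  have h1 : HasMFDerivAt (𝓡 n) I (fun z => φ (0, z)) x _ :=
    HasMFDerivAt.comp x (g := φ) (φ.mdifferentiableAt (by simp) hu).hasMFDerivAt
      ((hasFDerivAt_const _ _).prodMk (hasFDerivAt_id _)).hasMFDerivAt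
  have h2 : HasMFDerivAt (𝓡 n) I (i ∘ chartParam (𝓡 n) y₀) x _ :=
    HasMFDerivAt.comp x (hi.smooth.mdifferentiable (by simp) _).hasMFDerivAt
      ((chartParam (𝓡 n) y₀).mdifferentiableAt (by simp) (hball hx)).hasMFDerivAt
  have h3 : (fun z => φ (0, z)) =ᶠ[𝓝 x] i ∘ chartParam (𝓡 n) y₀ := by
    filter_upwards [Metric.isOpen_ball.mem_nhds hx] with z hz using hslice z hz
  have h4 := DFunLike.congr_fun (hasMFDerivAt_unique h1 (h2.congr_of_eventuallyEq h3)) b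
  have key : ∀ m : M, i (chartParam (𝓡 n) y₀ x) = m → ∀ (v : TangentSpace I m)
      (w : EuclideanSpace ℝ (Fin n)),
      (v : E) = mfderiv (𝓡 n) I i (chartParam (𝓡 n) y₀ x) w → (inner ℝ (ν m) v : ℝ) = 0 := by
    rintro _ rfl v w hv
    have h : v ∈ orthogonalDistribution I ν (i (chartParam (𝓡 n) y₀ x)) := by
      rw [← SetLike.mem_coe, ← hi.tangent]
      exact ⟨w, hv.symm⟩
    exact Submodule.mem_orthogonal_singleton_iff_inner_right.1 h
  rw [coordMetric_apply, ← hmap _ hu]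
  exact key _ (hslice x hx).symm _ _ h4

end FlowBox

section Calculus

theorem eq_of_hasDerivAt_zero {ε : ℝ} {f : ℝ → ℝ} (hf : ∀ t ∈ Ioo (-ε) ε, HasDerivAt f 0 t)
    {s t : ℝ} (hs : s ∈ Ioo (-ε) ε) (ht : t ∈ Ioo (-ε) ε) : f s = f t :=
  (convex_Ioo (-ε) ε).is_const_of_fderivWithin_eq_zero (𝕜 := ℝ) (f := f)
    (fun w hw => (hf w hw).differentiableAt.differentiableWithinAt)
    (fun w hw => by
      rw [fderivWithin_of_isOpen isOpen_Ioo hw]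
      ext
      simp [(hf w hw).deriv]) hs ht

/-- Two solutions of the same linear equation `f' = k f` are proportional. -/
theorem mul_eq_mul_of_hasDerivAt {ε : ℝ} {f g k : ℝ → ℝ} (h0 : (0 : ℝ) ∈ Ioo (-ε) ε)
    (hf : ∀ t ∈ Ioo (-ε) ε, HasDerivAt f (k t * f t) t)
    (hg : ∀ t ∈ Ioo (-ε) ε, HasDerivAt g (k t * g t) t) (hg0 : ∀ t ∈ Ioo (-ε) ε, g t ≠ 0)
    {t : ℝ} (ht : t ∈ Ioo (-ε) ε) : f t * g 0 = f 0 * g t := by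
  have h : f t / g t = f 0 / g 0 := by
    refine eq_of_hasDerivAt_zero (f := fun s => f s / g s) (fun s hs => ?_) ht h0
    have := (hf s hs).div (hg s hs) (hg0 s hs)
    refine this.congr_deriv ?_
    ring
  rwa [div_eq_div_iff (hg0 t ht) (hg0 0 h0)] at h

end Calculus

/-! ### The Gauss lemma, the Weingarten map and Killing fields in a flow box -/

namespace IsFlowBox

section

variable {E : Type*} [NormedAddCommGroup E] [NormedSpace ℝ E] [FiniteDimensional ℝ E]
  {H : Type*} [TopologicalSpace H] {I : ModelWithCorners ℝ E H}
  {M : Type*} [TopologicalSpace M] [ChartedSpace H M] [IsManifold I ∞ M]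
  [RiemannianBundle (fun x : M => TangentSpace I x)]
  [IsContMDiffRiemannianBundle I ∞ E (fun x : M => TangentSpace I x)]
  {V : Type*} [NormedAddCommGroup V] [NormedSpace ℝ V] [FiniteDimensional ℝ V]
  {ν η : Π x : M, TangentSpace I x} {φ : PartialDiffeomorph 𝓘(ℝ, ℝ × V) I (ℝ × V) M ∞}
  {ε r : ℝ} {x₀ : V} (hφ : IsFlowBox ν φ ε r x₀)

include hφ

omit [FiniteDimensional ℝ E] [IsManifold I ∞ M]
  [IsContMDiffRiemannianBundle I ∞ E (fun x : M => TangentSpace I x)] [FiniteDimensional ℝ V]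

theorem zero_mem : (0 : ℝ) ∈ Ioo (-ε) ε := ⟨neg_lt_zero.2 hφ.eps_pos, hφ.eps_pos⟩

theorem mem_source {t : ℝ} {x : V} (ht : t ∈ Ioo (-ε) ε) (hx : x ∈ Metric.ball x₀ r) :
    (t, x) ∈ φ.source := by
  rw [hφ.source_eq]
  exact ⟨ht, hx⟩

theorem mem_of_mem_source {u : ℝ × V} (hu : u ∈ φ.source) :
    u.1 ∈ Ioo (-ε) ε ∧ u.2 ∈ Metric.ball x₀ r := by
  rw [hφ.source_eq] at hu
  exact hu

theorem eventually_map_fst {u : ℝ × V} (hu : u ∈ φ.source) :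
    ∀ᶠ w in 𝓝 u, ν (φ w) = mfderiv 𝓘(ℝ, ℝ × V) I φ w ((1, 0) : ℝ × V) := by
  filter_upwards [φ.open_source.mem_nhds hu] with w hw using hφ.map_fst w hw

theorem coordMetric_unit (hν : ∀ x, (inner ℝ (ν x) (ν x) : ℝ) = 1) {u : ℝ × V}
    (hu : u ∈ φ.source) : coordMetric φ u (1, 0) (1, 0) = 1 := by
  rw [coordMetric_apply, ← hφ.map_fst u hu, hν]

variable [FiniteDimensional ℝ E] [IsManifold I ∞ M]
  [IsContMDiffRiemannianBundle I ∞ E (fun x : M => TangentSpace I x)] [FiniteDimensional ℝ V]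

/-- The Gauss lemma: as the integral curves of `ν` are geodesics, `ν` remains orthogonal to the
hypersurfaces `t = const`. -/
theorem coordMetric_fst (hν : IsUnitGeodesicField I ν) {u : ℝ × V} (hu : u ∈ φ.source)
    (b : ℝ × V) : coordMetric φ u (1, 0) b = b.1 := by
  have hd {w : ℝ × V} (hw : w ∈ φ.source) : fderiv ℝ (coordMetric φ) w (1, 0) (1, 0) b = 0 := by
    have h1 := inner_leviCivita_coord φ hw (differentiableAt_const ((1, 0) : ℝ × V))
      (hφ.eventually_map_fst hw) (1, 0) b
    rw [← hφ.map_fst w hw, hν.geodesic, inner_zero_left] at h1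
    have h2 : fderiv ℝ (coordMetric φ) w b (1, 0) (1, 0) = 0 := by
      rw [← fderiv_bilin_const_apply (differentiableAt_coordMetric φ hw)]
      have h : (fun w => coordMetric φ w (1, 0) (1, 0)) =ᶠ[𝓝 w] fun _ => 1 := by
        filter_upwards [φ.open_source.mem_nhds hw] with z hz using hφ.coordMetric_unit hν.unit hz
      rw [h.fderiv_eq]
      simp
    rw [h2] at h1
    simp only [fderiv_fun_const, Pi.zero_apply, zero_apply, map_zero, sub_zero, add_zero] at h1
    linarith
  obtain ⟨ht, hx⟩ := hφ.mem_of_mem_source hu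
  have h3 : coordMetric φ (u.1, u.2) (1, 0) b = coordMetric φ (0, u.2) (1, 0) b := by
    refine eq_of_hasDerivAt_zero (f := fun s => coordMetric φ (s, u.2) (1, 0) b) (fun s hs => ?_)
      ht hφ.zero_mem
    have h := fderiv_bilin_fst (differentiableAt_coordMetric φ (hφ.mem_source hs hx)) (1, 0) b
    rwa [hd (hφ.mem_source hs hx)] at h
  have h4 : b = b.1 • ((1, 0) : ℝ × V) + (0, b.2) := by ext <;> simp
  refine h3.trans ?_
  conv_lhs => rw [h4]
  rw [map_add, map_smul, hφ.orthogonal_zero _ hx,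
    hφ.coordMetric_unit hν.unit (hφ.mem_source hφ.zero_mem hx)]
  simp

theorem eventually_coordMetric_fst (hν : IsUnitGeodesicField I ν) {u : ℝ × V}
    (hu : u ∈ φ.source) : ∀ᶠ w in 𝓝 u, ∀ b, coordMetric φ w (1, 0) b = b.1 := by
  filter_upwards [φ.open_source.mem_nhds hu] with w hw b using hφ.coordMetric_fst hν hw b

/-- The Weingarten map is the logarithmic derivative of the metric. -/
theorem fderiv_coordMetric_fst (hν : IsUnitGeodesicField I ν) {u : ℝ × V} (hu : u ∈ φ.source)
    (a b : ℝ × V) : fderiv ℝ (coordMetric φ) u (1, 0) a b =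
      -2 * (inner ℝ (weingarten I ν (φ u) (mfderiv 𝓘(ℝ, ℝ × V) I φ u a))
        (mfderiv 𝓘(ℝ, ℝ × V) I φ u b : TangentSpace I (φ u)) : ℝ) := by
  have h := inner_leviCivita_adapted φ hu (hφ.eventually_map_fst hu)
    (hφ.eventually_coordMetric_fst hν hu) a b
  have h2 : (inner ℝ (weingarten I ν (φ u) (mfderiv 𝓘(ℝ, ℝ × V) I φ u a))
      (mfderiv 𝓘(ℝ, ℝ × V) I φ u b : TangentSpace I (φ u)) : ℝ) =
      -((1 / 2) * fderiv ℝ (coordMetric φ) u (1, 0) a b) :=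
    (inner_neg_left _ _).trans (congrArg _ h)
  linarith

section Killing

variable (hν : IsUnitGeodesicField I ν) (hη : IsKillingField I η)
  (horth : ∀ x, (inner ℝ (η x) (ν x) : ℝ) = 0)

include hν horth in
theorem coordField_fst {u : ℝ × V} (hu : u ∈ φ.source) : (coordField φ η u : ℝ × V).1 = 0 := by
  rw [← hφ.coordMetric_fst hν hu, coordMetric_apply, ← hφ.map_fst u hu, mfderiv_coordField φ η hu,
    real_inner_comm, horth]

omit hφ in
theorem differentiableAt_coordField (hη : IsKillingField I η) {u : ℝ × V} (hu : u ∈ φ.source) :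
    DifferentiableAt ℝ (coordField φ η) u :=
  (contDiffAt_coordField φ hu (hη.smooth _)).differentiableAt (by simp)

omit hφ in
theorem killing_coordField (hη : IsKillingField I η) {u : ℝ × V} (hu : u ∈ φ.source)
    (a b : ℝ × V) : fderiv ℝ (coordMetric φ) u (coordField φ η u) a b
      + coordMetric φ u (fderiv ℝ (coordField φ η) u a) b
      + coordMetric φ u (fderiv ℝ (coordField φ η) u b) a = 0 := by
  refine hη.coord φ hu (differentiableAt_coordField hη hu) ?_ a b
  filter_upwards [φ.open_source.mem_nhds hu] with w hw
  exact (mfderiv_coordField φ η hw).symm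

include hν hη horth in
/-- The coordinate expression of the Killing field does not depend on `t`. -/
theorem fderiv_coordField_fst {u : ℝ × V} (hu : u ∈ φ.source) :
    fderiv ℝ (coordField φ η) u (1, 0) = 0 := by
  set y : ℝ × V → ℝ × V := coordField φ η
  have hy := differentiableAt_coordField (φ := φ) hη hu
  -- In the Killing equation with `a = ∂_t`, only the term with the `t`-derivative of `y` survives.
  have hz (b : ℝ × V) : coordMetric φ u (fderiv ℝ y u (1, 0)) b = 0 := by
    have h1 := killing_coordField hη hu (1, 0) b
    have h2 : fderiv ℝ (coordMetric φ) u (y u) (1, 0) b = 0 := by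
      rw [← fderiv_bilin_const_apply (differentiableAt_coordMetric φ hu)]
      have h : (fun w => coordMetric φ w (1, 0) b) =ᶠ[𝓝 u] fun _ => b.1 :=
        (hφ.eventually_coordMetric_fst hν hu).mono fun w hw => hw b
      rw [h.fderiv_eq]
      simp
    have h3 : (fderiv ℝ y u b).1 = 0 := by
      have h4 : HasFDerivAt (fun w => (y w).1) _ u := hasFDerivAt_fst.comp u hy.hasFDerivAt
      have h5 : (fun w => (y w).1) =ᶠ[𝓝 u] fun _ => 0 := by
        filter_upwards [φ.open_source.mem_nhds hu] with w hw using hφ.coordField_fst hν horth hw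
      have h6 := h4.unique ((hasFDerivAt_const (0 : ℝ) u).congr_of_eventuallyEq h5)
      exact DFunLike.congr_fun h6 b
    rw [h2, coordMetric_symm φ u _ (1, 0), hφ.coordMetric_fst hν hu, h3] at h1
    linarith
  by_contra h0
  exact (coordMetric_self_pos φ hu h0).ne' (hz _)

include hν hη horth in
theorem coordField_eq {t : ℝ} {x : V} (ht : t ∈ Ioo (-ε) ε) (hx : x ∈ Metric.ball x₀ r) :
    coordField φ η (t, x) = ((0, (coordField φ η (0, x) : ℝ × V).2) : ℝ × V) := by
  have hmem {s : ℝ} (hs : s ∈ Ioo (-ε) ε) := hφ.mem_source hs hx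
  refine Prod.ext (hφ.coordField_fst hν horth (hmem ht)) ?_
  have hline (s : ℝ) : HasDerivAt (fun s : ℝ => (s, x)) ((1 : ℝ), (0 : V)) s :=
    (hasDerivAt_id _).prodMk (hasDerivAt_const _ _)
  have hd (s : ℝ) (hs : s ∈ Ioo (-ε) ε) :
      HasDerivAt (fun s => (coordField φ η (s, x) : ℝ × V)) 0 s := by
    have h := HasFDerivAt.comp_hasDerivAt (l := coordField φ η) s
      (differentiableAt_coordField hη (hmem hs)).hasFDerivAt (hline s)
    rwa [hφ.fderiv_coordField_fst hν hη horth (hmem hs)] at h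
  have h := (convex_Ioo (-ε) ε).is_const_of_fderivWithin_eq_zero (𝕜 := ℝ)
    (f := fun s => (coordField φ η (s, x) : ℝ × V))
    (fun s hs => (hd s hs).differentiableAt.differentiableWithinAt)
    (fun s hs => by
      rw [fderivWithin_of_isOpen isOpen_Ioo hs]
      ext <;> simp [(hd s hs).deriv]) ht hφ.zero_mem
  exact (congrArg (fun z : ℝ × V => z.2) h :)

end Killing

end

end IsFlowBox

/-! ### Slices of a flow box as integral leaves -/

/-- The open ball, as an element of the lattice of open sets. -/
def ballOpens {V : Type*} [PseudoMetricSpace V] (x₀ : V) (r : ℝ) : TopologicalSpace.Opens V :=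
  ⟨Metric.ball x₀ r, Metric.isOpen_ball⟩

namespace IsFlowBox

variable {E : Type*} [NormedAddCommGroup E] [NormedSpace ℝ E] [FiniteDimensional ℝ E]
  {H : Type*} [TopologicalSpace H] {I : ModelWithCorners ℝ E H}
  {M : Type u} [TopologicalSpace M] [ChartedSpace H M] [IsManifold I ∞ M]
  [RiemannianBundle (fun x : M => TangentSpace I x)]
  [IsContMDiffRiemannianBundle I ∞ E (fun x : M => TangentSpace I x)]
  {n : ℕ} {ν η : Π x : M, TangentSpace I x}
  {φ : PartialDiffeomorph 𝓘(ℝ, ℝ × EuclideanSpace ℝ (Fin n)) I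
    (ℝ × EuclideanSpace ℝ (Fin n)) M ∞}
  {ε r : ℝ} {x₀ : EuclideanSpace ℝ (Fin n)} (hφ : IsFlowBox ν φ ε r x₀)

include hφ

omit [FiniteDimensional ℝ E] [IsManifold I ∞ M]
  [IsContMDiffRiemannianBundle I ∞ E (fun x : M => TangentSpace I x)] in
theorem nonempty_ballOpens : Nonempty (ballOpens x₀ r) :=
  ⟨⟨x₀, Metric.mem_ball_self hφ.radius_pos⟩⟩

theorem mem_orthogonalDistribution_iff (hν : IsUnitGeodesicField I ν)
    {u : ℝ × EuclideanSpace ℝ (Fin n)} (hu : u ∈ φ.source) (a : ℝ × EuclideanSpace ℝ (Fin n)) :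
    mfderiv 𝓘(ℝ, ℝ × EuclideanSpace ℝ (Fin n)) I φ u a ∈ orthogonalDistribution I ν (φ u) ↔
      a.1 = 0 := by
  rw [orthogonalDistribution, Submodule.mem_orthogonal_singleton_iff_inner_right,
    hφ.map_fst u hu, ← hφ.coordMetric_fst hν hu a]
  rfl

/-- The slices `t = const` of a flow box are integral manifolds of `ν^⊥`. -/
theorem isIntegralManifold_slice (hν : IsUnitGeodesicField I ν) {t : ℝ} (ht : t ∈ Ioo (-ε) ε)
    [Nonempty (ballOpens x₀ r)] :
    IsIntegralManifold I (orthogonalDistribution I ν) (k := n)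
      (fun z : LiftedOpen.{u} (ballOpens x₀ r) => φ (t, LiftedOpen.emb _ z)) := by
  have hmem (z : LiftedOpen.{u} (ballOpens x₀ r)) : (t, LiftedOpen.emb _ z) ∈ φ.source :=
    hφ.mem_source ht z.down.2
  have hs : ContMDiff (𝓡 n) 𝓘(ℝ, ℝ × EuclideanSpace ℝ (Fin n)) ∞
      (fun z : LiftedOpen.{u} (ballOpens x₀ r) => (t, LiftedOpen.emb _ z)) :=
    contMDiff_const.prodMk_space (LiftedOpen.contMDiff_emb _)
  have hd (z : LiftedOpen.{u} (ballOpens x₀ r)) (w : EuclideanSpace ℝ (Fin n)) :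
      (mfderiv (𝓡 n) I (fun z : LiftedOpen.{u} (ballOpens x₀ r) => φ (t, LiftedOpen.emb _ z)) z w
        : E) =
      mfderiv 𝓘(ℝ, ℝ × EuclideanSpace ℝ (Fin n)) I φ (t, LiftedOpen.emb _ z)
        ((0, w) : ℝ × EuclideanSpace ℝ (Fin n)) := by
    have hc : HasFDerivAt (fun x : EuclideanSpace ℝ (Fin n) => (t, x))
        (ContinuousLinearMap.inr ℝ ℝ (EuclideanSpace ℝ (Fin n))) (LiftedOpen.emb _ z) :=
      (hasFDerivAt_const _ _).prodMk (hasFDerivAt_id _)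
    have h1 := HasMFDerivAt.comp z hc.hasMFDerivAt
      ((LiftedOpen.contMDiff_emb (ballOpens x₀ r)).mdifferentiable (by simp) z).hasMFDerivAt
    have h2 := HasMFDerivAt.comp z (g := φ) (φ.mdifferentiableAt (by simp) (hmem z)).hasMFDerivAt h1
    refine (DFunLike.congr_fun h2.mfderiv w).trans ?_
    refine congrArg (mfderiv 𝓘(ℝ, ℝ × EuclideanSpace ℝ (Fin n)) I φ (t, LiftedOpen.emb _ z)) ?_
    exact Prod.ext rfl (DFunLike.congr_fun (LiftedOpen.mfderiv_emb (ballOpens x₀ r) z) w)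
  have hbij (z : LiftedOpen.{u} (ballOpens x₀ r)) := isInvertible_mfderiv φ (hmem z)
  refine ⟨fun z => ?_, fun z z' h => ?_, fun z w w' h => ?_, fun z => ?_⟩
  · exact (φ.contMDiffOn.contMDiffAt (φ.open_source.mem_nhds (hmem z))).comp z (hs z)
  · have h1 := φ.injOn (hmem z) (hmem z') h
    exact (LiftedOpen.isOpenEmbedding_emb _).injective (congrArg (fun u => u.2) h1 :)
  · obtain ⟨A, hA⟩ := hbij z
    have h1 := (hd z w).symm.trans (h.trans (hd z w'))
    rw [← hA] at h1
    exact (congrArg (fun u : ℝ × EuclideanSpace ℝ (Fin n) => u.2) (A.injective h1) :)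
  · ext v
    constructor
    · rintro ⟨w, rfl⟩
      have h1 := (hφ.mem_orthogonalDistribution_iff hν (hmem z) (0, w)).2 rfl
      rw [SetLike.mem_coe]
      exact (hd z w) ▸ h1
    · intro hv
      obtain ⟨a, rfl⟩ := mfderiv_surjective φ (hmem z) v
      have h1 := (hφ.mem_orthogonalDistribution_iff hν (hmem z) a).1 hv
      refine ⟨a.2, (hd z a.2).trans ?_⟩
      rw [← h1]

theorem eq_of_isConstantAlongLeaves (hν : IsUnitGeodesicField I ν) {f : M → ℝ}
    (hf : IsConstantAlongLeaves I (orthogonalDistribution I ν) n f) {t : ℝ} (ht : t ∈ Ioo (-ε) ε)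
    {x x' : EuclideanSpace ℝ (Fin n)} (hx : x ∈ Metric.ball x₀ r) (hx' : x' ∈ Metric.ball x₀ r) :
    f (φ (t, x)) = f (φ (t, x')) := by
  have := hφ.nonempty_ballOpens
  have : ConnectedSpace (LiftedOpen.{u} (ballOpens x₀ r)) :=
    LiftedOpen.connectedSpace _ (convex_ball x₀ r).isPreconnected
  exact hf (LiftedOpen.{u} (ballOpens x₀ r)) _ (hφ.isIntegralManifold_slice hν ht)
    (LiftedOpen.mk _ x hx) (LiftedOpen.mk _ x' hx')

end IsFlowBox

/-! ### Forms with prescribed logarithmic derivative, and the zeros of the Killing field -/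

/-- A family `h t x` of positive definite forms whose logarithmic `t`-derivative has the eigenvector
`y x`, with the eigenvalue `lam t`, and the eigenvalue `mu t` on the orthogonal complement of `y x`,
is a warped family: the two components of `h 0 x` are scaled by functions of `t` alone. -/
theorem exists_warping {V : Type*} [NormedAddCommGroup V] [NormedSpace ℝ V]
    {h : ℝ → V → V →L[ℝ] V →L[ℝ] ℝ} {B : Set V} (hB : B.Nonempty) {y : V → V} {lam mu : ℝ → ℝ}
    {ε : ℝ} (h0 : (0 : ℝ) ∈ Ioo (-ε) ε)
    (hsymm : ∀ t ∈ Ioo (-ε) ε, ∀ x ∈ B, ∀ a b, h t x a b = h t x b a)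
    (hpos : ∀ t ∈ Ioo (-ε) ε, ∀ x ∈ B, ∀ a, a ≠ 0 → 0 < h t x a a)
    (hy : ∀ x ∈ B, y x ≠ 0)
    (hu : ∀ t ∈ Ioo (-ε) ε, ∀ x ∈ B, ∀ x' ∈ B, h t x (y x) (y x) = h t x' (y x') (y x'))
    (hsm : ∀ x ∈ B, ∀ a, ContDiffOn ℝ ∞ (fun t => h t x a a) (Ioo (-ε) ε))
    (hlam : ∀ t ∈ Ioo (-ε) ε, ∀ x ∈ B, ∀ b,
      HasDerivAt (fun s => h s x (y x) b) (lam t * h t x (y x) b) t)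
    (hmu : ∀ t ∈ Ioo (-ε) ε, ∀ x ∈ B, ∀ a, h t x (y x) a = 0 → ∀ b,
      HasDerivAt (fun s => h s x a b) (mu t * h t x a b) t) :
    ∃ (c : ℝ) (ρ σ : ℝ → ℝ), ContDiffOn ℝ ∞ ρ (Ioo (-ε) ε) ∧ ContDiffOn ℝ ∞ σ (Ioo (-ε) ε) ∧
      (∀ t ∈ Ioo (-ε) ε, 0 < ρ t) ∧ (∀ t ∈ Ioo (-ε) ε, 0 < σ t) ∧
      (∀ x ∈ B, h 0 x (c • y x) (c • y x) = 1) ∧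
      ∀ t ∈ Ioo (-ε) ε, ∀ x ∈ B, ∀ a b, h t x a b =
        ρ t ^ 2 * (h 0 x a (c • y x) * h 0 x b (c • y x))
        + σ t ^ 2 * (h 0 x a b - h 0 x a (c • y x) * h 0 x b (c • y x)) := by
  obtain ⟨x₁, hx₁⟩ := hB
  let U : ℝ → ℝ := fun t => h t x₁ (y x₁) (y x₁)
  have hU {t : ℝ} (ht : t ∈ Ioo (-ε) ε) : 0 < U t := hpos t ht x₁ hx₁ _ (hy x₁ hx₁)
  have hU' {t : ℝ} (ht : t ∈ Ioo (-ε) ε) {x : V} (hx : x ∈ B) : h t x (y x) (y x) = U t :=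
    hu t ht x hx x₁ hx₁
  have hP {t : ℝ} (ht : t ∈ Ioo (-ε) ε) {x : V} (hx : x ∈ B) (b : V) :
      h t x (y x) b * U 0 = h 0 x (y x) b * U t := by
    have h1 := mul_eq_mul_of_hasDerivAt (f := fun s => h s x (y x) b)
      (g := fun s => h s x (y x) (y x)) h0 (fun s hs => hlam s hs x hx b)
      (fun s hs => hlam s hs x hx (y x)) (fun s hs => (hpos s hs x hx _ (hy x hx)).ne') ht
    simpa only [hU' ht hx, hU' h0 hx] using h1
  have hQ {t : ℝ} (ht : t ∈ Ioo (-ε) ε) {x : V} (hx : x ∈ B) {a : V} (ha : h 0 x (y x) a = 0) :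
      h t x (y x) a = 0 := by
    have h1 := hP ht hx a
    rw [ha, zero_mul] at h1
    exact (mul_eq_zero.1 h1).resolve_right (hU h0).ne'
  -- The scaling function of the complement of `y`, which is arbitrary if that complement is zero.
  obtain ⟨S, hSs, hSpos, hS⟩ : ∃ S : ℝ → ℝ, ContDiffOn ℝ ∞ S (Ioo (-ε) ε) ∧
      (∀ t ∈ Ioo (-ε) ε, 0 < S t) ∧ ∀ t ∈ Ioo (-ε) ε, ∀ x ∈ B, ∀ a, h 0 x (y x) a = 0 →
        ∀ b, h t x a b = S t * h 0 x a b := by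
    by_cases hex : ∃ x₂ ∈ B, ∃ a₂, a₂ ≠ 0 ∧ h 0 x₂ (y x₂) a₂ = 0
    · obtain ⟨x₂, hx₂, a₂, ha₂, hya₂⟩ := hex
      refine ⟨fun t => h t x₂ a₂ a₂ / h 0 x₂ a₂ a₂, (hsm x₂ hx₂ a₂).div_const _,
        fun t ht => div_pos (hpos t ht x₂ hx₂ _ ha₂) (hpos 0 h0 x₂ hx₂ _ ha₂),
        fun t ht x hx a ha b => ?_⟩
      have h1 := mul_eq_mul_of_hasDerivAt (f := fun s => h s x a b)
        (g := fun s => h s x₂ a₂ a₂) h0 (fun s hs => hmu s hs x hx a (hQ hs hx ha) b)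
        (fun s hs => hmu s hs x₂ hx₂ a₂ (hQ hs hx₂ hya₂) a₂)
        (fun s hs => (hpos s hs x₂ hx₂ _ ha₂).ne') ht
      have h2 := (hpos 0 h0 x₂ hx₂ _ ha₂).ne'
      field_simp
      linarith
    · refine ⟨fun _ => 1, contDiffOn_const, fun _ _ => one_pos, fun t ht x hx a ha b => ?_⟩
      have ha0 : a = 0 := by
        by_contra ha0
        exact hex ⟨x, hx, a, ha0, ha⟩
      simp [ha0]
  have hU0 := hU h0
  have hsq : (Real.sqrt (U 0))⁻¹ * (Real.sqrt (U 0))⁻¹ = (U 0)⁻¹ := by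
    rw [← mul_inv, Real.mul_self_sqrt hU0.le]
  have hρpos {t : ℝ} (ht : t ∈ Ioo (-ε) ε) : 0 < U t / U 0 := div_pos (hU ht) hU0
  -- `c` normalizes `y` at `t = 0`, and `ρ²` is the ratio of the squared lengths of `y`.
  refine ⟨(Real.sqrt (U 0))⁻¹, fun t => Real.sqrt (U t / U 0), fun t => Real.sqrt (S t),
    ((hsm x₁ hx₁ (y x₁)).div_const _).sqrt fun t ht => (hρpos ht).ne',
    hSs.sqrt fun t ht => (hSpos t ht).ne', fun t ht => Real.sqrt_pos.2 (hρpos ht),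
    fun t ht => Real.sqrt_pos.2 (hSpos t ht), fun x hx => ?_, fun t ht x hx a b => ?_⟩
  · simp only [map_smul, smul_apply, smul_eq_mul]
    rw [hU' h0 hx, ← mul_assoc, hsq, inv_mul_cancel₀ hU0.ne']
  · let α : ℝ := h 0 x (y x) a / U 0
    have ha : h 0 x (y x) (a - α • y x) = 0 := by
      rw [map_sub, map_smul, hU' h0 hx, smul_eq_mul, div_mul_cancel₀ _ hU0.ne', sub_self]
    have h1 := hS t ht x hx _ ha b
    have h2 := hP ht hx b
    simp only [map_sub, map_smul, sub_apply, smul_apply, smul_eq_mul] at h1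
    rw [Real.sq_sqrt (hρpos ht).le, Real.sq_sqrt (hSpos t ht).le]
    simp only [map_smul, smul_eq_mul]
    have h3 : (Real.sqrt (U 0))⁻¹ * h 0 x a (y x) * ((Real.sqrt (U 0))⁻¹ * h 0 x b (y x)) =
        α * h 0 x (y x) b := by
      rw [hsymm 0 h0 x hx a, hsymm 0 h0 x hx b]
      linear_combination h 0 x (y x) a * h 0 x (y x) b * hsq
    rw [h3]
    have h4 : h t x (y x) b = U t / U 0 * h 0 x (y x) b := by
      field_simp
      linarith
    rw [h4] at h1
    linear_combination h1

section Coordinates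

variable {E : Type*} [NormedAddCommGroup E] [NormedSpace ℝ E] [FiniteDimensional ℝ E]
  {H : Type*} [TopologicalSpace H] {I : ModelWithCorners ℝ E H}
  {M : Type u} [TopologicalSpace M] [ChartedSpace H M] [IsManifold I ∞ M]
  [RiemannianBundle (fun x : M => TangentSpace I x)]
  [IsContMDiffRiemannianBundle I ∞ E (fun x : M => TangentSpace I x)]
  {n : ℕ} {ν η : Π x : M, TangentSpace I x}

/-- A Killing field orthogonal to `ν` whose length is constant along the leaves of `ν^⊥` vanishes
everywhere if it vanishes somewhere. -/
theorem killing_ne_zero [I.Boundaryless] [ConnectedSpace M] (hν : IsUnitGeodesicField I ν)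
    (hint : IsIntegrable I (orthogonalDistribution I ν) n) (hη : IsKillingField I η)
    (hne : ∃ x, η x ≠ 0) (horth : ∀ x, (inner ℝ (η x) (ν x) : ℝ) = 0)
    (hlen : IsConstantAlongLeaves I (orthogonalDistribution I ν) n
      (fun x => Real.sqrt (inner ℝ (η x) (η x)))) (x : M) : η x ≠ 0 := by
  have hclosed : IsClosed {x : M | η x = 0} := by
    have h1 : Continuous fun x => (inner ℝ (η x) (η x) : ℝ) :=
      (show ContMDiff I 𝓘(ℝ, ℝ) ∞ _ from
        fun x => contMDiffAt_inner (hη.smooth x) (hη.smooth x)).continuous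
    have h2 : {x : M | η x = 0} = {x : M | (inner ℝ (η x) (η x) : ℝ) = 0} := by
      ext x
      exact inner_self_eq_zero.symm
    rw [h2]
    exact isClosed_eq h1 continuous_const
  have hopen : IsOpen {x : M | η x = 0} := by
    rw [isOpen_iff_mem_nhds]
    intro p hp
    obtain ⟨N, _, _, _, _, _, _, i, hi, y₀, rfl⟩ := hint p
    obtain ⟨φ, ε, r, x₀, hφ, h0⟩ := exists_isFlowBox hν.smooth hν.unit hi y₀
    have hx₀ : x₀ ∈ Metric.ball x₀ r := Metric.mem_ball_self hφ.radius_pos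
    have hmem := hφ.mem_source hφ.zero_mem hx₀
    have hz : ∀ x ∈ Metric.ball x₀ r, η (φ (0, x)) = 0 := by
      intro x hx
      have h1 := hφ.eq_of_isConstantAlongLeaves hν hlen hφ.zero_mem hx hx₀
      have h2 : η (φ (0, x₀)) = 0 := by rw [h0]; exact hp
      simp only [h2, inner_zero_left, Real.sqrt_zero] at h1
      exact inner_self_eq_zero.1 ((Real.sqrt_eq_zero real_inner_self_nonneg).1 h1)
    have hc : ∀ x ∈ Metric.ball x₀ r,
        (coordField φ η (0, x) : ℝ × EuclideanSpace ℝ (Fin n)) = 0 := by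
      intro x hx
      have hm := hφ.mem_source hφ.zero_mem hx
      obtain ⟨A, hA⟩ := isInvertible_mfderiv φ hm
      have h1 := mfderiv_coordField φ η hm
      rw [hz x hx, ← hA] at h1
      exact A.map_eq_zero_iff.1 h1
    have h1 : φ.target ∈ 𝓝 (i y₀) := by
      rw [← h0]
      exact φ.open_target.mem_nhds (φ.map_source hmem)
    filter_upwards [h1] with m hm
    have h2 : φ (φ.symm m) = m := φ.right_inv hm
    have h3 := φ.map_target hm
    have h4 := hφ.mem_of_mem_source h3
    have h5 := mfderiv_coordField φ η h3
    have h6 : (coordField φ η (φ.symm m) : ℝ × EuclideanSpace ℝ (Fin n)) = 0 := by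
      have h7 := hφ.coordField_eq hν hη horth h4.1 h4.2
      rw [hc _ h4.2] at h7
      exact h7
    have h8 : η (φ (φ.symm m)) = 0 := by
      refine h5.symm.trans ?_
      refine (congrArg (mfderiv 𝓘(ℝ, ℝ × EuclideanSpace ℝ (Fin n)) I φ (φ.symm m)) h6).trans ?_
      exact map_zero _
    rwa [h2] at h8
  obtain ⟨z, hz⟩ := hne
  intro hx
  have := (isClopen_iff.1 ⟨hclosed, hopen⟩).resolve_left (nonempty_iff_ne_empty.1 ⟨x, hx⟩)
  exact hz (this ▸ mem_univ z : z ∈ {x : M | η x = 0})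

end Coordinates

/-! ### Doubly warped products with given coefficients -/

namespace LiftedOpen

variable {V : Type} [NormedAddCommGroup V] [NormedSpace ℝ V] (O : TopologicalSpace.Opens V)
  [hO : Nonempty O] [FiniteDimensional ℝ V] (g : V → V →L[ℝ] V →L[ℝ] ℝ) (hg : ContDiffOn ℝ ∞ g O)
  (hs : ∀ x ∈ O, ∀ a b, g x a b = g x b a) (hp : ∀ x ∈ O, ∀ a, a ≠ 0 → 0 < g x a a)

/-- The vector field with given coefficients. -/
def field (y : V → V) (x : LiftedOpen.{u} O) : TangentSpace 𝓘(ℝ, V) x := (y (emb O x) : V)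

omit [FiniteDimensional ℝ V] in
theorem field_param (y : V → V) (x₀ : LiftedOpen.{u} O) {v : V} (hv : v ∈ O) :
    field O y (param O x₀ v) = mfderiv 𝓘(ℝ, V) 𝓘(ℝ, V) (param O x₀) v (y v) :=
  (congrArg y (emb_param O x₀ hv)).trans (mfderiv_param O x₀ hv (y v)).symm

theorem isKillingField_field {y : V → V} (hy : ContDiffOn ℝ ∞ y O)
    (hk : ∀ x ∈ O, ∀ a b, fderiv ℝ g x (y x) a b + g x (fderiv ℝ y x a) b
      + g x (fderiv ℝ y x b) a = 0) :
    letI : RiemannianBundle (fun x : LiftedOpen.{u} O => TangentSpace 𝓘(ℝ, V) x) :=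
      ⟨(metric O g hg hs hp).toRiemannianMetric⟩
    IsKillingField 𝓘(ℝ, V) (field.{u} O y) := by
  let : RiemannianBundle (fun x : LiftedOpen.{u} O => TangentSpace 𝓘(ℝ, V) x) :=
    ⟨(metric O g hg hs hp).toRiemannianMetric⟩
  have : CompleteSpace V := FiniteDimensional.complete ℝ V
  have hsrc (x : LiftedOpen.{u} O) : emb O x ∈ (param O x).source := by
    rw [param_source]
    exact x.down.2
  have hY (x : LiftedOpen.{u} O) : ∀ᶠ w in 𝓝 (emb O x),
      field O y (param O x w) = mfderiv 𝓘(ℝ, V) 𝓘(ℝ, V) (param O x) w (y w) := by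
    filter_upwards [O.isOpen.mem_nhds x.down.2] with w hw using field_param O y x hw
  refine ⟨fun x => ?_, fun x v w => ?_⟩
  · have h := contMDiffAt_of_coord (param O x) (hsrc x) (hY x)
      (hy.contDiffAt (O.isOpen.mem_nhds x.down.2))
    rwa [param_emb] at h
  · have key : ∀ z : LiftedOpen.{u} O, param O x (emb O x) = z →
        ∀ v w : TangentSpace 𝓘(ℝ, V) z, (inner ℝ (leviCivita 𝓘(ℝ, V) (field O y) z v) w +
          inner ℝ v (leviCivita 𝓘(ℝ, V) (field O y) z w) : ℝ) = 0 := by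
      rintro _ rfl v w
      obtain ⟨a, rfl⟩ := mfderiv_surjective (param O x) (hsrc x) v
      obtain ⟨b, rfl⟩ := mfderiv_surjective (param O x) (hsrc x) w
      rw [leviCivita_symmetrized_coord (param O x) (hsrc x)
        ((hy.contDiffAt (O.isOpen.mem_nhds x.down.2)).differentiableAt (by simp)) (hY x)]
      have h1 : coordMetric (param O x) =ᶠ[𝓝 (emb O x)] g := by
        filter_upwards [O.isOpen.mem_nhds x.down.2] with w hw
        ext a b
        exact coordMetric_param O g hg hs hp x hw a b
      rw [h1.fderiv_eq, h1.self_of_nhds]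
      exact hk _ x.down.2 a b
    exact key x (param_emb O x x) v w

end LiftedOpen

namespace DoublyWarpedProduct

variable {n : ℕ} (O : TopologicalSpace.Opens (EuclideanSpace ℝ (Fin n))) [Nonempty O]
  (hO : IsPreconnected (O : Set (EuclideanSpace ℝ (Fin n))))
  (g : EuclideanSpace ℝ (Fin n) → EuclideanSpace ℝ (Fin n) →L[ℝ] EuclideanSpace ℝ (Fin n) →L[ℝ] ℝ)
  (hg : ContDiffOn ℝ ∞ g O) (hs : ∀ x ∈ O, ∀ a b, g x a b = g x b a)
  (hp : ∀ x ∈ O, ∀ a, a ≠ 0 → 0 < g x a a)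
  (y : EuclideanSpace ℝ (Fin n) → EuclideanSpace ℝ (Fin n)) (hy : ContDiffOn ℝ ∞ y O)
  (hk : ∀ x ∈ O, ∀ a b, fderiv ℝ g x (y x) a b + g x (fderiv ℝ y x a) b
      + g x (fderiv ℝ y x b) a = 0)
  (hy1 : ∀ x ∈ O, g x (y x) (y x) = 1) {ε : ℝ} (hε : 0 < ε) {ρ σ : ℝ → ℝ}
  (hρ : ContDiffOn ℝ ∞ ρ (Ioo (-ε) ε)) (hσ : ContDiffOn ℝ ∞ σ (Ioo (-ε) ε))
  (hρ0 : ∀ t ∈ Ioo (-ε) ε, 0 < ρ t) (hσ0 : ∀ t ∈ Ioo (-ε) ε, 0 < σ t)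

/-- The doubly warped product over an open subset of `ℝⁿ` with given metric coefficients. -/
def ofCoordinates : DoublyWarpedProduct.{u} n where
  Mhat := LiftedOpen.{u} O
  connectedSpace := LiftedOpen.connectedSpace O hO
  riemannianBundle := ⟨(LiftedOpen.metric O g hg hs hp).toRiemannianMetric⟩
  etahat := LiftedOpen.field O y
  killing := LiftedOpen.isKillingField_field O g hg hs hp hy hk
  unit := fun x => hy1 _ x.down.2
  interval := ⟨Ioo (-ε) ε, isOpen_Ioo⟩
  interval_nonempty := ⟨0, neg_lt_zero.2 hε, hε⟩
  interval_ordConnected := ordConnected_Ioo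
  rho := ρ
  sigma := σ
  rho_smooth := hρ
  sigma_smooth := hσ
  rho_pos := hρ0
  sigma_pos := hσ0

variable {M : Type*} [TopologicalSpace M]
  [ChartedSpace (EuclideanSpace ℝ (Fin (n + 1))) M] [IsManifold (𝓡 (n + 1)) ∞ M]
  [RiemannianBundle (fun x : M => TangentSpace (𝓡 (n + 1)) x)]

/-- A parametrization in which the metric has the coefficients of a doubly warped product is an
isometry of that doubly warped product. -/
theorem isIsometricTo_ofCoordinates (φ : PartialDiffeomorph
      𝓘(ℝ, ℝ × EuclideanSpace ℝ (Fin n)) (𝓡 (n + 1)) (ℝ × EuclideanSpace ℝ (Fin n)) M ∞)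
    (hsrc : φ.source = Ioo (-ε) ε ×ˢ (O : Set (EuclideanSpace ℝ (Fin n))))
    (hφ : ∀ u ∈ φ.source, ∀ a b, coordMetric φ u a b = warpedForm ρ σ g y u a b) :
    (ofCoordinates.{u} O hO g hg hs hp y hy hk hy1 hε hρ hσ hρ0 hσ0).IsIsometricTo φ.target := by
  set D := ofCoordinates.{u} O hO g hg hs hp y hy hk hy1 hε hρ hσ hρ0 hσ0 with hD
  let F : D.Carrier → ℝ × EuclideanSpace ℝ (Fin n) := fun q => ((q.1 : ℝ), LiftedOpen.emb O q.2)
  have hF (q : D.Carrier) : F q ∈ φ.source := by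
    rw [hsrc]
    exact ⟨q.1.2, q.2.down.2⟩
  have hFinj : Injective F := fun q q' h =>
    Prod.ext (Subtype.ext (congrArg Prod.fst h))
      ((LiftedOpen.isOpenEmbedding_emb O).injective (congrArg Prod.snd h))
  have hchart (q : D.Carrier) : ((D.carrierParam q).symm : D.Carrier → _) = F := by
    funext q'
    have h : (D.carrierParam q).symm q' = extChartAt (𝓘(ℝ, ℝ).prod (𝓡 n)) q q' := rfl
    rw [h, extChartAt_prod]
    exact Prod.ext (D.extChartAt_interval q.1 q'.1) rfl
  have hdF (q : D.Carrier) (v : TangentSpace (𝓘(ℝ, ℝ).prod (𝓡 n)) q) :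
      MDifferentiableAt (𝓘(ℝ, ℝ).prod (𝓡 n)) 𝓘(ℝ, ℝ × EuclideanSpace ℝ (Fin n)) F q ∧
      (mfderiv (𝓘(ℝ, ℝ).prod (𝓡 n)) 𝓘(ℝ, ℝ × EuclideanSpace ℝ (Fin n)) F q v :
        ℝ × EuclideanSpace ℝ (Fin n)) = (D.dt q v, (D.dproj q v : EuclideanSpace ℝ (Fin n))) := by
    have h1 := (D.mdifferentiableAt_interval_coord q).hasMFDerivAt
    have h2 := HasMFDerivAt.comp q (g := LiftedOpen.emb O)
      ((LiftedOpen.contMDiff_emb.{u} O).mdifferentiable (by simp) q.2).hasMFDerivAt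
      ((contMDiff_snd (n := ∞) (M := D.interval) (N := D.Mhat)
        (I := 𝓘(ℝ, ℝ)) (J := 𝓡 n)).contMDiffAt.mdifferentiableAt
        (x := q) (by simp)).hasMFDerivAt
    have h3 : MDifferentiableAt (𝓘(ℝ, ℝ).prod (𝓡 n)) 𝓘(ℝ, ℝ × EuclideanSpace ℝ (Fin n)) F q :=
      h1.mdifferentiableAt.prodMk_space h2.mdifferentiableAt
    have h4 := HasMFDerivAt.comp q
      (hasFDerivAt_fst (𝕜 := ℝ) (p := F q)).hasMFDerivAt h3.hasMFDerivAt
    have h5 := HasMFDerivAt.comp q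
      (hasFDerivAt_snd (𝕜 := ℝ) (p := F q)).hasMFDerivAt h3.hasMFDerivAt
    refine ⟨h3, Prod.ext (DFunLike.congr_fun (hasMFDerivAt_unique h4 h1) v) ?_⟩
    exact (DFunLike.congr_fun (hasMFDerivAt_unique h5 h2) v).trans
      (DFunLike.congr_fun (LiftedOpen.mfderiv_emb.{u} O q.2) _)
  refine ⟨φ ∘ F, fun q => ?_, fun q q' h => hFinj (φ.injOn (hF q) (hF q') h), ?_,
    fun q v w => ?_⟩
  · have h := PartialDiffeomorph.isLocalDiffeomorphAt _ _ _ ((D.carrierParam q).symm.trans φ)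
      (x := q) ⟨D.mem_target_carrierParam q, by
        have h1 : (D.carrierParam q).symm q ∈ φ.source := by rw [hchart]; exact hF q
        exact h1⟩
    have h2 : (((D.carrierParam q).symm.trans φ : PartialDiffeomorph _ _ _ _ _) : D.Carrier → M) =
        φ ∘ F := congrArg (fun f => φ ∘ f) (hchart q)
    rwa [h2] at h
  · ext m
    constructor
    · rintro ⟨q, rfl⟩
      exact φ.map_source (hF q)
    · intro hm
      have h1 : φ.symm m ∈ φ.source := φ.map_target hm
      have h2 : φ (φ.symm m) = m := φ.right_inv hm
      rw [hsrc] at h1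
      exact ⟨(⟨(φ.symm m).1, h1.1⟩, LiftedOpen.mk O (φ.symm m).2 h1.2), h2⟩
  · have h1 (v : TangentSpace (𝓘(ℝ, ℝ).prod (𝓡 n)) q) :
        mfderiv (𝓘(ℝ, ℝ).prod (𝓡 n)) (𝓡 (n + 1)) (φ ∘ F) q v =
        mfderiv 𝓘(ℝ, ℝ × EuclideanSpace ℝ (Fin n)) (𝓡 (n + 1)) φ (F q)
          ((D.dt q v, (D.dproj q v : EuclideanSpace ℝ (Fin n))) :
            ℝ × EuclideanSpace ℝ (Fin n)) := by
      have h2 := mfderiv_comp q (φ.mdifferentiableAt (by simp) (hF q)) (hdF q v).1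
      exact (DFunLike.congr_fun h2 v).trans
        (congrArg (mfderiv 𝓘(ℝ, ℝ × EuclideanSpace ℝ (Fin n)) (𝓡 (n + 1)) φ (F q)) (hdF q v).2)
    rw [h1 v, h1 w]
    exact hφ (F q) (hF q) _ _

end DoublyWarpedProduct

/-! ### Warped form of the metric in a flow box -/

section SliceMetric

variable {E : Type*} [NormedAddCommGroup E] [NormedSpace ℝ E] [FiniteDimensional ℝ E]
  {H : Type*} [TopologicalSpace H] {I : ModelWithCorners ℝ E H}
  {M : Type*} [TopologicalSpace M] [ChartedSpace H M] [IsManifold I ∞ M]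
  [RiemannianBundle (fun x : M => TangentSpace I x)]
  [IsContMDiffRiemannianBundle I ∞ E (fun x : M => TangentSpace I x)]
  {V : Type*} [NormedAddCommGroup V] [NormedSpace ℝ V] [FiniteDimensional ℝ V]
  {ν η : Π x : M, TangentSpace I x} {φ : PartialDiffeomorph 𝓘(ℝ, ℝ × V) I (ℝ × V) M ∞}
  {ε r : ℝ} {x₀ : V}

variable (φ) in
/-- The metric induced on the slice `{t} × V` of the parametrization `φ`. -/
def sliceMetric (t : ℝ) (x : V) : V →L[ℝ] V →L[ℝ] ℝ :=
  (coordMetric φ (t, x)).bilinearComp (ContinuousLinearMap.inr ℝ ℝ V)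
    (ContinuousLinearMap.inr ℝ ℝ V)

omit [FiniteDimensional ℝ E] [IsManifold I ∞ M]
  [IsContMDiffRiemannianBundle I ∞ E (fun x : M => TangentSpace I x)] [FiniteDimensional ℝ V] in
theorem sliceMetric_apply (t : ℝ) (x a b : V) :
    sliceMetric φ t x a b = coordMetric φ (t, x) (0, a) (0, b) := rfl

variable (hφ : IsFlowBox ν φ ε r x₀)

include hφ

namespace IsFlowBox

theorem contDiffOn_sliceMetric {t : ℝ} (ht : t ∈ Ioo (-ε) ε) :
    ContDiffOn ℝ ∞ (sliceMetric φ t) (Metric.ball x₀ r) := by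
  rw [contDiffOn_clm_apply]
  intro a
  rw [contDiffOn_clm_apply]
  intro b
  have h1 : ContDiffOn ℝ ∞ (fun x => coordMetric φ (t, x)) (Metric.ball x₀ r) :=
    (contDiffOn_coordMetric φ).comp (contDiff_prodMk_right t).contDiffOn
      fun x hx => hφ.mem_source ht hx
  exact (h1.clm_apply contDiffOn_const).clm_apply contDiffOn_const

theorem contDiffOn_sliceMetric_apply {x : V} (hx : x ∈ Metric.ball x₀ r) (a : V) :
    ContDiffOn ℝ ∞ (fun t => sliceMetric φ t x a a) (Ioo (-ε) ε) := by
  have h1 : ContDiffOn ℝ ∞ (fun t => coordMetric φ (t, x)) (Ioo (-ε) ε) :=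
    (contDiffOn_coordMetric φ).comp (contDiff_prodMk_left x).contDiffOn
      fun t ht => hφ.mem_source ht hx
  exact (h1.clm_apply contDiffOn_const).clm_apply contDiffOn_const

theorem coordMetric_eq (hν : IsUnitGeodesicField I ν) {t : ℝ} {x : V} (ht : t ∈ Ioo (-ε) ε)
    (hx : x ∈ Metric.ball x₀ r) (a b : ℝ × V) :
    coordMetric φ (t, x) a b = a.1 * b.1 + sliceMetric φ t x a.2 b.2 := by
  have hu := hφ.mem_source ht hx
  have hdec (c : ℝ × V) : c = c.1 • ((1, 0) : ℝ × V) + (0, c.2) := by ext <;> simp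
  have h1 : coordMetric φ (t, x) ((0, a.2) : ℝ × V) (1, 0) = 0 := by
    rw [coordMetric_symm, hφ.coordMetric_fst hν hu]
  have h2 : coordMetric φ (t, x) ((0, a.2) : ℝ × V) b = sliceMetric φ t x a.2 b.2 := by
    conv_lhs => rw [hdec b]
    rw [map_add, map_smul, h1, smul_zero, zero_add, sliceMetric_apply]
  conv_lhs => rw [hdec a]
  rw [map_add, map_smul, add_apply, smul_apply, hφ.coordMetric_fst hν hu, h2, smul_eq_mul]

theorem hasDerivAt_sliceMetric (hν : IsUnitGeodesicField I ν) {t : ℝ} {x : V}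
    (ht : t ∈ Ioo (-ε) ε) (hx : x ∈ Metric.ball x₀ r) {a : V} {k : ℝ}
    (ha : weingarten I ν (φ (t, x)) (mfderiv 𝓘(ℝ, ℝ × V) I φ (t, x) ((0, a) : ℝ × V)) =
      (k • (mfderiv 𝓘(ℝ, ℝ × V) I φ (t, x) ((0, a) : ℝ × V)) : TangentSpace I (φ (t, x)))) (b : V) :
    HasDerivAt (fun s => sliceMetric φ s x a b) (-2 * k * sliceMetric φ t x a b) t := by
  have hu := hφ.mem_source ht hx
  have h1 := fderiv_bilin_fst (differentiableAt_coordMetric φ hu) (0, a) (0, b)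
  rw [hφ.fderiv_coordMetric_fst hν hu, ha, inner_smul_left, conj_trivial, ← mul_assoc] at h1
  exact h1

theorem contDiffOn_coordField_snd (hη : IsKillingField I η) : ContDiffOn ℝ ∞
    (fun x => (coordField φ η (0, x) : ℝ × V).2) (Metric.ball x₀ r) := fun x hx =>
  ((contDiffAt_snd.comp _ (contDiffAt_coordField φ (hφ.mem_source hφ.zero_mem hx)
    (hη.smooth _))).comp x (contDiff_prodMk_right (0 : ℝ)).contDiffAt).contDiffWithinAt

/-- A Killing field orthogonal to `ν` restricts to a Killing field of the slices. -/
theorem killing_slice (hν : IsUnitGeodesicField I ν) (hη : IsKillingField I η)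
    (horth : ∀ x, (inner ℝ (η x) (ν x) : ℝ) = 0) {x : V} (hx : x ∈ Metric.ball x₀ r) (a b : V) :
    fderiv ℝ (sliceMetric φ 0) x (coordField φ η (0, x) : ℝ × V).2 a b
      + sliceMetric φ 0 x (fderiv ℝ (fun x => (coordField φ η (0, x) : ℝ × V).2) x a) b
      + sliceMetric φ 0 x (fderiv ℝ (fun x => (coordField φ η (0, x) : ℝ × V).2) x b) a = 0 := by
  have hu := hφ.mem_source hφ.zero_mem hx
  have hg : DifferentiableAt ℝ (sliceMetric φ 0) x :=
    ((hφ.contDiffOn_sliceMetric hφ.zero_mem).contDiffAt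
      (Metric.isOpen_ball.mem_nhds hx)).differentiableAt (by simp)
  have hinr : HasFDerivAt (fun x : V => ((0 : ℝ), x)) (ContinuousLinearMap.inr ℝ ℝ V) x :=
    (hasFDerivAt_const _ _).prodMk (hasFDerivAt_id _)
  have hc : HasFDerivAt (fun x : V => (coordField φ η (0, x) : ℝ × V))
      ((fderiv ℝ (coordField φ η) (0, x)).comp (ContinuousLinearMap.inr ℝ ℝ V)) x :=
    HasFDerivAt.comp x (g := coordField φ η) (differentiableAt_coordField hη hu).hasFDerivAt hinr
  have h1 (c : V) : fderiv ℝ (coordField φ η) (0, x) (0, c) =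
      ((0, fderiv ℝ (fun x => (coordField φ η (0, x) : ℝ × V).2) x c) : ℝ × V) := by
    refine Prod.ext ?_ (DFunLike.congr_fun hc.snd.fderiv c).symm
    have h2 : (fun x : V => (coordField φ η (0, x) : ℝ × V).1) =ᶠ[𝓝 x] fun _ => 0 := by
      filter_upwards [Metric.isOpen_ball.mem_nhds hx] with z hz
      exact hφ.coordField_fst hν horth (hφ.mem_source hφ.zero_mem hz)
    exact DFunLike.congr_fun
      (hc.fst.unique ((hasFDerivAt_const (0 : ℝ) x).congr_of_eventuallyEq h2)) c
  have h3 : (coordField φ η (0, x) : ℝ × V) = (0, (coordField φ η (0, x) : ℝ × V).2) :=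
    Prod.ext (hφ.coordField_fst hν horth hu) rfl
  have h4 := killing_coordField hη hu (0, a) (0, b)
  rw [h1, h1, h3, fderiv_bilin_snd (differentiableAt_coordMetric φ hu)] at h4
  rw [← fderiv_bilin_const_apply hg]
  exact h4

end IsFlowBox

end SliceMetric

variable {n : ℕ} {M : Type u} [TopologicalSpace M]
  [ChartedSpace (EuclideanSpace ℝ (Fin (n + 1))) M] [IsManifold (𝓡 (n + 1)) ∞ M]
  [RiemannianBundle (fun x : M => TangentSpace (𝓡 (n + 1)) x)]
  [IsContMDiffRiemannianBundle (𝓡 (n + 1)) ∞ (EuclideanSpace ℝ (Fin (n + 1)))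
      (fun x : M => TangentSpace (𝓡 (n + 1)) x)]

set_option synthInstance.maxHeartbeats 200000 in
/-- A Riemannian manifold with a local DWP-structure is locally a doubly warped product. -/
theorem IsLocalDWPStructure.exists_isIsometricTo [ConnectedSpace M]
    {ν η : Π x : M, TangentSpace (𝓡 (n + 1)) x} (h : IsLocalDWPStructure ν η) (p : M) :
    ∃ U : Set M, IsOpen U ∧ p ∈ U ∧ ∃ D : DoublyWarpedProduct.{u} n, D.IsIsometricTo U := by
  have hν := h.unitGeodesic
  have hη := h.killing
  have hη0 := killing_ne_zero hν h.integrable hη h.nontrivial h.orthogonal h.length_const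
  obtain ⟨lam, mu, hlam, hmu, hlamc, hmuc⟩ := h.weingarten_eigen
  obtain ⟨N, _, _, _, _, _, _, i, hi, y₀, rfl⟩ := h.integrable p
  obtain ⟨φ, ε, r, x₀, hφ, h0⟩ := exists_isFlowBox hν.smooth hν.unit hi y₀
  have hx₀ : x₀ ∈ Metric.ball x₀ r := Metric.mem_ball_self hφ.radius_pos
  let y : EuclideanSpace ℝ (Fin n) → EuclideanSpace ℝ (Fin n) := fun x =>
    (coordField φ η (0, x) : ℝ × EuclideanSpace ℝ (Fin n)).2
  have hηφ {t : ℝ} (ht : t ∈ Ioo (-ε) ε) {x} (hx : x ∈ Metric.ball x₀ r) : η (φ (t, x)) =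
      mfderiv 𝓘(ℝ, ℝ × EuclideanSpace ℝ (Fin n)) (𝓡 (n + 1)) φ (t, x)
        ((0, y x) : ℝ × EuclideanSpace ℝ (Fin n)) := by
    rw [← mfderiv_coordField φ η (hφ.mem_source ht hx), hφ.coordField_eq hν hη h.orthogonal ht hx]
  have hηη {t : ℝ} (ht : t ∈ Ioo (-ε) ε) {x} (hx : x ∈ Metric.ball x₀ r) :
      sliceMetric φ t x (y x) (y x) = inner ℝ (η (φ (t, x))) (η (φ (t, x))) := by
    rw [hηφ ht hx]
    rfl
  have hpos : ∀ t ∈ Ioo (-ε) ε, ∀ x ∈ Metric.ball x₀ r, ∀ a, a ≠ 0 →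
      0 < sliceMetric φ t x a a := fun t ht x hx a ha =>
    coordMetric_self_pos φ (hφ.mem_source ht hx) fun h => ha (congrArg Prod.snd h)
  have hsymm (t : ℝ) (x a b) : sliceMetric φ t x a b = sliceMetric φ t x b a :=
    coordMetric_symm φ _ _ _
  obtain ⟨c, ρ, σ, hρ, hσ, hρ0, hσ0, hc, hw⟩ := exists_warping (h := sliceMetric φ) (y := y)
    (lam := fun t => -2 * lam (φ (t, x₀))) (mu := fun t => -2 * mu (φ (t, x₀)))
    ⟨x₀, hx₀⟩ hφ.zero_mem (fun t _ x _ => hsymm t x) hpos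
    (fun x hx hyx => by
      have h1 := hηη hφ.zero_mem hx
      rw [hyx, map_zero] at h1
      exact hη0 _ (inner_self_eq_zero.1 h1.symm))
    (fun t ht x hx x' hx' => by
      have h1 := hφ.eq_of_isConstantAlongLeaves hν h.length_const ht hx hx'
      rw [hηη ht hx, hηη ht hx']
      exact (Real.sqrt_inj real_inner_self_nonneg real_inner_self_nonneg).1 h1)
    (fun x hx => hφ.contDiffOn_sliceMetric_apply hx)
    (fun t ht x hx b => by
      refine hφ.hasDerivAt_sliceMetric hν ht hx ?_ b
      rw [hφ.eq_of_isConstantAlongLeaves hν hlamc ht hx₀ hx]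
      refine hlam _ _ ?_
      rw [hηφ ht hx]
      exact Submodule.mem_span_singleton_self _)
    (fun t ht x hx a ha b => by
      refine hφ.hasDerivAt_sliceMetric hν ht hx ?_ b
      rw [hφ.eq_of_isConstantAlongLeaves hν hmuc ht hx₀ hx]
      refine hmu _ _ ⟨?_, ?_⟩
      · rw [SetLike.mem_coe, Submodule.mem_orthogonal_singleton_iff_inner_right, hηφ ht hx]
        exact ha
      · exact (hφ.mem_orthogonalDistribution_iff hν (hφ.mem_source ht hx) (0, a)).2 rfl)
  have := hφ.nonempty_ballOpens
  have hys := hφ.contDiffOn_coordField_snd hη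
  refine ⟨φ.target, φ.open_target, h0 ▸ φ.map_source (hφ.mem_source hφ.zero_mem hx₀), _,
    DoublyWarpedProduct.isIsometricTo_ofCoordinates.{u} (ballOpens x₀ r)
      (convex_ball x₀ r).isPreconnected (sliceMetric φ 0) (hφ.contDiffOn_sliceMetric hφ.zero_mem)
      (fun x _ => hsymm 0 x) (hpos 0 hφ.zero_mem) (fun x => c • y x) (hys.const_smul c) ?_ hc
      hφ.eps_pos hρ hσ hρ0 hσ0 φ hφ.source_eq ?_⟩
  · intro x hx a b
    have hd : DifferentiableAt ℝ y x :=
      (hys.contDiffAt (Metric.isOpen_ball.mem_nhds hx)).differentiableAt (by simp)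
    have h1 := hφ.killing_slice hν hη h.orthogonal hx a b
    rw [fderiv_fun_const_smul hd c]
    simp only [map_smul, smul_apply, smul_eq_mul]
    linear_combination c * h1
  · intro u hu a b
    obtain ⟨ht, hx⟩ := hφ.mem_of_mem_source hu
    have h1 := hφ.coordMetric_eq hν ht hx a b
    rw [hw u.1 ht u.2 hx] at h1
    refine h1.trans ?_
    rw [warpedForm]
    ring

end

end DWP


theorem mainTheorem8 {n : ℕ} {M : Type u} [TopologicalSpace M]
    [ChartedSpace (EuclideanSpace ℝ (Fin (n + 1))) M] [IsManifold (𝓡 (n + 1)) ∞ M]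
    [T2Space M] [SecondCountableTopology M] [ConnectedSpace M]
    [RiemannianBundle (fun x : M => TangentSpace (𝓡 (n + 1)) x)]
    [IsContMDiffRiemannianBundle (𝓡 (n + 1)) ∞ (EuclideanSpace ℝ (Fin (n + 1)))
      (fun x : M => TangentSpace (𝓡 (n + 1)) x)] :
    ((∃ D : DWP.DoublyWarpedProduct.{u} n, D.IsIsometricTo (Set.univ : Set M)) →
      ∃ ν η : Π x : M, TangentSpace (𝓡 (n + 1)) x, DWP.IsLocalDWPStructure ν η) ∧
    ((∃ ν η : Π x : M, TangentSpace (𝓡 (n + 1)) x, DWP.IsLocalDWPStructure ν η) →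
      ∀ p : M, ∃ U : Set M, IsOpen U ∧ p ∈ U ∧
        ∃ D : DWP.DoublyWarpedProduct.{u} n, D.IsIsometricTo U) := by
  refine ⟨fun ⟨D, hD⟩ => D.exists_isLocalDWPStructure hD, fun ⟨ν, η, h⟩ p => ?_⟩
  exact h.exists_isIsometricTo p
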